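/- **Theorem (Exponential stability of the closed-loop system on a sector).** Let $\epsilon>0$, $c>0$, $R>0$, $\theta_1<\theta_2$, and let $\lambda\in\mathbb R$ with $c+\lambda\ge 0$. Let $\Omega$ be the sector $\{(r,\theta): 0<r<R,\ \theta_1<\theta<\theta_2\}$ in polar coordinates, with area element $r\,dr\,d\theta$, so that $\|v\|_{L^2(\Omega)}^2=\int_0^R\int_{\theta_1}^{\theta_2}v^2\,r\,d\theta\,dr$. Consider $$u_t=\epsilon\Big(u_{rr}+\tfrac1r u_r+\tfrac1{r^2}u_{\theta\theta}\Big)+\lambda u,\qquad u(t,r,\theta_1)=u(t,r,\theta_2)=0,\qquad u(t,R,\theta)=U(t,\theta),$$ with the feedback law $$U(t,\theta)=-\int_0^R\int_{\theta_1}^{\theta_2}K(R,\rho,\theta,\eta)\,u(t,\rho,\eta)\,d\eta\,d\rho,$$ $$K(r,\rho,\theta,\eta)=\frac{2}{\theta_2-\theta_1}\sum_{n=1}^N\frac{c+\lambda}{\epsilon}\,\rho\Big(\frac{\rho}{r}\Big)^{\frac{n\pi}{\theta_2-\theta_1}}\frac{I_1\big[\sqrt{\frac{c+\lambda}{\epsilon}(r^2-\rho^2)}\big]}{\sqrt{\frac{c+\lambda}{\epsilon}(r^2-\rho^2)}}\,\sin\Big(\frac{n\pi(\eta-\theta_1)}{\theta_2-\theta_1}\Big)\sin\Big(\frac{n\pi(\theta-\theta_1)}{\theta_2-\theta_1}\Big),$$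 where $I_1$ is the modified Bessel function of the first kind of order one. Suppose that the number $N\in\mathbb N$ of controlled modes satisfies $$N>\sqrt{\frac{c+\lambda}{\epsilon}}\;\frac{(\theta_2-\theta_1)R}{\pi}.$$ Then the zero equilibrium of the closed loop is exponentially stable in $L^2(\Omega)$ with decay rate $c$: there is a constant $M>0$, depending only on $\epsilon,\lambda,c,R,\theta_1,\theta_2,N$, such that every weak solution $u\in C([0,\infty);L^2(\Omega))\cap L^2_{\mathrm{loc}}((0,\infty);H^1(\Omega))$ of the closed loop, with arbitrary initial value $u(0)\in L^2(\Omega)$, satisfies $$\|u(t,\cdot,\cdot)\|_{L^2(\Omega)}\le M e^{-ct}\,\|u(0,\cdot,\cdot)\|_{L^2(\Omega)}\qquad\text{for all }t\ge 0.$$ Here $u$ is a weak solution if the boundary values hold in the $H^1$ sense for almost every $t>0$ ($u(t)$ minus the $H^1$ function $(r/R)\,U(t,\theta)$ lies in $H^1_0(\Omega)$, the $H^1$-closure of $C_c^\infty(\Omega)$) and, for all $\varphi\in C_c^\infty(\Omega)$ and $0<s\le t$, $$\int_\Omega u(t)\varphi-\int_\Omega u(s)\varphi=\int_s^t\Big(-\epsilon\int_\Omega\nabla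 u(\tau)\cdot\nabla\varphi+\lambda\int_\Omega u(\tau)\varphi\Big)d\tau .$$ -/

import Mathlib

open MeasureTheory Set
open scoped ContDiff

noncomputable section

namespace Sector

/-- The open sector of radius `R` between the angles `θ₁` and `θ₂`, in polar coordinates
`p = (r, θ)`. -/
def domain (R θ₁ θ₂ : ℝ) : Set (ℝ × ℝ) := Ioo 0 R ×ˢ Ioo θ₁ θ₂

/-- The area measure `r dr dθ` of the sector. -/
def area (R θ₁ θ₂ : ℝ) : Measure (ℝ × ℝ) :=
  (volume.restrict (domain R θ₁ θ₂)).withDensity (fun p => ENNReal.ofReal p.1)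

/-- The Hilbert space `L²(Ω)` of the sector `Ω`. -/
abbrev L2 (R θ₁ θ₂ : ℝ) : Type := Lp ℝ 2 (area R θ₁ θ₂)

/-- Radial derivative `∂φ/∂r`. -/
def dRad (φ : ℝ × ℝ → ℝ) (p : ℝ × ℝ) : ℝ := deriv (fun r => φ (r, p.2)) p.1

/-- Plain angular derivative `∂φ/∂θ`; the angular component of the gradient is `(1/r) ∂φ/∂θ`. -/
def dAng (φ : ℝ × ℝ → ℝ) (p : ℝ × ℝ) : ℝ := deriv (fun θ => φ (p.1, θ)) p.2

/-- Test functions: smooth with compact support inside the open sector. -/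
structure IsTest (R θ₁ θ₂ : ℝ) (φ : ℝ × ℝ → ℝ) : Prop where
  smooth : ContDiff ℝ ∞ φ
  compact : HasCompactSupport φ
  inside : tsupport φ ⊆ domain R θ₁ θ₂

/-- `(g, h)` is the weak gradient of `v` on the sector in the orthonormal polar frame, that is,
`g = ∂v/∂r` and `h = (1/r) ∂v/∂θ` in the sense of distributions. -/
structure HasWeakGradient (R θ₁ θ₂ : ℝ) (v g h : ℝ × ℝ → ℝ) : Prop where
  radial : ∀ φ, IsTest R θ₁ θ₂ φ →
    ∫ p in domain R θ₁ θ₂, v p * dRad φ p = -∫ p in domain R θ₁ θ₂, g p * φ p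
  angular : ∀ φ, IsTest R θ₁ θ₂ φ →
    ∫ p in domain R θ₁ θ₂, v p * dAng φ p = -∫ p in domain R θ₁ θ₂, p.1 * h p * φ p

/-- `v ∈ H¹₀(Ω)`: `v` and its weak gradient are in `L²(Ω)`, and `v` is a limit of test functions
in the norm of `H¹(Ω)`. -/
def MemH10 (R θ₁ θ₂ : ℝ) (v : ℝ × ℝ → ℝ) : Prop :=
  MemLp v 2 (area R θ₁ θ₂) ∧
  ∃ g h : ℝ × ℝ → ℝ, MemLp g 2 (area R θ₁ θ₂) ∧ MemLp h 2 (area R θ₁ θ₂) ∧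
    HasWeakGradient R θ₁ θ₂ v g h ∧
    ∀ δ : ENNReal, 0 < δ → ∃ φ, IsTest R θ₁ θ₂ φ ∧
      eLpNorm (fun p => v p - φ p) 2 (area R θ₁ θ₂) < δ ∧
      eLpNorm (fun p => g p - dRad φ p) 2 (area R θ₁ θ₂) < δ ∧
      eLpNorm (fun p => h p - dAng φ p / p.1) 2 (area R θ₁ θ₂) < δ

/-- Dirichlet conditions `v = 0` on the straight edges `θ = θ₁`, `θ = θ₂` and `v(R, θ) = b(θ)` on
the arc, for a `C¹` function `b` vanishing at `θ₁` and `θ₂`: `v` minus an `H¹` extension of the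
boundary values, here `(r / R) b(θ)`, lies in `H¹₀(Ω)`. -/
def HasBoundaryValues (R θ₁ θ₂ : ℝ) (b : ℝ → ℝ) (v : ℝ × ℝ → ℝ) : Prop :=
  MemH10 R θ₁ θ₂ (fun p => v p - p.1 / R * b p.2)

/-- The modified Bessel function of the first kind of order one. -/
def besselI1 (x : ℝ) : ℝ :=
  ∑' m : ℕ, (x / 2) ^ (2 * m + 1) / ((m.factorial : ℝ) * ((m + 1).factorial : ℝ))

/-- The angular eigenfunction `sin (n π (θ - θ₁) / (θ₂ - θ₁))`. -/
def angMode (θ₁ θ₂ : ℝ) (n : ℕ) (θ : ℝ) : ℝ :=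
  Real.sin (n * Real.pi * (θ - θ₁) / (θ₂ - θ₁))

/-- The backstepping kernel `kₙ(r, ρ)` of the `n`-th angular mode. The Bessel quotient extends
continuously to `ρ = r` (value `1/2`); the value at that single point plays no role below. -/
def kernel (ε lam c θ₁ θ₂ : ℝ) (n : ℕ) (r ρ : ℝ) : ℝ :=
  -((lam + c) / ε) * ρ * (ρ / r) ^ (n * Real.pi / (θ₂ - θ₁)) *
    (besselI1 (Real.sqrt ((lam + c) / ε * (r ^ 2 - ρ ^ 2))) /
      Real.sqrt ((lam + c) / ε * (r ^ 2 - ρ ^ 2)))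

/-- The kernel of the feedback law built from the first `N` modes. -/
def fullKernel (ε lam c θ₁ θ₂ : ℝ) (N : ℕ) (r ρ θ η : ℝ) : ℝ :=
  2 / (θ₂ - θ₁) * ∑ n ∈ Finset.Icc 1 N,
    -kernel ε lam c θ₁ θ₂ n r ρ * angMode θ₁ θ₂ n η * angMode θ₁ θ₂ n θ

/-- The feedback law `U(θ) = - ∫₀ᴿ ∫ K(R, ρ, θ, η) v(ρ, η) dη dρ`. The Jacobian factor `ρ` is part
of `K`. Equivalently the `n`-th sine coefficient of `U` is `∫₀ᴿ kₙ(R, ρ) vₙ(ρ) dρ` for `n ≤ N`, and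
`0` for `n > N`, where `vₙ` is the `n`-th sine coefficient of `v`. -/
def feedback (ε lam c R θ₁ θ₂ : ℝ) (N : ℕ) (v : ℝ × ℝ → ℝ) (θ : ℝ) : ℝ :=
  -∫ p in domain R θ₁ θ₂, fullKernel ε lam c θ₁ θ₂ N R p.1 θ p.2 * v p

/-- `u` is a (finite energy) weak solution on `t ≥ 0` of
`u_t = ε (u_rr + u_r / r + u_θθ / r²) + λ u` in the sector, `u = 0` on the straight edges, and
`u(t, R, θ) = U(t, θ)` on the arc, where `U(t, ·)` is the feedback law applied to `u(t)`:
`u ∈ C([0, ∞); L²(Ω)) ∩ L²_loc((0, ∞); H¹(Ω))`, with the equation tested against `φ ∈ C_c^∞(Ω)`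
and integrated over time intervals. The initial value is `u 0`, an arbitrary element of `L²(Ω)`. -/
def IsClosedLoopSolution (ε lam c R θ₁ θ₂ : ℝ) (N : ℕ) (u : ℝ → L2 R θ₁ θ₂) : Prop :=
  ContinuousOn u (Ici 0) ∧
  ∃ ur ua : ℝ → L2 R θ₁ θ₂,
    (∀ a b : ℝ, 0 < a → MemLp ur 2 (volume.restrict (Icc a b)) ∧
      MemLp ua 2 (volume.restrict (Icc a b))) ∧
    (∀ᵐ t ∂(volume.restrict (Ioi (0 : ℝ))),
      HasWeakGradient R θ₁ θ₂ (u t) (ur t) (ua t) ∧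
      HasBoundaryValues R θ₁ θ₂ (feedback ε lam c R θ₁ θ₂ N (u t)) (u t)) ∧
    ∀ φ, IsTest R θ₁ θ₂ φ → ∀ s t : ℝ, 0 < s → s ≤ t →
      (∫ p, u t p * φ p ∂(area R θ₁ θ₂)) - (∫ p, u s p * φ p ∂(area R θ₁ θ₂)) =
        ∫ τ in s..t,
          (-ε * (∫ p, (ur τ p * dRad φ p + ua τ p * (dAng φ p / p.1)) ∂(area R θ₁ θ₂)) +
            lam * (∫ p, u τ p * φ p ∂(area R θ₁ θ₂)))

end Sector

end

namespace Sector

open Filter Topology ContinuousLinearMap InnerProductSpace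

/-! ### Hilbert space: decay for the inverted equation, and exponentials of a commutator -/

section Abstract

variable {X : Type*} [NormedAddCommGroup X] [InnerProductSpace ℝ X] [CompleteSpace X]

/-! Sine modes in the angle split the problem into radial equations, one for each frequency μ =
nπ/(θ₂-θ₁), with the operator L = ∂_r² + (1/r)∂_r - μ²/r² and a boundary value at r = R that is the
feedback coefficient for n ≤ N and 0 for n > N. By Parseval it is enough to bound every mode by a
common constant times e^{-ct} times its initial norm (`norm_le_of_norm_mode_le`).

L factors as (∂_r + (1+μ)/r)(∂_r - μ/r). The left factor is inverted by H = `hOp`; the right one,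
with zero value at R, by -H*. Hence "Lf = g and f(R) = b" takes the form f = -Tg + b e with T = H*H
and e = (r/R)^μ. Only bounded operators on L²(r dr) occur here, so this form makes sense for weak
solutions: integrated over [s,t], the equation of a mode w becomes T(w(t) - w(s)) = -εW + εβe + λTW,
where W is the time integral of w and β the boundary value of W (`WeakRelation.mode_equation`).

Without the boundary term, Tw' = -εw + aTw forces decay at rate c as soon as a + c ≥ 0 and (a+c)‖H‖²
≤ ε (`norm_le_exp_mul_of_adjoint_comp_self_eq`). For n > N this applies with a = λ: one has ‖H‖ ≤
R/μ (`norm_hOp_le`), and the hypothesis on N gives the required inequality.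

For n ≤ N the backstepping transformation is exp(sV) with the Volterra operator V = 2rH. The key
fact is LV = VL + 4, together with the boundary value 2⟪e, f⟫ of Vf (`volterra_apply_of_eq`). It
implies L exp(sV) = exp(sV)(L + 4s), so s = (λ+c)/(4ε) turns the reaction coefficient λ into -c. The
boundary value of exp(sV)f is f(R) plus a series in ⟪e, V^m f⟫. Since (V*)^m e = (r/R)^μ
(R²-r²)^m/m!, this series sums to the Bessel kernel, and the feedback law is exactly what cancels it
(`hasSum_inner_volterra_pow`). The transformed mode then decays at rate c by the abstract lemma with
a = -c, and exp(sV) is invertible. The resulting constants depend on n, but only N modes need them.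
-/

theorem inner_adjoint_comp_self (H : X →L[ℝ] X) (x : X) :
    ⟪(adjoint H ∘L H) x, x⟫_ℝ = ‖H x‖ ^ 2 := by
  rw [ContinuousLinearMap.comp_apply, adjoint_inner_left, real_inner_self_eq_norm_sq]

/-- H*H + δ is coercive with constant δ, hence invertible, with an inverse of norm at most 1/δ. -/
theorem exists_resolvent (H : X →L[ℝ] X) {δ : ℝ} (hδ : 0 < δ) :
    ∃ S : X →L[ℝ] X, (∀ x, S ((adjoint H ∘L H) x) + δ • S x = x) ∧
      (∀ x, (adjoint H ∘L H) (S x) + δ • S x = x) ∧ ∀ x, δ * ‖S x‖ ≤ ‖x‖ := by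
  set T := adjoint H ∘L H
  have hpos : ∀ x, δ * ‖x‖ ^ 2 ≤ ⟪(T + δ • (1 : X →L[ℝ] X)) x, x⟫_ℝ := by
    intro x
    have h1 := inner_adjoint_comp_self H x
    rw [add_apply, inner_add_left, h1]
    simp only [smul_apply, one_apply_eq_self, inner_smul_left, real_inner_self_eq_norm_sq]
    simp
  have hu : IsUnit (T + δ • (1 : X →L[ℝ] X)) := by
    refine isUnit_of_forall_le_norm_inner_map _ (c := ⟨δ, hδ.le⟩) hδ fun x => ?_
    refine le_trans ?_ ((hpos x).trans (le_abs_self _))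
    exact (mul_comm _ _).le
  obtain ⟨u, hu⟩ := hu
  have h1 : ∀ x, (u⁻¹ : (X →L[ℝ] X)ˣ).1 (u.1 x) = x := fun x => by
    rw [← mul_apply_eq_comp, Units.inv_mul]; rfl
  have h2 : ∀ x, u.1 ((u⁻¹ : (X →L[ℝ] X)ˣ).1 x) = x := fun x => by
    rw [← mul_apply_eq_comp, Units.mul_inv]; rfl
  refine ⟨(u⁻¹ : (X →L[ℝ] X)ˣ).1, fun x => ?_, fun x => ?_, fun x => ?_⟩
  · have := h1 x
    rw [hu] at this
    simpa using this
  · have := h2 x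
    rw [hu] at this
    simpa using this
  · have h3 := hpos ((u⁻¹ : (X →L[ℝ] X)ˣ).1 x)
    rw [← hu, h2] at h3
    set y := (u⁻¹ : (X →L[ℝ] X)ˣ).1 x
    have h4 := h3.trans (real_inner_le_norm x y)
    rcases eq_or_lt_of_le (norm_nonneg y) with h | h
    · rw [← h]; simp
    · nlinarith

/-- Take S n = (T + δ)⁻¹ with T = H*H and δ = 1/(n+1). Then S n T x - x = -δ S n x. This is O(δ) for
x in the range of T, the range is dense because T is self-adjoint and injective, and ‖δ S n‖ ≤ 1
carries the convergence to the closure. -/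
theorem exists_approximate_inverse (H : X →L[ℝ] X) (hH : ∀ x, H x = 0 → x = 0) :
    ∃ S : ℕ → X →L[ℝ] X, (∀ n x, S n (adjoint H (H x)) = adjoint H (H (S n x))) ∧
      ∀ x, Tendsto (fun n => S n (adjoint H (H x))) atTop (𝓝 x) := by
  set T := adjoint H ∘L H with hT
  have hδ : ∀ n : ℕ, (0 : ℝ) < 1 / ((n : ℝ) + 1) := fun n => by positivity
  choose S hS1 hS2 hS3 using fun n : ℕ => exists_resolvent H (hδ n)
  refine ⟨S, fun n x => add_right_cancel ((hS1 n x).trans (hS2 n x).symm), fun x => ?_⟩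
  have hdense : Dense (T.range : Set X) := by
    rw [Submodule.dense_iff_topologicalClosure_eq_top,
      Submodule.topologicalClosure_eq_top_iff, orthogonal_range]
    have : adjoint T = T := by rw [hT, adjoint_comp, adjoint_adjoint]
    rw [this, Submodule.eq_bot_iff]
    intro y hy
    have hy' : T y = 0 := hy
    have h1 := inner_adjoint_comp_self H y
    rw [← hT, hy', inner_zero_left] at h1
    exact hH y (by simpa using h1.symm)
  rw [Metric.tendsto_atTop]
  intro η hη
  obtain ⟨_, hz, z, rfl⟩ := Metric.dense_iff.1 hdense x (η / 2) (half_pos hη)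
  have hz' : ‖x - T z‖ < η / 2 := by
    rw [Metric.mem_ball, dist_comm, dist_eq_norm] at hz; exact hz
  have hlim : Tendsto (fun n : ℕ => 1 / ((n : ℝ) + 1) * (2 * ‖z‖)) atTop (𝓝 (0 * (2 * ‖z‖))) :=
    tendsto_one_div_add_atTop_nhds_zero_nat.mul_const _
  rw [zero_mul] at hlim
  obtain ⟨n0, hn0⟩ := eventually_atTop.1 (hlim.eventually (gt_mem_nhds (half_pos hη)))
  refine ⟨n0, fun n hn => ?_⟩
  have hb := hn0 n hn
  set δ := 1 / ((n : ℝ) + 1)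
  have e1 : S n (T x) - x = -(δ • S n x) := by
    nth_rewrite 2 [← hS1 n x]; abel
  have e2 : S n x = S n (x - T z) + S n (T z) := by rw [← map_add]; congr 1; abel
  have e3 : ‖S n (T z)‖ ≤ 2 * ‖z‖ := by
    have : S n (T z) = z - δ • S n z := by rw [eq_sub_iff_add_eq]; exact hS1 n z
    rw [this]
    have h4 := hS3 n z
    calc ‖z - δ • S n z‖ ≤ ‖z‖ + ‖δ • S n z‖ := norm_sub_le _ _
      _ = ‖z‖ + δ * ‖S n z‖ := by rw [norm_smul, Real.norm_of_nonneg (hδ n).le]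
      _ ≤ 2 * ‖z‖ := by linarith
  rw [dist_eq_norm]
  change ‖S n (T x) - x‖ < η
  rw [e1, norm_neg, norm_smul, Real.norm_of_nonneg (hδ n).le, e2]
  calc δ * ‖S n (x - T z) + S n (T z)‖ ≤ δ * (‖S n (x - T z)‖ + ‖S n (T z)‖) := by
        gcongr
        exact norm_add_le _ _
    _ = δ * ‖S n (x - T z)‖ + δ * ‖S n (T z)‖ := mul_add _ _ _
    _ ≤ ‖x - T z‖ + δ * (2 * ‖z‖) := by
        gcongr
        exact hS3 n _
    _ < η := by linarith

/-- With T = H*H, formally w' = -εT⁻¹w + aw, and T⁻¹ ≥ ‖H‖⁻². Since only Tw is known to be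
differentiable, the energy estimate is made for y = S n T w = Tz with z = S n w. It satisfies y' =
-εz + ay, ⟪y, z⟫ = ‖Hz‖² and ‖y‖ ≤ ‖H‖‖Hz‖, so e^{2ct}‖y‖² decreases; n → ∞ gives the claim for w.
-/
theorem norm_le_exp_mul_of_adjoint_comp_self_eq (H : X →L[ℝ] X) (hH : ∀ x, H x = 0 → x = 0)
    {ε a c : ℝ} (hac : 0 ≤ a + c) (hε : (a + c) * ‖H‖ ^ 2 ≤ ε) {w : ℝ → X}
    (hw : ContinuousOn w (Ici 0))
    (heq : ∀ s t : ℝ, 0 < s → s ≤ t → adjoint H (H (w t - w s)) =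
      -(ε • ∫ τ in s..t, w τ) + a • adjoint H (H (∫ τ in s..t, w τ))) {t : ℝ} (ht : 0 ≤ t) :
    ‖w t‖ ≤ Real.exp (-c * t) * ‖w 0‖ := by
  obtain ⟨S, hcomm, hlim⟩ := exists_approximate_inverse H hH
  have hderiv : ∀ r : ℝ, 0 < r → HasDerivAt (fun r => adjoint H (H (w r)))
      (-(ε • w r) + a • adjoint H (H (w r))) r := by
    intro r hr
    have hint : HasDerivAt (fun r' => ∫ τ in (r / 2)..r', w τ) (w r) r := by
      apply intervalIntegral.integral_hasDerivAt_right
      · apply ContinuousOn.intervalIntegrable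
        apply hw.mono
        rw [uIcc_of_le (by linarith)]
        exact fun x hx => le_trans (by positivity) hx.1
      · exact (hw.mono Ioi_subset_Ici_self).stronglyMeasurableAtFilter isOpen_Ioi r hr
      · exact hw.continuousAt (Ici_mem_nhds hr)
    -- The equation holds only from positive times on, so the base point r/2 replaces 0.
    have h2 : HasDerivAt (fun r' => adjoint H (H (w (r / 2))) + (-(ε • ∫ τ in (r / 2)..r', w τ) +
        a • adjoint H (H (∫ τ in (r / 2)..r', w τ)))) (-(ε • w r) + a • adjoint H (H (w r))) r := by
      refine ((hint.const_smul ε).neg.add (HasDerivAt.const_smul a ?_)).const_add _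
      exact ((adjoint H ∘L H).hasFDerivAt.comp_hasDerivAt r hint)
    refine h2.congr_of_eventuallyEq ?_
    filter_upwards [lt_mem_nhds (half_lt_self hr)] with r' hr'
    rw [← heq (r / 2) r' (by positivity) hr'.le, map_sub, map_sub]
    abel
  have key : ∀ n, Real.exp (c * t) * ‖S n (adjoint H (H (w t)))‖ ≤
      ‖S n (adjoint H (H (w 0)))‖ := by
    intro n
    set y : ℝ → X := fun r => S n (adjoint H (H (w r))) with hy
    have hyd : ∀ r : ℝ, 0 < r →
        HasDerivAt y (S n (-(ε • w r) + a • adjoint H (H (w r)))) r := fun r hr =>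
      (S n).hasFDerivAt.comp_hasDerivAt r (hderiv r hr)
    have hG : ∀ r : ℝ, 0 < r → HasDerivAt (fun r => Real.exp (2 * c * r) * ‖y r‖ ^ 2)
        (Real.exp (2 * c * r) * (2 * c) * ‖y r‖ ^ 2 + Real.exp (2 * c * r) *
          (2 * ⟪y r, S n (-(ε • w r) + a • adjoint H (H (w r)))⟫_ℝ)) r := by
      intro r hr
      refine HasDerivAt.mul ?_ (hyd r hr).norm_sq
      have := ((hasDerivAt_id r).const_mul (2 * c)).exp
      simpa using this
    -- Continuity up to 0 lets monotonicity start at the initial value, although the derivative is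
    -- known only for positive times.
    have hcont : ContinuousOn (fun r => Real.exp (2 * c * r) * ‖y r‖ ^ 2) (Ici 0) := by
      refine ContinuousOn.mul (by fun_prop) (ContinuousOn.pow (ContinuousOn.norm ?_) 2)
      exact (S n ∘L adjoint H ∘L H).continuous.comp_continuousOn hw
    have hanti : AntitoneOn (fun r => Real.exp (2 * c * r) * ‖y r‖ ^ 2) (Ici 0) := by
      apply antitoneOn_of_deriv_nonpos (convex_Ici 0) hcont
      · rw [interior_Ici]
        exact fun r hr => (hG r hr).differentiableAt.differentiableWithinAt
      · rw [interior_Ici]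
        intro r hr
        rw [(hG r hr).deriv]
        set z := S n (w r) with hz
        have hyz : y r = adjoint H (H z) := hcomm n (w r)
        have h1 : S n (-(ε • w r) + a • adjoint H (H (w r))) = -(ε • z) + a • y r := by
          simp [hy, hz]
        have h2 : ⟪y r, z⟫_ℝ = ‖H z‖ ^ 2 := by
          rw [hyz]; exact inner_adjoint_comp_self H z
        have h3 : ‖y r‖ ^ 2 ≤ ‖H‖ ^ 2 * ‖H z‖ ^ 2 := by
          rw [hyz, ← mul_pow]
          gcongr
          refine (le_opNorm _ _).trans_eq ?_
          rw [LinearIsometryEquiv.norm_map]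
        rw [h1, inner_add_right, inner_neg_right, inner_smul_right, inner_smul_right, h2,
          real_inner_self_eq_norm_sq]
        have h4 : (a + c) * ‖y r‖ ^ 2 ≤ ε * ‖H z‖ ^ 2 :=
          calc (a + c) * ‖y r‖ ^ 2 ≤ (a + c) * (‖H‖ ^ 2 * ‖H z‖ ^ 2) := by gcongr
            _ = (a + c) * ‖H‖ ^ 2 * ‖H z‖ ^ 2 := by ring
            _ ≤ ε * ‖H z‖ ^ 2 := by gcongr
        have h5 := Real.exp_pos (2 * c * r)
        have h6 : Real.exp (2 * c * r) * (2 * ((a + c) * ‖y r‖ ^ 2 - ε * ‖H z‖ ^ 2)) ≤ 0 :=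
          mul_nonpos_of_nonneg_of_nonpos h5.le (by linarith)
        linarith
    have h0 := hanti (show (0 : ℝ) ∈ Ici 0 from self_mem_Ici) (show t ∈ Ici 0 from ht) ht
    simp only [mul_zero, Real.exp_zero, one_mul] at h0
    have h7 : Real.exp (2 * c * t) = Real.exp (c * t) ^ 2 := by
      rw [← Real.exp_nat_mul]; congr 1; push_cast; ring
    rw [h7, ← mul_pow] at h0
    exact (pow_le_pow_iff_left₀ (by positivity) (norm_nonneg _) two_ne_zero).1 h0
  have hfin : Real.exp (c * t) * ‖w t‖ ≤ ‖w 0‖ :=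
    le_of_tendsto_of_tendsto' ((hlim (w t)).norm.const_mul _) (hlim (w 0)).norm key
  have h8 : Real.exp (-c * t) * Real.exp (c * t) = 1 := by
    rw [← Real.exp_add]; simp
  calc ‖w t‖ = Real.exp (-c * t) * (Real.exp (c * t) * ‖w t‖) := by rw [← mul_assoc, h8, one_mul]
    _ ≤ _ := by gcongr

/-- If `f = -T g + b e` forces `V f = -T (V g + 4 f) + 2 ⟪e, f⟫ e`, then `exp (s V)` maps solutions
to solutions of the shifted equation. -/
theorem exp_smul_apply_of_commutator (T V : X →L[ℝ] X) (e : X)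
    (hV : ∀ (f g : X) (b : ℝ), f = -T g + b • e → V f = -T (V g + (4 : ℝ) • f) +
      (2 * ⟪e, f⟫_ℝ) • e) (s : ℝ) {f g : X} {b β : ℝ} (hf : f = -T g + b • e)
    (hβ : HasSum (fun m : ℕ => s ^ (m + 1) / (m + 1).factorial * (2 * ⟪e, (V ^ m) f⟫_ℝ)) β) :
    NormedSpace.exp (s • V) f =
      -T (NormedSpace.exp (s • V) (g + (4 * s) • f)) + (b + β) • e := by
  -- In differential form this is [L, V^(m+1)] = 4(m+1)V^m, a consequence of [L, V] = 4. Only the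
  -- last application of V contributes to the boundary value.
  have hm : ∀ m : ℕ, (V ^ (m + 1)) f = -T ((V ^ (m + 1)) g + (4 * (m + 1) : ℝ) • (V ^ m) f) +
      (2 * ⟪e, (V ^ m) f⟫_ℝ) • e := by
    intro m
    induction m with
    | zero => simpa using hV f g b hf
    | succ m ih =>
      rw [pow_succ' V (m + 1), mul_apply_eq_comp, hV _ _ _ ih]
      congr 2
      rw [map_add V, map_smul V, ← mul_apply_eq_comp V, ← mul_apply_eq_comp V, ← pow_succ',
        ← pow_succ', add_assoc, ← add_smul]
      congr 4
      push_cast; ring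
  have hexp : ∀ x : X, HasSum (fun m : ℕ => ((s ^ m / m.factorial) : ℝ) • (V ^ m) x)
      (NormedSpace.exp (s • V) x) := by
    intro x
    have h := NormedSpace.exp_series_hasSum_exp' (𝕂 := ℝ) (s • V)
    have h2 := h.mapL (ContinuousLinearMap.apply ℝ X x)
    refine h2.congr_fun fun m => ?_
    simp [smul_pow, smul_smul, div_eq_inv_mul]
  have h1 := (hasSum_nat_add_iff' 1).2 (hexp f)
  have h2 := (hasSum_nat_add_iff' 1).2 (hexp g)
  -- The factor m+1 cancels against (m+1)!, so the commutator terms sum to 4s exp(sV)f.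
  have h3 : HasSum (fun m : ℕ => ((s ^ (m + 1) / (m + 1).factorial : ℝ)) • (V ^ (m + 1)) f)
      (-T ((NormedSpace.exp (s • V) g - ∑ i ∈ Finset.range 1, ((s ^ i / i.factorial) : ℝ) • (V ^ i) g)
        + (4 * s) • NormedSpace.exp (s • V) f) + β • e) := by
    have h4 := ((h2.add ((hexp f).const_smul (4 * s))).mapL T).neg.add (hβ.smul_const e)
    refine h4.congr_fun fun m => ?_
    rw [hm m, smul_add, smul_neg, ← map_smul, smul_add, smul_smul, smul_smul, smul_smul]
    congr 5
    rw [Nat.factorial_succ]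
    have := Nat.factorial_ne_zero m
    push_cast
    field_simp
    ring
  have h5 := h1.unique h3
  simp only [Finset.range_one, Finset.sum_singleton, pow_zero, Nat.factorial_zero, Nat.cast_one,
    div_one, one_smul, one_apply_eq_self] at h5
  rw [sub_eq_iff_eq_add] at h5
  rw [map_add (NormedSpace.exp (s • V)), map_smul (NormedSpace.exp (s • V))]
  generalize NormedSpace.exp (s • V) f = F at h5 ⊢
  refine h5.trans ?_
  rw [hf]
  simp only [map_add, map_sub, map_smul, add_smul]
  abel

end Abstract

/-! ### Tensor products of L² spaces and Hilbert–Schmidt operators -/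

section Tensor

variable {A B : Type*} [MeasurableSpace A] [MeasurableSpace B] {μ : Measure A} {ν : Measure B}

theorem inner_eq_integral {f g : Lp ℝ 2 μ} {f' g' : A → ℝ} (hf : f =ᵐ[μ] f') (hg : g =ᵐ[μ] g') :
    ⟪f, g⟫_ℝ = ∫ x, f' x * g' x ∂μ := by
  rw [L2.inner_def]
  refine integral_congr_ae ?_
  filter_upwards [hf, hg] with x h1 h2
  rw [h1, h2]
  simp [mul_comm]

theorem inner_toLp_toLp {f g : A → ℝ} (hf : MemLp f 2 μ) (hg : MemLp g 2 μ) :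
    ⟪hf.toLp f, hg.toLp g⟫_ℝ = ∫ x, f x * g x ∂μ :=
  inner_eq_integral hf.coeFn_toLp hg.coeFn_toLp

theorem memLp_tensor {f : A → ℝ} {g : B → ℝ} (hf : MemLp f 2 μ) (hg : MemLp g 2 ν) :
    MemLp (fun p : A × B => f p.1 * g p.2) 2 (μ.prod ν) := by
  refine (memLp_two_iff_integrable_sq (hf.1.comp_fst.mul hg.1.comp_snd)).2 ?_
  change Integrable (fun p : A × B => (f p.1 * g p.2) ^ 2) _
  simpa only [mul_pow] using hf.integrable_sq.mul_prod hg.integrable_sq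

variable [SFinite μ] [SFinite ν]

variable (μ ν) in
/-- The bilinear map `(f, g) ↦ f ⊗ g` from `L²(μ) × L²(ν)` to `L²(μ × ν)`. -/
noncomputable def tensor : Lp ℝ 2 μ →L[ℝ] Lp ℝ 2 ν →L[ℝ] Lp ℝ 2 (μ.prod ν) :=
  LinearMap.mkContinuous₂ (LinearMap.mk₂ ℝ
    (fun f g => (memLp_tensor (Lp.memLp f) (Lp.memLp g)).toLp _)
    (fun f f' g => by
      rw [← MemLp.toLp_add]
      refine MemLp.toLp_congr _ _ ?_
      filter_upwards [Measure.quasiMeasurePreserving_fst.ae (Lp.coeFn_add f f')] with p hp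
      simp only [hp, Pi.add_apply, add_mul])
    (fun a f g => by
      rw [← MemLp.toLp_const_smul]
      refine MemLp.toLp_congr _ _ ?_
      filter_upwards [Measure.quasiMeasurePreserving_fst.ae (Lp.coeFn_smul a f)] with p hp
      simp only [hp, Pi.smul_apply, smul_eq_mul, mul_assoc])
    (fun f g g' => by
      rw [← MemLp.toLp_add]
      refine MemLp.toLp_congr _ _ ?_
      filter_upwards [Measure.quasiMeasurePreserving_snd.ae (Lp.coeFn_add g g')] with p hp
      simp only [hp, Pi.add_apply, mul_add])
    (fun a f g => by
      rw [← MemLp.toLp_const_smul]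
      refine MemLp.toLp_congr _ _ ?_
      filter_upwards [Measure.quasiMeasurePreserving_snd.ae (Lp.coeFn_smul a g)] with p hp
      simp only [hp, Pi.smul_apply, smul_eq_mul, mul_left_comm]))
    1 fun f g => by
      rw [one_mul]
      refine (pow_le_pow_iff_left₀ (norm_nonneg _) (by positivity) two_ne_zero).1 (le_of_eq ?_)
      rw [mul_pow, ← real_inner_self_eq_norm_sq, ← real_inner_self_eq_norm_sq,
        ← real_inner_self_eq_norm_sq]
      simp only [LinearMap.mk₂_apply]
      rw [inner_toLp_toLp, inner_eq_integral (ae_eq_refl f) (ae_eq_refl f),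
        inner_eq_integral (ae_eq_refl g) (ae_eq_refl g), ← integral_prod_mul]
      simp only [mul_mul_mul_comm]

theorem tensor_toLp {f : A → ℝ} {g : B → ℝ} (hf : MemLp f 2 μ) (hg : MemLp g 2 ν) :
    tensor μ ν (hf.toLp f) (hg.toLp g) = (memLp_tensor hf hg).toLp _ := by
  refine MemLp.toLp_congr (memLp_tensor (Lp.memLp _) (Lp.memLp _)) _ ?_
  filter_upwards [Measure.quasiMeasurePreserving_fst.ae hf.coeFn_toLp,
    Measure.quasiMeasurePreserving_snd.ae hg.coeFn_toLp] with p h1 h2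
  rw [h1, h2]

theorem tensor_coeFn {f : Lp ℝ 2 μ} {g : Lp ℝ 2 ν} {f' : A → ℝ} {g' : B → ℝ} (hf : f =ᵐ[μ] f')
    (hg : g =ᵐ[ν] g') : tensor μ ν f g =ᵐ[μ.prod ν] fun p => f' p.1 * g' p.2 := by
  refine (MemLp.coeFn_toLp (memLp_tensor (Lp.memLp f) (Lp.memLp g))).trans ?_
  filter_upwards [Measure.quasiMeasurePreserving_fst.ae hf,
    Measure.quasiMeasurePreserving_snd.ae hg] with p h1 h2
  rw [h1, h2]

theorem inner_tensor_tensor (f f' : Lp ℝ 2 μ) (g g' : Lp ℝ 2 ν) :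
    ⟪tensor μ ν f g, tensor μ ν f' g'⟫_ℝ = ⟪f, f'⟫_ℝ * ⟪g, g'⟫_ℝ := by
  rw [inner_eq_integral (tensor_coeFn (ae_eq_refl f) (ae_eq_refl g))
    (tensor_coeFn (ae_eq_refl f') (ae_eq_refl g')), inner_eq_integral (ae_eq_refl f) (ae_eq_refl f'),
    inner_eq_integral (ae_eq_refl g) (ae_eq_refl g'), ← integral_prod_mul]
  simp only [mul_mul_mul_comm]

theorem inner_tensor_eq_integral {U : Lp ℝ 2 (μ.prod ν)} {U' : A × B → ℝ}
    (hU : U =ᵐ[μ.prod ν] U') {f : Lp ℝ 2 μ} {g : Lp ℝ 2 ν} {f' : A → ℝ} {g' : B → ℝ}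
    (hf : f =ᵐ[μ] f') (hg : g =ᵐ[ν] g') :
    ⟪U, tensor μ ν f g⟫_ℝ = ∫ x, f' x * ∫ y, U' (x, y) * g' y ∂ν ∂μ := by
  rw [inner_eq_integral hU (tensor_coeFn hf hg), integral_prod]
  · refine integral_congr_ae (Eventually.of_forall fun x => ?_)
    simp only
    rw [← integral_const_mul]
    simp only [mul_left_comm]
  · exact MemLp.integrable_mul ((memLp_congr_ae hU).1 (Lp.memLp U))
      ((memLp_congr_ae (tensor_coeFn hf hg)).1 (Lp.memLp _))

theorem inner_tensor_eq_integral_symm {U : Lp ℝ 2 (μ.prod ν)} {U' : A × B → ℝ}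
    (hU : U =ᵐ[μ.prod ν] U') {f : Lp ℝ 2 μ} {g : Lp ℝ 2 ν} {f' : A → ℝ} {g' : B → ℝ}
    (hf : f =ᵐ[μ] f') (hg : g =ᵐ[ν] g') :
    ⟪U, tensor μ ν f g⟫_ℝ = ∫ y, g' y * ∫ x, U' (x, y) * f' x ∂μ ∂ν := by
  rw [inner_eq_integral hU (tensor_coeFn hf hg), integral_prod_symm]
  · refine integral_congr_ae (Eventually.of_forall fun x => ?_)
    simp only
    rw [← integral_const_mul]
    refine integral_congr_ae (Eventually.of_forall fun x => ?_)
    simp only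
    ring
  · exact MemLp.integrable_mul ((memLp_congr_ae hU).1 (Lp.memLp U))
      ((memLp_congr_ae (tensor_coeFn hf hg)).1 (Lp.memLp _))

variable (μ) in
/-- The partial pairing `U ↦ (x ↦ ∫ U (x, y) g y dν(y))`. -/
noncomputable def partialInner (g : Lp ℝ 2 ν) : Lp ℝ 2 (μ.prod ν) →L[ℝ] Lp ℝ 2 μ :=
  adjoint ((tensor μ ν).flip g)

theorem inner_partialInner (g : Lp ℝ 2 ν) (U : Lp ℝ 2 (μ.prod ν)) (f : Lp ℝ 2 μ) :
    ⟪partialInner μ g U, f⟫_ℝ = ⟪U, tensor μ ν f g⟫_ℝ := by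
  rw [partialInner, adjoint_inner_left]; rfl

/-- The Hilbert–Schmidt operator with kernel `K`. -/
noncomputable def hilbertSchmidt (K : Lp ℝ 2 (μ.prod μ)) : Lp ℝ 2 μ →L[ℝ] Lp ℝ 2 μ :=
  continuousLinearMapOfBilin (𝕜 := ℝ)
    ((compL ℝ (Lp ℝ 2 μ) (Lp ℝ 2 (μ.prod μ)) ℝ (innerSL ℝ K)) ∘L (tensor μ μ).flip)

theorem inner_hilbertSchmidt (K : Lp ℝ 2 (μ.prod μ)) (f g : Lp ℝ 2 μ) :
    ⟪hilbertSchmidt K f, g⟫_ℝ = ⟪K, tensor μ μ g f⟫_ℝ := by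
  rw [hilbertSchmidt, continuousLinearMapOfBilin_apply]; rfl

theorem inner_adjoint_hilbertSchmidt (K : Lp ℝ 2 (μ.prod μ)) (f g : Lp ℝ 2 μ) :
    ⟪adjoint (hilbertSchmidt K) f, g⟫_ℝ = ⟪K, tensor μ μ f g⟫_ℝ := by
  rw [adjoint_inner_left, real_inner_comm, inner_hilbertSchmidt]

/-- The operator is defined through pairings; Fubini identifies it with the pointwise integral
formula, which is how explicit functions enter later. -/
theorem hilbertSchmidt_eq_toLp {K : Lp ℝ 2 (μ.prod μ)} {K' : A × A → ℝ} (hK : K =ᵐ[μ.prod μ] K')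
    {f : Lp ℝ 2 μ} {f' G : A → ℝ} (hf : f =ᵐ[μ] f') (hG : MemLp G 2 μ)
    (h : ∀ᵐ x ∂μ, ∫ y, K' (x, y) * f' y ∂μ = G x) : hilbertSchmidt K f = hG.toLp G := by
  refine ext_inner_right ℝ fun v => ?_
  rw [inner_hilbertSchmidt, inner_tensor_eq_integral hK (ae_eq_refl v) hf,
    inner_eq_integral hG.coeFn_toLp (ae_eq_refl v)]
  refine integral_congr_ae ?_
  filter_upwards [h] with x hx
  rw [hx, mul_comm]

theorem adjoint_hilbertSchmidt_eq_toLp {K : Lp ℝ 2 (μ.prod μ)} {K' : A × A → ℝ}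
    (hK : K =ᵐ[μ.prod μ] K') {f : Lp ℝ 2 μ} {f' G : A → ℝ} (hf : f =ᵐ[μ] f') (hG : MemLp G 2 μ)
    (h : ∀ᵐ y ∂μ, ∫ x, K' (x, y) * f' x ∂μ = G y) :
    adjoint (hilbertSchmidt K) f = hG.toLp G := by
  refine ext_inner_right ℝ fun v => ?_
  rw [inner_adjoint_hilbertSchmidt, inner_tensor_eq_integral_symm hK hf (ae_eq_refl v),
    inner_eq_integral hG.coeFn_toLp (ae_eq_refl v)]
  refine integral_congr_ae ?_
  filter_upwards [h] with x hx
  rw [hx, mul_comm]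

end Tensor

/-! ### The radial space L²(r dr) and the inverses of the two first-order factors -/

section Radial

/-- The measure `r dr` on `(0, R)`. -/
noncomputable def radMeas (R : ℝ) : Measure ℝ :=
  (volume.restrict (Ioo 0 R)).withDensity (fun r => ENNReal.ofReal r)

theorem radMeas_absolutelyContinuous (R : ℝ) : radMeas R ≪ volume.restrict (Ioo 0 R) :=
  withDensity_absolutelyContinuous _ _

theorem ae_radMeas {R : ℝ} {P : ℝ → Prop} (h : ∀ r ∈ Ioo 0 R, P r) : ∀ᵐ r ∂radMeas R, P r :=
  (radMeas_absolutelyContinuous R).ae_le (ae_restrict_of_forall_mem measurableSet_Ioo h)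

theorem integral_radMeas {R : ℝ} (f : ℝ → ℝ) :
    ∫ r, f r ∂radMeas R = ∫ r in Ioo 0 R, r * f r := by
  rw [radMeas, integral_withDensity_eq_integral_toReal_smul (by fun_prop) (by simp)]
  refine setIntegral_congr_fun measurableSet_Ioo fun r hr => ?_
  simp only [ENNReal.toReal_ofReal hr.1.le, smul_eq_mul]

instance (R : ℝ) : IsFiniteMeasure (radMeas R) := by
  refine isFiniteMeasure_withDensity ?_
  refine ne_of_lt (lt_of_le_of_lt (b := ∫⁻ _ in Ioo 0 R, ENNReal.ofReal R) ?_ ?_)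
  · exact setLIntegral_mono measurable_const fun r hr => ENNReal.ofReal_le_ofReal hr.2.le
  · simp [ENNReal.mul_lt_top]

/-- Functions that are continuous on `(0, ∞)` and bounded near `0`. -/
structure IsNice (f : ℝ → ℝ) : Prop where
  cont : ContinuousOn f (Ioi 0)
  bdd : ∃ δ > 0, ∃ C, ∀ r ∈ Ioc 0 δ, |f r| ≤ C

theorem IsNice.exists_bound {f : ℝ → ℝ} (hf : IsNice f) (b : ℝ) :
    ∃ C, 0 ≤ C ∧ ∀ r ∈ Ioc 0 b, |f r| ≤ C := by
  obtain ⟨δ, hδ, C, hC⟩ := hf.bdd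
  obtain ⟨D, hD⟩ := (isCompact_Icc (a := δ) (b := b)).exists_bound_of_continuousOn
    (hf.cont.mono fun x hx => lt_of_lt_of_le hδ hx.1)
  refine ⟨max 0 (max C D), le_max_left _ _, fun r hr => ?_⟩
  rcases le_total r δ with h | h
  · exact (hC r ⟨hr.1, h⟩).trans ((le_max_left _ _).trans (le_max_right _ _))
  · exact (hD r ⟨h, hr.2⟩).trans ((le_max_right _ _).trans (le_max_right _ _))

theorem IsNice.of_continuous {f : ℝ → ℝ} (hf : Continuous f) : IsNice f := by
  obtain ⟨D, hD⟩ := (isCompact_Icc (a := (0 : ℝ)) (b := 1)).exists_bound_of_continuousOn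
    hf.continuousOn
  exact ⟨hf.continuousOn, 1, one_pos, D, fun r hr => hD r ⟨hr.1.le, hr.2⟩⟩

theorem IsNice.mul {f g : ℝ → ℝ} (hf : IsNice f) (hg : IsNice g) :
    IsNice (fun r => f r * g r) := by
  obtain ⟨C, hC0, hC⟩ := hf.exists_bound 1
  obtain ⟨D, hD0, hD⟩ := hg.exists_bound 1
  refine ⟨hf.cont.mul hg.cont, 1, one_pos, C * D, fun r hr => ?_⟩
  rw [abs_mul]
  exact mul_le_mul (hC r hr) (hD r hr) (abs_nonneg _) hC0

theorem IsNice.sub {f g : ℝ → ℝ} (hf : IsNice f) (hg : IsNice g) :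
    IsNice (fun r => f r - g r) := by
  obtain ⟨C, hC0, hC⟩ := hf.exists_bound 1
  obtain ⟨D, hD0, hD⟩ := hg.exists_bound 1
  refine ⟨hf.cont.sub hg.cont, 1, one_pos, C + D, fun r hr => ?_⟩
  exact (abs_sub _ _).trans (add_le_add (hC r hr) (hD r hr))

theorem IsNice.rpow {a : ℝ} (ha : 0 ≤ a) : IsNice (fun r => r ^ a) :=
  IsNice.of_continuous (Real.continuous_rpow_const ha)

theorem IsNice.const_mul {f : ℝ → ℝ} (hf : IsNice f) (c : ℝ) : IsNice (fun r => c * f r) :=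
  (IsNice.of_continuous continuous_const).mul hf

theorem IsNice.id_mul {f : ℝ → ℝ} (hf : IsNice f) : IsNice (fun r => r * f r) :=
  (IsNice.of_continuous continuous_id).mul hf

theorem IsNice.memLp {f : ℝ → ℝ} (hf : IsNice f) (R : ℝ) : MemLp f 2 (radMeas R) := by
  obtain ⟨C, hC0, hC⟩ := hf.exists_bound R
  refine MemLp.of_bound ?_ C (ae_radMeas fun r hr => hC r ⟨hr.1, hr.2.le⟩)
  exact ((hf.cont.mono Ioo_subset_Ioi_self).aestronglyMeasurable measurableSet_Ioo).mono_ac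
    (radMeas_absolutelyContinuous R)

theorem IsNice.intervalIntegrable {f : ℝ → ℝ} (hf : IsNice f) {b : ℝ} (hb : 0 ≤ b) :
    IntervalIntegrable f volume 0 b := by
  obtain ⟨C, hC0, hC⟩ := hf.exists_bound b
  rw [intervalIntegrable_iff_integrableOn_Ioc_of_le hb]
  refine Integrable.of_bound (C := C) ?_ ?_
  · exact (hf.cont.mono Ioc_subset_Ioi_self).aestronglyMeasurable measurableSet_Ioc
  · exact ae_restrict_of_forall_mem measurableSet_Ioc hC

theorem continuousOn_rpow_Ioi (a : ℝ) : ContinuousOn (fun r : ℝ => r ^ a) (Ioi 0) :=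
  continuousOn_id.rpow_const fun _ hx => Or.inl (ne_of_gt hx)

theorem intervalIntegrable_of_pos {f : ℝ → ℝ} (hf : ContinuousOn f (Ioi 0)) {a b : ℝ} (ha : 0 < a)
    (hb : 0 < b) : IntervalIntegrable f volume a b :=
  (hf.mono fun _ hx => lt_of_lt_of_le (lt_min ha hb) hx.1).intervalIntegrable

/-- Closed properties of `L²(r dr)` may be checked on nice functions. -/
theorem nice_induction {R : ℝ} {P : Lp ℝ 2 (radMeas R) → Prop} (hP : IsClosed {f | P f})
    (h : ∀ (f : ℝ → ℝ) (hf : IsNice f), P ((hf.memLp R).toLp f)) (f : Lp ℝ 2 (radMeas R)) :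
    P f := by
  have hd := BoundedContinuousFunction.toLp_denseRange (E := ℝ) (p := 2) (μ := radMeas R) ℝ
    (by simp)
  refine isClosed_property hd hP (fun g => ?_) f
  exact h g (IsNice.of_continuous g.continuous)

/-- `r ↦ r^(-1-μ) ∫₀ʳ σ^(1+μ) f σ dσ`. -/
noncomputable def fwd (μ : ℝ) (f : ℝ → ℝ) (r : ℝ) : ℝ :=
  r ^ (-1 - μ) * ∫ σ in (0 : ℝ)..r, σ ^ (1 + μ) * f σ

/-- `r ↦ r^μ ∫ᵣᴿ ρ^(-μ) g ρ dρ`. -/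
noncomputable def bwd (R μ : ℝ) (g : ℝ → ℝ) (r : ℝ) : ℝ :=
  r ^ μ * ∫ ρ in r..R, ρ ^ (-μ) * g ρ

variable {R μ : ℝ}

theorem hasDerivAt_integral_rpow_mul {f : ℝ → ℝ} (hf : IsNice f) (hμ : 0 < μ) {r : ℝ} (hr : 0 < r) :
    HasDerivAt (fun r => ∫ σ in (0 : ℝ)..r, σ ^ (1 + μ) * f σ) (r ^ (1 + μ) * f r) r := by
  have hg : IsNice fun σ => σ ^ (1 + μ) * f σ := (IsNice.rpow (by positivity)).mul hf
  exact intervalIntegral.integral_hasDerivAt_right (hg.intervalIntegrable hr.le)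
    (hg.cont.stronglyMeasurableAtFilter isOpen_Ioi r hr) (hg.cont.continuousAt (Ioi_mem_nhds hr))

/-- `fwd` inverts ∂_r + (1+μ)/r, and `bwd` inverts -(∂_r - μ/r) with zero value at R. The product of
the two factors is the radial Laplacian at frequency μ. -/
theorem hasDerivAt_fwd {f : ℝ → ℝ} (hf : IsNice f) (hμ : 0 < μ) {r : ℝ} (hr : 0 < r) :
    HasDerivAt (fwd μ f) (f r - (1 + μ) / r * fwd μ f r) r := by
  refine ((Real.hasDerivAt_rpow_const (p := -1 - μ) (Or.inl hr.ne')).mul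
    (hasDerivAt_integral_rpow_mul hf hμ hr)).congr_deriv ?_
  have h1 : r ^ (-1 - μ) * (r ^ (1 + μ) * f r) = f r := by
    rw [← mul_assoc, ← Real.rpow_add hr]; simp
  have h2 : r ^ (-1 - μ - 1) = r ^ (-1 - μ) / r := Real.rpow_sub_one hr.ne' _
  rw [h1, h2, fwd]
  field_simp
  ring

theorem IsNice.fwd {f : ℝ → ℝ} (hf : IsNice f) (hμ : 0 < μ) : IsNice (fwd μ f) := by
  refine ⟨fun r hr => (hasDerivAt_fwd hf hμ hr).continuousAt.continuousWithinAt, 1, one_pos, ?_⟩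
  obtain ⟨C, hC0, hC⟩ := hf.exists_bound 1
  refine ⟨C, fun r hr => ?_⟩
  have h1 : ‖∫ σ in (0 : ℝ)..r, σ ^ (1 + μ) * f σ‖ ≤ r ^ (1 + μ) * C * |r - 0| := by
    refine intervalIntegral.norm_integral_le_of_norm_le_const fun σ hσ => ?_
    rw [uIoc_of_le hr.1.le] at hσ
    rw [norm_mul, Real.norm_of_nonneg (Real.rpow_nonneg hσ.1.le _)]
    exact mul_le_mul (Real.rpow_le_rpow hσ.1.le hσ.2 (by positivity))
      (hC σ ⟨hσ.1, hσ.2.trans hr.2⟩) (norm_nonneg _) (Real.rpow_nonneg hr.1.le _)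
  rw [Sector.fwd, abs_mul, abs_of_nonneg (Real.rpow_nonneg hr.1.le _)]
  calc r ^ (-1 - μ) * |∫ σ in (0 : ℝ)..r, σ ^ (1 + μ) * f σ|
      ≤ r ^ (-1 - μ) * (r ^ (1 + μ) * C * |r - 0|) := by
        gcongr
        · exact Real.rpow_nonneg hr.1.le _
        · exact h1
    _ = C * r := by
        rw [sub_zero, abs_of_pos hr.1, ← mul_assoc, ← mul_assoc, ← Real.rpow_add hr.1]; simp
    _ ≤ C := mul_le_of_le_one_right hC0 hr.2

theorem hasDerivAt_bwd {g : ℝ → ℝ} (hg : IsNice g) (hR : 0 < R) {r : ℝ} (hr : 0 < r) :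
    HasDerivAt (bwd R μ g) (μ / r * bwd R μ g r - g r) r := by
  have hc : ContinuousOn (fun ρ => ρ ^ (-μ) * g ρ) (Ioi 0) := (continuousOn_rpow_Ioi _).mul hg.cont
  have h0 : HasDerivAt (fun r => ∫ ρ in r..R, ρ ^ (-μ) * g ρ) (-(r ^ (-μ) * g r)) r :=
    intervalIntegral.integral_hasDerivAt_left (intervalIntegrable_of_pos hc hr hR)
      (hc.stronglyMeasurableAtFilter isOpen_Ioi r hr) (hc.continuousAt (Ioi_mem_nhds hr))
  refine ((Real.hasDerivAt_rpow_const (p := μ) (Or.inl hr.ne')).mul h0).congr_deriv ?_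
  have h1 : r ^ μ * (r ^ (-μ) * g r) = g r := by
    rw [← mul_assoc, ← Real.rpow_add hr]; simp
  have h2 : r ^ (μ - 1) = r ^ μ / r := Real.rpow_sub_one hr.ne' _
  rw [mul_neg, h1, h2, bwd]
  field_simp
  ring

/-- The singular weight is harmless: ρ^(-μ) ≤ r^(-μ) for ρ ≥ r, and the prefactor r^μ absorbs it. -/
theorem IsNice.bwd {g : ℝ → ℝ} (hg : IsNice g) (hR : 0 < R) (hμ : 0 < μ) :
    IsNice (bwd R μ g) := by
  refine ⟨fun r hr => (hasDerivAt_bwd hg hR hr).continuousAt.continuousWithinAt, R, hR, ?_⟩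
  obtain ⟨C, hC0, hC⟩ := hg.exists_bound R
  refine ⟨C * R, fun r hr => ?_⟩
  have h1 : ‖∫ ρ in r..R, ρ ^ (-μ) * g ρ‖ ≤ r ^ (-μ) * C * |R - r| := by
    refine intervalIntegral.norm_integral_le_of_norm_le_const fun σ hσ => ?_
    rw [uIoc_of_le hr.2] at hσ
    have hσ0 : 0 < σ := hr.1.trans hσ.1
    rw [norm_mul, Real.norm_of_nonneg (Real.rpow_nonneg hσ0.le _)]
    exact mul_le_mul (Real.rpow_le_rpow_of_nonpos hr.1 hσ.1.le (by linarith))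
      (hC σ ⟨hσ0, hσ.2⟩) (norm_nonneg _) (Real.rpow_nonneg hr.1.le _)
  rw [Sector.bwd, abs_mul, abs_of_nonneg (Real.rpow_nonneg hr.1.le _)]
  calc r ^ μ * |∫ ρ in r..R, ρ ^ (-μ) * g ρ|
      ≤ r ^ μ * (r ^ (-μ) * C * |R - r|) := by
        gcongr
        · exact Real.rpow_nonneg hr.1.le _
        · exact h1
    _ = C * (R - r) := by
        rw [abs_of_nonneg (sub_nonneg.2 hr.2), ← mul_assoc, ← mul_assoc, ← Real.rpow_add hr.1]; simp
    _ ≤ C * R := by gcongr; linarith [hr.1]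

/-- The kernel of `fwd` with respect to `σ dσ`. -/
noncomputable def radKernel (μ : ℝ) (p : ℝ × ℝ) : ℝ :=
  if p.2 < p.1 then p.2 ^ μ * p.1 ^ (-1 - μ) else 0

theorem measurable_radKernel (μ : ℝ) : Measurable (radKernel μ) :=
  Measurable.ite (measurableSet_lt measurable_snd measurable_fst)
    ((measurable_snd.pow_const _).mul (measurable_fst.pow_const _)) measurable_const

theorem radKernel_le (hμ : 0 < μ) {r σ : ℝ} (hr : 0 < r) (hσ : 0 < σ) :
    0 ≤ radKernel μ (r, σ) ∧ radKernel μ (r, σ) ≤ if σ < r then r⁻¹ else 0 := by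
  unfold radKernel
  split_ifs with h
  · refine ⟨by positivity, ?_⟩
    calc σ ^ μ * r ^ (-1 - μ) ≤ r ^ μ * r ^ (-1 - μ) := by
          gcongr
      _ = r⁻¹ := by rw [← Real.rpow_add hr, ← Real.rpow_neg_one]; congr 1; ring
  · simp

/-- The kernel is at most 1/r on σ < r and 0 elsewhere, so its square integrates to at most 1
against σ dσ for each r, and r dr has finite mass. -/
theorem memLp_radKernel (hμ : 0 < μ) (R : ℝ) :
    MemLp (radKernel μ) 2 ((radMeas R).prod (radMeas R)) := by
  have hm := (measurable_radKernel μ).aestronglyMeasurable (μ := (radMeas R).prod (radMeas R))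
  refine (memLp_two_iff_integrable_sq hm).2 ((integrable_prod_iff (hm.pow 2)).2 ⟨?_, ?_⟩)
  · refine ae_radMeas fun r hr => ?_
    refine Integrable.of_bound (C := (r⁻¹) ^ 2) ?_ (ae_radMeas fun σ hσ => ?_)
    · exact (((measurable_radKernel μ).comp measurable_prodMk_left).pow_const 2).aestronglyMeasurable
    · obtain ⟨h1, h2⟩ := radKernel_le hμ hr.1 hσ.1
      rw [Pi.pow_apply, norm_pow, Real.norm_of_nonneg h1]
      have : (if σ < r then r⁻¹ else 0) ≤ r⁻¹ := by
        split_ifs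
        · exact le_rfl
        · exact inv_nonneg.2 hr.1.le
      gcongr
      exact h2.trans this
  · refine Integrable.of_bound (C := 1) (hm.pow 2).norm.integral_prod_right' ?_
    refine ae_radMeas fun r hr => ?_
    rw [Real.norm_of_nonneg (integral_nonneg fun _ => norm_nonneg _), integral_radMeas]
    have h1 : ∫ σ in Ioo 0 R, σ * ‖radKernel μ (r, σ) ^ 2‖ ≤
        ∫ σ in Ioo 0 R, (Ioo 0 r).indicator (fun _ => r⁻¹) σ := by
      refine integral_mono_of_nonneg ?_ ?_ ?_
      · exact ae_restrict_of_forall_mem measurableSet_Ioo fun σ hσ => by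
          have := hσ.1
          positivity
      · exact (integrable_const _).indicator measurableSet_Ioo
      · refine ae_restrict_of_forall_mem measurableSet_Ioo fun σ hσ => ?_
        obtain ⟨h1, h2⟩ := radKernel_le hμ hr.1 hσ.1
        simp only [norm_pow, Real.norm_of_nonneg h1]
        by_cases h : σ < r
        · rw [indicator_of_mem (show σ ∈ Ioo 0 r from ⟨hσ.1, h⟩)]
          rw [if_pos h] at h2
          calc σ * radKernel μ (r, σ) ^ 2 ≤ r * (r⁻¹) ^ 2 := by
                gcongr
                exact hr.1.le
            _ = r⁻¹ := by have := hr.1.ne'; field_simp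
        · rw [if_neg h] at h2
          rw [le_antisymm h2 h1, indicator_of_notMem (fun h' => h h'.2)]
          simp
    refine h1.trans ?_
    rw [integral_indicator measurableSet_Ioo, Measure.restrict_restrict measurableSet_Ioo,
      inter_eq_left.2 (Ioo_subset_Ioo_right hr.2.le)]
    simp [hr.1.le, hr.1.ne']

/-- The operator `f ↦ r^(-1-μ) ∫₀ʳ σ^(1+μ) f σ dσ` on `L²(r dr)`. -/
noncomputable def hOp (hμ : 0 < μ) (R : ℝ) : Lp ℝ 2 (radMeas R) →L[ℝ] Lp ℝ 2 (radMeas R) :=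
  hilbertSchmidt ((memLp_radKernel hμ R).toLp _)

theorem hOp_toLp (hμ : 0 < μ) {f : ℝ → ℝ} (hf : IsNice f) :
    hOp hμ R ((hf.memLp R).toLp f) = ((hf.fwd hμ).memLp R).toLp (fwd μ f) := by
  refine hilbertSchmidt_eq_toLp (MemLp.coeFn_toLp _) (MemLp.coeFn_toLp _) _ ?_
  refine ae_radMeas fun r hr => ?_
  rw [integral_radMeas, fwd, ← intervalIntegral.integral_const_mul,
    intervalIntegral.integral_of_le hr.1.le, integral_Ioc_eq_integral_Ioo]
  have h1 : ∫ σ in Ioo 0 R, σ * (radKernel μ (r, σ) * f σ) = ∫ σ in Ioo 0 R,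
      (Ioo 0 r).indicator (fun σ => r ^ (-1 - μ) * (σ ^ (1 + μ) * f σ)) σ := by
    refine setIntegral_congr_fun measurableSet_Ioo fun σ hσ => ?_
    by_cases h : σ < r
    · simp only [indicator_of_mem (show σ ∈ Ioo 0 r from ⟨hσ.1, h⟩), radKernel, if_pos h,
        Real.rpow_add hσ.1, Real.rpow_one]
      ring
    · simp only [indicator_of_notMem (fun h' : σ ∈ Ioo 0 r => h h'.2), radKernel, if_neg h]
      ring
  rw [h1, integral_indicator measurableSet_Ioo, Measure.restrict_restrict measurableSet_Ioo,
    inter_eq_left.2 (Ioo_subset_Ioo_right hr.2.le)]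

theorem adjoint_hOp_toLp (hμ : 0 < μ) (hR : 0 < R) {g : ℝ → ℝ} (hg : IsNice g) :
    adjoint (hOp hμ R) ((hg.memLp R).toLp g) = ((hg.bwd hR hμ).memLp R).toLp (bwd R μ g) := by
  refine adjoint_hilbertSchmidt_eq_toLp (MemLp.coeFn_toLp _) (MemLp.coeFn_toLp _) _ ?_
  refine ae_radMeas fun r hr => ?_
  rw [integral_radMeas, bwd, ← intervalIntegral.integral_const_mul,
    intervalIntegral.integral_of_le hr.2.le, integral_Ioc_eq_integral_Ioo]
  have h1 : ∫ σ in Ioo 0 R, σ * (radKernel μ (σ, r) * g σ) = ∫ σ in Ioo 0 R,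
      (Ioo r R).indicator (fun σ => r ^ μ * (σ ^ (-μ) * g σ)) σ := by
    refine setIntegral_congr_fun measurableSet_Ioo fun σ hσ => ?_
    by_cases h : r < σ
    · have h2 : σ ^ (-μ) = σ * σ ^ (-1 - μ) := by
        rw [show -μ = 1 + (-1 - μ) by ring, Real.rpow_add hσ.1, Real.rpow_one]
      simp only [indicator_of_mem (show σ ∈ Ioo r R from ⟨h, hσ.2⟩), radKernel, if_pos h, h2]
      ring
    · simp only [indicator_of_notMem (fun h' : σ ∈ Ioo r R => h h'.1), radKernel, if_neg h]
      ring
  rw [h1, integral_indicator measurableSet_Ioo, Measure.restrict_restrict measurableSet_Ioo,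
    inter_eq_left.2 (Ioo_subset_Ioo_left hr.1.le)]

theorem memLp_id_mul {f : ℝ → ℝ} (hf : MemLp f 2 (radMeas R)) :
    MemLp (fun r => r * f r) 2 (radMeas R) := by
  refine MemLp.of_le_mul (c := R) hf (measurable_id.aestronglyMeasurable.mul hf.1) ?_
  refine ae_radMeas fun r hr => ?_
  rw [norm_mul, Real.norm_of_nonneg hr.1.le]
  gcongr
  exact hr.2.le

/-- Multiplication by `r` on `L²(r dr)`. -/
noncomputable def mulRad (R : ℝ) : Lp ℝ 2 (radMeas R) →L[ℝ] Lp ℝ 2 (radMeas R) :=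
  LinearMap.mkContinuous
    { toFun := fun f => (memLp_id_mul (Lp.memLp f)).toLp _
      map_add' := fun f g => by
        rw [← MemLp.toLp_add]
        refine MemLp.toLp_congr _ _ ?_
        filter_upwards [Lp.coeFn_add f g] with p hp
        simp only [hp, Pi.add_apply, mul_add]
      map_smul' := fun a f => by
        rw [RingHom.id_apply, ← MemLp.toLp_const_smul]
        refine MemLp.toLp_congr _ _ ?_
        filter_upwards [Lp.coeFn_smul a f] with p hp
        simp only [hp, Pi.smul_apply, smul_eq_mul, mul_left_comm] }
    R fun f => by
      refine Lp.norm_le_mul_norm_of_ae_le_mul ?_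
      filter_upwards [(memLp_id_mul (Lp.memLp f)).coeFn_toLp, ae_radMeas (R := R) fun r hr => hr]
        with r hr hr'
      simp only [LinearMap.coe_mk, AddHom.coe_mk]
      rw [hr, norm_mul, Real.norm_of_nonneg hr'.1.le]
      gcongr
      exact hr'.2.le

theorem mulRad_coeFn (f : Lp ℝ 2 (radMeas R)) :
    mulRad R f =ᵐ[radMeas R] fun r => r * f r :=
  (memLp_id_mul (Lp.memLp f)).coeFn_toLp

theorem mulRad_toLp {f : ℝ → ℝ} (hf : MemLp f 2 (radMeas R)) :
    mulRad R (hf.toLp f) = (memLp_id_mul hf).toLp _ := by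
  refine MemLp.toLp_congr (memLp_id_mul (Lp.memLp _)) _ ?_
  filter_upwards [hf.coeFn_toLp] with r hr
  rw [hr]

theorem norm_mulRad_le (hR : 0 < R) (f : Lp ℝ 2 (radMeas R)) : ‖mulRad R f‖ ≤ R * ‖f‖ :=
  (le_opNorm _ _).trans (by gcongr; exact LinearMap.mkContinuous_norm_le _ hR.le _)

theorem inner_mulRad_left (f g : Lp ℝ 2 (radMeas R)) :
    ⟪mulRad R f, g⟫_ℝ = ⟪f, mulRad R g⟫_ℝ := by
  rw [inner_eq_integral (mulRad_coeFn f) (ae_eq_refl g),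
    inner_eq_integral (ae_eq_refl f) (mulRad_coeFn g)]
  congr 1
  ext r
  ring

end Radial

/-! ### Commutation identities, the norm of H, and the backstepping kernel -/

section RadialIdentities

variable {R μ : ℝ}

theorem IsNice.continuousOn_rpow_mul {f : ℝ → ℝ} (hf : IsNice f) {a : ℝ} (ha : 0 < a) :
    ContinuousOn (fun r => r ^ a * f r) (Ici 0) := by
  intro r hr
  rcases eq_or_lt_of_le (show (0 : ℝ) ≤ r from hr) with rfl | h
  · obtain ⟨C, hC0, hC⟩ := hf.exists_bound 1
    have h0 : Tendsto (fun r : ℝ => r ^ a * C) (𝓝[≥] 0) (𝓝 (0 ^ a * C)) :=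
      (((Real.continuous_rpow_const ha.le).mul continuous_const).tendsto 0).mono_left
        nhdsWithin_le_nhds
    rw [Real.zero_rpow ha.ne', zero_mul] at h0
    rw [ContinuousWithinAt, Real.zero_rpow ha.ne', zero_mul]
    refine squeeze_zero_norm' ?_ h0
    filter_upwards [self_mem_nhdsWithin, nhdsWithin_le_nhds (Iic_mem_nhds (one_pos (α := ℝ)))]
      with r hr hr1
    rw [norm_mul, Real.norm_of_nonneg (Real.rpow_nonneg hr _)]
    rcases eq_or_lt_of_le (show (0 : ℝ) ≤ r from hr) with rfl | h
    · simp [Real.zero_rpow ha.ne']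
    · exact mul_le_mul_of_nonneg_left (hC r ⟨h, hr1⟩) (Real.rpow_nonneg hr _)
  · exact ((((continuousOn_rpow_Ioi a).mul hf.cont) r h).continuousAt
      (Ioi_mem_nhds h)).continuousWithinAt

theorem IsNice.integral_eq_rpow_mul {f F' : ℝ → ℝ} (hf : IsNice f) {a : ℝ} (ha : 0 < a)
    (hF' : IsNice F') (hd : ∀ r > 0, HasDerivAt (fun r => r ^ a * f r) (F' r) r) {r : ℝ}
    (hr : 0 < r) : ∫ σ in (0 : ℝ)..r, F' σ = r ^ a * f r := by
  rw [intervalIntegral.integral_eq_sub_of_hasDerivAt_of_le hr.le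
    ((hf.continuousOn_rpow_mul ha).mono Icc_subset_Ici_self) (fun x hx => hd x hx.1)
    (hF'.intervalIntegrable hr.le)]
  simp [Real.zero_rpow ha.ne']

/-- Integrate (r^(2+μ)φ)' = 2(μ+1)r^(1+μ)φ - r^(2+μ)g from 0, where the boundary term vanishes, and
multiply by r^(-1-μ). -/
theorem id_mul_eq_fwd {φ g : ℝ → ℝ} (hφ : IsNice φ) (hg : IsNice g) (hμ : 0 < μ)
    (hd : ∀ r > 0, HasDerivAt φ (μ / r * φ r - g r) r) {r : ℝ} (hr : 0 < r) :
    r * φ r = 2 * (μ + 1) * fwd μ φ r - fwd μ (fun r => r * g r) r := by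
  have h1 : IsNice fun σ => σ ^ (1 + μ) * φ σ := (IsNice.rpow (by positivity)).mul hφ
  have h2 : IsNice fun σ => σ ^ (1 + μ) * (σ * g σ) := (IsNice.rpow (by positivity)).mul hg.id_mul
  have key := hφ.integral_eq_rpow_mul (a := 2 + μ) (by positivity)
    ((h1.const_mul (2 * (μ + 1))).sub h2) (fun r hr => by
      refine ((Real.hasDerivAt_rpow_const (p := 2 + μ) (Or.inl hr.ne')).mul
        (hd r hr)).congr_deriv ?_
      rw [show 2 + μ - 1 = 1 + μ by ring, show 2 + μ = 1 + μ + 1 by ring,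
        Real.rpow_add hr (1 + μ) 1, Real.rpow_one]
      field_simp
      ring) hr
  rw [intervalIntegral.integral_sub ((h1.const_mul _).intervalIntegrable hr.le)
    (h2.intervalIntegrable hr.le), intervalIntegral.integral_const_mul] at key
  have h3 : r ^ (-1 - μ) * (r ^ (2 + μ) * φ r) = r * φ r := by
    rw [← mul_assoc, ← Real.rpow_add hr, show -1 - μ + (2 + μ) = 1 by ring, Real.rpow_one]
  rw [← h3, ← key, fwd, fwd]
  ring

/-- With ψ = `fwd μ φ`, integrate (r^(1-μ)ψ)' = r^(-μ)(rφ - 2μψ) from r to R; the end point R leaves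
a multiple of (r/R)^μ. -/
theorem fwd_eq_bwd {φ : ℝ → ℝ} (hφ : IsNice φ) (hR : 0 < R) (hμ : 0 < μ) {r : ℝ} (hr : 0 < r) :
    2 * (r * fwd μ φ r) = bwd R μ (fun r => 4 * μ * fwd μ φ r - 2 * (r * φ r)) r +
      2 * (R * fwd μ φ R) * (r / R) ^ μ := by
  have hd : ∀ r > 0, HasDerivAt (fun r => r ^ (1 - μ) * fwd μ φ r)
      (r ^ (-μ) * (r * φ r - 2 * μ * fwd μ φ r)) r := fun r hr => by
    refine ((Real.hasDerivAt_rpow_const (p := 1 - μ) (Or.inl hr.ne')).mul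
      (hasDerivAt_fwd hφ hμ hr)).congr_deriv ?_
    rw [show 1 - μ - 1 = -μ by ring, show 1 - μ = -μ + 1 by ring,
      Real.rpow_add hr (-μ) 1, Real.rpow_one]
    field_simp
    ring
  have h1 : ∫ ρ in r..R, ρ ^ (-μ) * (4 * μ * fwd μ φ ρ - 2 * (ρ * φ ρ)) =
      -2 * (R ^ (1 - μ) * fwd μ φ R - r ^ (1 - μ) * fwd μ φ r) := by
    rw [← intervalIntegral.integral_eq_sub_of_hasDerivAt (a := r) (b := R)
      (fun x hx => hd x (lt_of_lt_of_le (lt_min hr hR) hx.1)), ← intervalIntegral.integral_const_mul]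
    · congr 1
      ext ρ
      ring
    · refine intervalIntegrable_of_pos ((continuousOn_rpow_Ioi _).mul ?_) hr hR
      exact hφ.id_mul.cont.sub ((hφ.fwd hμ).const_mul (2 * μ)).cont
  rw [bwd, h1, Real.div_rpow hr.le hR.le]
  have h2 : r ^ μ * r ^ (1 - μ) = r := by rw [← Real.rpow_add hr]; simp
  have h3 : R ^ (1 - μ) = R / R ^ μ := by rw [Real.rpow_sub hR, Real.rpow_one]
  rw [h3]
  have h4 : R ^ μ ≠ 0 := (Real.rpow_pos_of_pos hR _).ne'
  field_simp
  linear_combination (-fwd μ φ r * R ^ μ) * h2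

theorem isNice_ratio (hμ : 0 < μ) (R : ℝ) : IsNice fun r => (r / R) ^ μ :=
  IsNice.of_continuous ((continuous_id.div_const R).rpow_const fun _ => Or.inr hμ.le)

theorem hasDerivAt_ratio (hR : 0 < R) {r : ℝ} (hr : 0 < r) :
    HasDerivAt (fun r => (r / R) ^ μ) (μ / r * (r / R) ^ μ) r := by
  refine (((hasDerivAt_id r).div_const R).rpow_const (p := μ)
    (Or.inl (div_pos hr hR).ne')).congr_deriv ?_
  simp only [id]
  rw [Real.rpow_sub_one (div_pos hr hR).ne']
  field_simp

/-- The function `(r / R)^μ` as an element of `L²(r dr)`. -/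
noncomputable def eVec (hμ : 0 < μ) (R : ℝ) : Lp ℝ 2 (radMeas R) :=
  ((isNice_ratio hμ R).memLp R).toLp _

theorem toLp_congr_nice {f g : ℝ → ℝ} (hf : MemLp f 2 (radMeas R)) (hg : MemLp g 2 (radMeas R))
    (h : ∀ r > 0, f r = g r) : hf.toLp f = hg.toLp g :=
  MemLp.toLp_congr _ _ (ae_radMeas fun r hr => h r hr.1)

theorem mulRad_adjoint_hOp (hR : 0 < R) (hμ : 0 < μ) (g : Lp ℝ 2 (radMeas R)) :
    mulRad R (adjoint (hOp hμ R) g) =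
      (2 * (μ + 1)) • hOp hμ R (adjoint (hOp hμ R) g) - hOp hμ R (mulRad R g) := by
  refine nice_induction (P := fun g => mulRad R (adjoint (hOp hμ R) g) =
    (2 * (μ + 1)) • hOp hμ R (adjoint (hOp hμ R) g) - hOp hμ R (mulRad R g))
    (isClosed_eq (by fun_prop) (by fun_prop)) (fun g hg => ?_) g
  rw [adjoint_hOp_toLp hμ hR hg, mulRad_toLp, mulRad_toLp, hOp_toLp hμ (hg.bwd hR hμ),
    hOp_toLp hμ hg.id_mul, ← MemLp.toLp_const_smul, ← MemLp.toLp_sub]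
  exact toLp_congr_nice _ _ fun r hr =>
    id_mul_eq_fwd (hg.bwd hR hμ) hg hμ (fun r hr => hasDerivAt_bwd hg hR hr) hr

/-- The function (r/R)^μ is annihilated by ∂_r - μ/r, so `id_mul_eq_fwd` applies with g = 0. -/
theorem mulRad_eVec (hR : 0 < R) (hμ : 0 < μ) :
    mulRad R (eVec hμ R) = (2 * (μ + 1)) • hOp hμ R (eVec hμ R) := by
  rw [eVec, mulRad_toLp, hOp_toLp hμ (isNice_ratio hμ R), ← MemLp.toLp_const_smul]
  refine toLp_congr_nice _ _ fun r hr => ?_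
  have h := id_mul_eq_fwd (isNice_ratio hμ R) (IsNice.of_continuous (continuous_const (y := (0 : ℝ))))
    hμ (fun r hr => by simpa using hasDerivAt_ratio hR hr) hr
  simpa [fwd] using h

/-- Turns the boundary value of rHφ at R into a bounded functional, so that identities proved for
nice functions extend to L² by density. -/
theorem inner_eVec_toLp (hR : 0 < R) (hμ : 0 < μ) {φ : ℝ → ℝ} (hφ : IsNice φ) :
    ⟪eVec hμ R, (hφ.memLp R).toLp φ⟫_ℝ = R * fwd μ φ R := by
  rw [eVec, inner_toLp_toLp, integral_radMeas, fwd, ← intervalIntegral.integral_const_mul,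
    ← intervalIntegral.integral_const_mul, intervalIntegral.integral_of_le hR.le,
    integral_Ioc_eq_integral_Ioo]
  refine setIntegral_congr_fun measurableSet_Ioo fun r hr => ?_
  rw [Real.div_rpow hr.1.le hR.le, Real.rpow_add hr.1, Real.rpow_one, Real.rpow_sub hR,
    Real.rpow_neg_one]
  field_simp

theorem mulRad_hOp (hR : 0 < R) (hμ : 0 < μ) (φ : Lp ℝ 2 (radMeas R)) :
    (2 : ℝ) • mulRad R (hOp hμ R φ) =
      adjoint (hOp hμ R) ((4 * μ) • hOp hμ R φ - (2 : ℝ) • mulRad R φ) +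
        (2 * ⟪eVec hμ R, φ⟫_ℝ) • eVec hμ R := by
  refine nice_induction (P := fun φ => (2 : ℝ) • mulRad R (hOp hμ R φ) =
      adjoint (hOp hμ R) ((4 * μ) • hOp hμ R φ - (2 : ℝ) • mulRad R φ) +
        (2 * ⟪eVec hμ R, φ⟫_ℝ) • eVec hμ R)
    (isClosed_eq (by fun_prop) (by fun_prop)) (fun φ hφ => ?_) φ
  rw [inner_eVec_toLp hR hμ hφ, eVec, hOp_toLp hμ hφ, mulRad_toLp, mulRad_toLp,
    ← MemLp.toLp_const_smul, ← MemLp.toLp_const_smul, ← MemLp.toLp_const_smul, ← MemLp.toLp_sub,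
    ← MemLp.toLp_const_smul]
  have h1 : IsNice fun r => 4 * μ * fwd μ φ r - 2 * (r * φ r) :=
    ((hφ.fwd hμ).const_mul _).sub (hφ.id_mul.const_mul _)
  refine Eq.trans ?_ (congrArg₂ (· + ·) (adjoint_hOp_toLp hμ hR h1).symm rfl)
  rw [← MemLp.toLp_add]
  exact toLp_congr_nice _ _ fun r hr => fwd_eq_bwd hφ hR hμ hr

/-- Pairing `mulRad_hOp` with φ gives 4⟪φ, rHφ⟫ = 4μ‖Hφ‖² + 2⟪e, φ⟫². Dropping the last square
leaves μ‖Hφ‖² ≤ ⟪φ, rHφ⟫ ≤ R‖φ‖‖Hφ‖. -/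
theorem norm_hOp_le (hR : 0 < R) (hμ : 0 < μ) : ‖hOp hμ R‖ ≤ R / μ := by
  refine opNorm_le_bound _ (by positivity) fun φ => ?_
  have h1 := congrArg (fun x => ⟪x, φ⟫_ℝ) (mulRad_hOp hR hμ φ)
  simp only [inner_add_left, adjoint_inner_left, inner_sub_left, inner_smul_left,
    real_inner_self_eq_norm_sq, inner_mulRad_left, conj_trivial] at h1
  have h2 : ⟪hOp hμ R φ, mulRad R φ⟫_ℝ = ⟪φ, mulRad R (hOp hμ R φ)⟫_ℝ := by
    rw [← inner_mulRad_left, real_inner_comm]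
  rw [h2] at h1
  have h3 : ⟪φ, mulRad R (hOp hμ R φ)⟫_ℝ ≤ ‖φ‖ * (R * ‖hOp hμ R φ‖) :=
    (real_inner_le_norm _ _).trans (by gcongr; exact norm_mulRad_le hR _)
  have h4 : μ * ‖hOp hμ R φ‖ ^ 2 ≤ ‖φ‖ * (R * ‖hOp hμ R φ‖) := by
    nlinarith [mul_self_nonneg ⟪eVec hμ R, φ⟫_ℝ]
  rcases eq_or_lt_of_le (norm_nonneg (hOp hμ R φ)) with h | h
  · rw [← h]; positivity
  · rw [div_mul_eq_mul_div, le_div_iff₀ hμ]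
    nlinarith

/-- The operator `f ↦ 2 ∫₀ʳ (ρ/r)^μ f ρ ρ dρ`; the backstepping transformation is `exp (s V)`. -/
noncomputable def volterra (hμ : 0 < μ) (R : ℝ) : Lp ℝ 2 (radMeas R) →L[ℝ] Lp ℝ 2 (radMeas R) :=
  (2 : ℝ) • (mulRad R ∘L hOp hμ R)

/-- The relation LV = VL + 4, with the boundary value 2⟪e, f⟫ of Vf, in inverted form. Commuting r
past H* and e gives rf = 2(μ+1)Hf + HrHg; inserted into `mulRad_hOp`, the coefficient of Hf becomes
4μ - 4(μ+1) = -4. -/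
theorem volterra_apply_of_eq (hR : 0 < R) (hμ : 0 < μ) (f g : Lp ℝ 2 (radMeas R)) (b : ℝ)
    (h : f = -(adjoint (hOp hμ R) ∘L hOp hμ R) g + b • eVec hμ R) :
    volterra hμ R f = -(adjoint (hOp hμ R) ∘L hOp hμ R) (volterra hμ R g + (4 : ℝ) • f) +
      (2 * ⟪eVec hμ R, f⟫_ℝ) • eVec hμ R := by
  have h1 : mulRad R f = (2 * (μ + 1)) • hOp hμ R f + hOp hμ R (mulRad R (hOp hμ R g)) := by
    have h2 := mulRad_adjoint_hOp hR hμ (hOp hμ R g)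
    have h3 := mulRad_eVec hR hμ
    rw [h]
    simp only [map_add, map_neg, map_smul, ContinuousLinearMap.comp_apply, h2, h3]
    module
  have h4 := mulRad_hOp hR hμ f
  have h5 : volterra hμ R f = (2 : ℝ) • mulRad R (hOp hμ R f) := rfl
  have h6 : volterra hμ R g = (2 : ℝ) • mulRad R (hOp hμ R g) := rfl
  rw [h5, h4, h6, h1]
  congr 1
  rw [ContinuousLinearMap.comp_apply, ← map_neg]
  congr 1
  simp only [map_add, map_smul]
  module

theorem adjoint_volterra (hμ : 0 < μ) :
    adjoint (volterra hμ R) = (2 : ℝ) • (adjoint (hOp hμ R) ∘L mulRad R) := by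
  have h : adjoint (mulRad R) = mulRad R :=
    ((eq_adjoint_iff _ _).2 fun x y => inner_mulRad_left x y).symm
  rw [volterra, map_smulₛₗ, adjoint_comp, h]
  simp

theorem isNice_iterate (hμ : 0 < μ) (R : ℝ) (m : ℕ) :
    IsNice fun r => (r / R) ^ μ * ((R ^ 2 - r ^ 2) ^ m / m.factorial) :=
  (isNice_ratio hμ R).mul (IsNice.of_continuous (by fun_prop))

/-- V* multiplies by 2r and applies H*. On (ρ/R)^μ p(ρ) the powers ρ^(±μ) cancel, leaving the
integral of 2ρp from r to R, which sends (R²-ρ²)^m/m! to the next term of the family. -/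
theorem adjoint_volterra_pow_eVec (hR : 0 < R) (hμ : 0 < μ) (m : ℕ) :
    (adjoint (volterra hμ R) ^ m) (eVec hμ R) = ((isNice_iterate hμ R m).memLp R).toLp _ := by
  induction m with
  | zero =>
    rw [pow_zero, one_apply_eq_self, eVec]
    exact toLp_congr_nice _ _ fun r hr => by simp
  | succ m ih =>
    rw [pow_succ', mul_apply_eq_comp, ih, adjoint_volterra, smul_apply,
      ContinuousLinearMap.comp_apply, mulRad_toLp,
      adjoint_hOp_toLp hμ hR (isNice_iterate hμ R m).id_mul, ← MemLp.toLp_const_smul]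
    refine toLp_congr_nice _ _ fun r hr => ?_
    have hd : ∀ ρ : ℝ, HasDerivAt (fun ρ => -(R ^ 2 - ρ ^ 2) ^ (m + 1) / (m + 1).factorial)
        (2 * ρ * ((R ^ 2 - ρ ^ 2) ^ m / m.factorial)) ρ := fun ρ => by
      refine (((((hasDerivAt_id ρ).pow 2).const_sub (R ^ 2)).pow (m + 1)).neg.div_const
        ((m + 1).factorial : ℝ)).congr_deriv ?_
      have := Nat.factorial_ne_zero m
      simp only [id, Nat.factorial_succ]
      push_cast
      field_simp
      simp [mul_comm]
    have h1 : ∫ ρ in r..R, ρ ^ (-μ) * (ρ * ((ρ / R) ^ μ * ((R ^ 2 - ρ ^ 2) ^ m / m.factorial))) =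
        ∫ ρ in r..R, (R ^ μ)⁻¹ / 2 * (2 * ρ * ((R ^ 2 - ρ ^ 2) ^ m / m.factorial)) := by
      refine intervalIntegral.integral_congr fun ρ hρ => ?_
      have hρ0 : 0 < ρ := lt_of_lt_of_le (lt_min hr hR) hρ.1
      rw [Real.div_rpow hρ0.le hR.le, Real.rpow_neg hρ0.le]
      have := (Real.rpow_pos_of_pos hρ0 μ).ne'
      field_simp
    simp only [Pi.smul_apply, smul_eq_mul]
    rw [bwd, h1, intervalIntegral.integral_const_mul, intervalIntegral.integral_eq_sub_of_hasDerivAt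
      (fun x _ => hd x) (Continuous.intervalIntegrable (by fun_prop) _ _),
      Real.div_rpow hr.le hR.le]
    simp
    ring

/-- The `n`-th backstepping kernel at `r = R`, as a function of `κ = (λ + c) / ε` and the angular
frequency `μ`. -/
noncomputable def besselKernel (κ R μ ρ : ℝ) : ℝ :=
  -κ * ρ * (ρ / R) ^ μ * (besselI1 (Real.sqrt (κ * (R ^ 2 - ρ ^ 2))) /
    Real.sqrt (κ * (R ^ 2 - ρ ^ 2)))

/-- The quotient is a power series in x², so the square root inside the kernel disappears. -/
theorem besselI1_div_self {x : ℝ} (hx : x ≠ 0) :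
    besselI1 x / x = ∑' m : ℕ, (x ^ 2 / 4) ^ m / (2 * ((m.factorial : ℝ) * (m + 1).factorial)) := by
  rw [besselI1, ← tsum_div_const]
  refine tsum_congr fun m => ?_
  have h : (x / 2) ^ (2 * m + 1) = (x ^ 2 / 4) ^ m * x / 2 := by
    rw [pow_succ, pow_mul, div_pow]
    ring
  rw [h]
  field_simp

theorem neg_besselKernel_eq_tsum {κ ρ : ℝ} (hκ : 0 ≤ κ) (hρ : ρ ∈ Ioo 0 R) :
    -besselKernel κ R μ ρ = ∑' m : ℕ, ρ * (2 * ((κ / 4) ^ (m + 1) / (m + 1).factorial) *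
      ((ρ / R) ^ μ * ((R ^ 2 - ρ ^ 2) ^ m / m.factorial))) := by
  -- For κ = 0 the quotient is 0/0 by convention, but the prefactor κ makes both sides vanish.
  rcases eq_or_lt_of_le hκ with rfl | hκ
  · simp [besselKernel]
  have h1 : 0 < κ * (R ^ 2 - ρ ^ 2) := by
    have : ρ ^ 2 < R ^ 2 := pow_lt_pow_left₀ hρ.2 hρ.1.le two_ne_zero
    exact mul_pos hκ (by linarith)
  rw [besselKernel, besselI1_div_self (Real.sqrt_pos.2 h1).ne', Real.sq_sqrt h1.le, ← tsum_mul_left,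
    ← tsum_neg]
  refine tsum_congr fun m => ?_
  rw [show κ * (R ^ 2 - ρ ^ 2) / 4 = κ / 4 * (R ^ 2 - ρ ^ 2) by ring, mul_pow]
  field_simp
  ring

/-- Moving V^m onto e gives explicit kernels, which sum to the Bessel kernel under the integral. The
series is the boundary value created by exp((κ/4)V), and its sum is minus the feedback coefficient.
-/
theorem hasSum_inner_volterra_pow (hR : 0 < R) (hμ : 0 < μ) {κ : ℝ} (hκ : 0 ≤ κ)
    (f : Lp ℝ 2 (radMeas R)) :
    HasSum (fun m : ℕ => (κ / 4) ^ (m + 1) / (m + 1).factorial *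
      (2 * ⟪eVec hμ R, (volterra hμ R ^ m) f⟫_ℝ)) (-∫ ρ in Ioo 0 R, besselKernel κ R μ ρ * f ρ) := by
  set F : ℕ → ℝ → ℝ := fun m ρ => (2 * ((κ / 4) ^ (m + 1) / (m + 1).factorial) *
      ((ρ / R) ^ μ * ((R ^ 2 - ρ ^ 2) ^ m / m.factorial))) * f ρ with hF
  have hFn : ∀ m, IsNice fun ρ => (2 * ((κ / 4) ^ (m + 1) / (m + 1).factorial) *
      ((ρ / R) ^ μ * ((R ^ 2 - ρ ^ 2) ^ m / m.factorial))) := fun m =>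
    (isNice_iterate hμ R m).const_mul _
  have hint : ∀ m, Integrable (F m) (radMeas R) := fun m =>
    MemLp.integrable_mul ((hFn m).memLp R) (Lp.memLp f)
  have h1 : ∀ m, (κ / 4) ^ (m + 1) / (m + 1).factorial *
      (2 * ⟪eVec hμ R, (volterra hμ R ^ m) f⟫_ℝ) = ∫ ρ, F m ρ ∂radMeas R := by
    intro m
    rw [← adjoint_inner_left, ← star_eq_adjoint, star_pow, star_eq_adjoint,
      adjoint_volterra_pow_eVec hR hμ m,
      inner_eq_integral (MemLp.coeFn_toLp _) (ae_eq_refl f), ← integral_const_mul,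
      ← integral_const_mul]
    congr 1
    ext ρ
    simp only [hF]
    ring
  have hfi : Integrable (fun ρ => f ρ) (radMeas R) := (Lp.memLp f).integrable (by norm_num)
  -- Bounding (ρ/R)^μ by 1, R²-ρ² by R² and 1/(m+1)! by 1 leaves an exponential series as majorant.
  have hsum : Summable fun m => ∫ ρ, ‖F m ρ‖ ∂radMeas R := by
    refine Summable.of_nonneg_of_le (fun m => integral_nonneg fun _ => norm_nonneg _) (fun m => ?_)
      ((Real.summable_pow_div_factorial (κ / 4 * R ^ 2)).mul_left
        (2 * (κ / 4) * ∫ ρ, ‖f ρ‖ ∂radMeas R))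
    rw [mul_right_comm, ← integral_const_mul]
    refine integral_mono_ae (hint m).norm (hfi.norm.const_mul _) (ae_radMeas fun ρ hρ => ?_)
    simp only [hF]
    rw [norm_mul]
    refine mul_le_mul_of_nonneg_right ?_ (norm_nonneg _)
    have hρR : ρ / R ≤ 1 := (div_le_one hR).2 hρ.2.le
    have hρ0 : 0 ≤ ρ / R := (div_pos hρ.1 hR).le
    have h2 : 0 ≤ R ^ 2 - ρ ^ 2 := by
      have : ρ ^ 2 ≤ R ^ 2 := pow_le_pow_left₀ hρ.1.le hρ.2.le 2
      linarith
    have h3 : R ^ 2 - ρ ^ 2 ≤ R ^ 2 := by nlinarith [sq_nonneg ρ]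
    have h4 : (ρ / R) ^ μ ≤ 1 := Real.rpow_le_one hρ0 hρR hμ.le
    have h5 : (1 : ℝ) ≤ (m + 1).factorial := by exact_mod_cast Nat.succ_le_of_lt (Nat.factorial_pos _)
    rw [Real.norm_of_nonneg (by positivity)]
    calc 2 * ((κ / 4) ^ (m + 1) / (m + 1).factorial) *
          ((ρ / R) ^ μ * ((R ^ 2 - ρ ^ 2) ^ m / m.factorial))
        ≤ 2 * ((κ / 4) ^ (m + 1) / 1) * (1 * ((R ^ 2) ^ m / m.factorial)) := by gcongr
      _ = 2 * (κ / 4) * ((κ / 4 * R ^ 2) ^ m / m.factorial) := by rw [mul_pow, pow_succ]; ring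
  have h2 := hasSum_integral_of_summable_integral_norm hint hsum
  simp only [h1]
  suffices h3 : ∫ ρ, ∑' m, F m ρ ∂radMeas R = -∫ ρ in Ioo 0 R, besselKernel κ R μ ρ * f ρ from
    h3 ▸ h2
  rw [integral_radMeas, ← integral_neg]
  refine setIntegral_congr_fun measurableSet_Ioo fun ρ hρ => ?_
  simp only [hF]
  rw [← neg_mul, neg_besselKernel_eq_tsum hκ hρ, tsum_mul_right, tsum_mul_left]
  ring

end RadialIdentities

/-! ### Test functions on an interval -/

section IntervalTests

/-- Test functions on the interval `(a, b)`. -/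
structure IsTestOn (a b : ℝ) (χ : ℝ → ℝ) : Prop where
  smooth : ContDiff ℝ ∞ χ
  compact : HasCompactSupport χ
  inside : tsupport χ ⊆ Ioo a b

variable {a b : ℝ} {χ : ℝ → ℝ}

theorem IsTestOn.deriv (hχ : IsTestOn a b χ) : IsTestOn a b (deriv χ) :=
  ⟨(contDiff_infty_iff_deriv.1 hχ.smooth).2, hχ.compact.deriv,
    (closure_minimal support_deriv_subset (isClosed_tsupport _)).trans hχ.inside⟩

theorem IsTestOn.hasDerivAt (hχ : IsTestOn a b χ) (x : ℝ) : HasDerivAt χ (_root_.deriv χ x) x :=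
  (hχ.smooth.differentiable (by simp) x).hasDerivAt

theorem IsTestOn.eq_zero (hχ : IsTestOn a b χ) {x : ℝ} (hx : x ∉ Ioo a b) : χ x = 0 :=
  image_eq_zero_of_notMem_tsupport fun h => hx (hχ.inside h)

theorem IsTestOn.sub {η : ℝ → ℝ} (hχ : IsTestOn a b χ) (hη : IsTestOn a b η) :
    IsTestOn a b (fun x => χ x - η x) :=
  ⟨hχ.smooth.sub hη.smooth, hχ.compact.sub hη.compact,
    (tsupport_sub χ η).trans (union_subset hχ.inside hη.inside)⟩

theorem IsTestOn.const_mul (hχ : IsTestOn a b χ) (c : ℝ) : IsTestOn a b (fun x => c * χ x) :=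
  ⟨contDiff_const.mul hχ.smooth, hχ.compact.mul_left,
    (tsupport_mul_subset_right (f := fun _ => c)).trans hχ.inside⟩

theorem IsTestOn.mul_contDiffOn (hχ : IsTestOn a b χ) {F : ℝ → ℝ} (hF : ContDiffOn ℝ ∞ F (Ioo a b)) :
    IsTestOn a b (fun x => F x * χ x) := by
  refine ⟨contDiff_iff_contDiffAt.2 fun x => ?_, hχ.compact.mul_left,
    (tsupport_mul_subset_right (f := F)).trans hχ.inside⟩
  by_cases hx : x ∈ tsupport χ
  · exact (hF.contDiffAt (isOpen_Ioo.mem_nhds (hχ.inside hx))).mul hχ.smooth.contDiffAt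
  · refine (contDiffAt_const (c := (0 : ℝ))).congr_of_eventuallyEq ?_
    filter_upwards [notMem_tsupport_iff_eventuallyEq.1 hx] with y hy
    simp [hy]

theorem IsTestOn.continuous_mul (hχ : IsTestOn a b χ) {F : ℝ → ℝ} (hF : ContinuousOn F (Ioo a b)) :
    Continuous (fun x => F x * χ x) := by
  refine continuous_of_tsupport fun x hx => ?_
  have hx' := hχ.inside (tsupport_mul_subset_right (f := F) hx)
  exact (hF.continuousAt (isOpen_Ioo.mem_nhds hx')).mul hχ.smooth.continuous.continuousAt

theorem IsTestOn.integrable_mul (hχ : IsTestOn a b χ) {F : ℝ → ℝ} (hF : ContinuousOn F (Ioo a b)) :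
    Integrable (fun x => F x * χ x) :=
  (hχ.continuous_mul hF).integrable_of_hasCompactSupport hχ.compact.mul_left

theorem IsTestOn.setIntegral_mul (hχ : IsTestOn a b χ) (F : ℝ → ℝ) :
    ∫ x in Ioo a b, F x * χ x = ∫ x, F x * χ x :=
  setIntegral_eq_integral_of_forall_compl_eq_zero fun x hx => by rw [hχ.eq_zero hx, mul_zero]

theorem IsTestOn.setIntegral (hχ : IsTestOn a b χ) : ∫ x in Ioo a b, χ x = ∫ x, χ x :=
  setIntegral_eq_integral_of_forall_compl_eq_zero fun _ hx => hχ.eq_zero hx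

/-- Integration by parts against a test function. -/
theorem IsTestOn.integral_mul_deriv (hχ : IsTestOn a b χ) {F F' : ℝ → ℝ}
    (hF : ∀ x ∈ Ioo a b, HasDerivAt F (F' x) x) (hF' : ContinuousOn F' (Ioo a b)) :
    ∫ x in Ioo a b, F x * _root_.deriv χ x = -∫ x in Ioo a b, F' x * χ x := by
  have hFc : ContinuousOn F (Ioo a b) := fun x hx => (hF x hx).continuousAt.continuousWithinAt
  have hd : ∀ x, HasDerivAt (fun x => F x * χ x) (F' x * χ x + F x * _root_.deriv χ x) x := by
    intro x
    by_cases hx : x ∈ Ioo a b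
    · exact (hF x hx).mul (hχ.hasDerivAt x)
    · have hx' : x ∉ tsupport χ := fun h => hx (hχ.inside h)
      rw [hχ.eq_zero hx, hχ.deriv.eq_zero hx, mul_zero, mul_zero, add_zero]
      refine (hasDerivAt_const x (0 : ℝ)).congr_of_eventuallyEq ?_
      filter_upwards [notMem_tsupport_iff_eventuallyEq.1 hx'] with y hy
      simp [hy]
  have h := integral_eq_zero_of_hasDerivAt_of_integrable hd
    ((hχ.integrable_mul hF').add (hχ.deriv.integrable_mul hFc)) (hχ.integrable_mul hFc)
  rw [integral_add (hχ.integrable_mul hF') (hχ.deriv.integrable_mul hFc)] at h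
  rw [hχ.setIntegral_mul, hχ.deriv.setIntegral_mul]
  linarith

theorem IsTestOn.exists_Icc (hχ : IsTestOn a b χ) (hab : a < b) :
    ∃ a' b', a < a' ∧ a' ≤ b' ∧ b' < b ∧ tsupport χ ⊆ Icc a' b' := by
  rcases (tsupport χ).eq_empty_or_nonempty with h | h
  · exact ⟨(a + b) / 2, (a + b) / 2, by linarith, le_rfl, by linarith, by simp [h]⟩
  · have hc : IsCompact (tsupport χ) := hχ.compact
    have h1 := hc.sInf_mem h
    have h2 := hc.sSup_mem h
    exact ⟨_, _, (hχ.inside h1).1, csInf_le hc.bddBelow h2, (hχ.inside h2).2,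
      fun x hx => ⟨csInf_le hc.bddBelow hx, le_csSup hc.bddAbove hx⟩⟩

/-- The primitive from a vanishes to the left of the support and, by the zero mean, also to the
right of it. -/
theorem IsTestOn.exists_primitive (hχ : IsTestOn a b χ) (hab : a < b)
    (h0 : ∫ x in Ioo a b, χ x = 0) : ∃ G, IsTestOn a b G ∧ _root_.deriv G = χ := by
  obtain ⟨a', b', ha', hab', hb', hsub⟩ := hχ.exists_Icc hab
  have hout : ∀ x, x ∉ Icc a' b' → χ x = 0 := fun x hx =>
    image_eq_zero_of_notMem_tsupport fun h => hx (hsub h)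
  have hc := hχ.smooth.continuous
  have hd : ∀ x, HasDerivAt (fun x => ∫ t in a..x, χ t) (χ x) x := fun x =>
    intervalIntegral.integral_hasDerivAt_right (hc.intervalIntegrable _ _)
      (hc.stronglyMeasurableAtFilter _ _) hc.continuousAt
  have hderiv : _root_.deriv (fun x => ∫ t in a..x, χ t) = χ := funext fun x => (hd x).deriv
  have hzero : ∀ x, x ∉ Icc a' b' → ∫ t in a..x, χ t = 0 := by
    intro x hx
    by_cases h1 : x < a'
    · refine intervalIntegral.integral_zero_ae (Eventually.of_forall fun t ht => hout t fun h => ?_)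
      rcases le_total a x with h2 | h2
      · rw [uIoc_of_le h2] at ht
        linarith [ht.2, h.1]
      · rw [uIoc_of_ge h2] at ht
        linarith [ht.2, h.1]
    · have h2 : b' < x := by
        by_contra h3
        exact hx ⟨not_lt.1 h1, not_lt.1 h3⟩
      have h3 : ∫ t in a..b, χ t = 0 := by
        rw [intervalIntegral.integral_of_le hab.le, integral_Ioc_eq_integral_Ioo, h0]
      rw [← intervalIntegral.integral_add_adjacent_intervals (hc.intervalIntegrable a b)
        (hc.intervalIntegrable b x), h3, zero_add]
      refine intervalIntegral.integral_zero_ae (Eventually.of_forall fun t ht => hout t fun h => ?_)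
      rcases le_total b x with h4 | h4
      · rw [uIoc_of_le h4] at ht
        linarith [ht.1, h.2]
      · rw [uIoc_of_ge h4] at ht
        linarith [ht.1, h.2]
  refine ⟨_, ⟨?_, HasCompactSupport.intro isCompact_Icc hzero, ?_⟩, hderiv⟩
  · rw [contDiff_infty_iff_deriv, hderiv]
    exact ⟨fun x => (hd x).differentiableAt, hχ.smooth⟩
  · refine (closure_minimal (fun x hx => ?_) isClosed_Icc).trans (Icc_subset_Ioo ha' hb')
    by_contra h
    exact hx (hzero x h)

theorem exists_isTestOn_integral_eq_one (hab : a < b) :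
    ∃ χ, IsTestOn a b χ ∧ ∫ x in Ioo a b, χ x = 1 := by
  let f : ContDiffBump ((a + b) / 2) := ⟨(b - a) / 8, (b - a) / 4, by linarith, by linarith⟩
  have h : IsTestOn a b (f.normed volume) := by
    refine ⟨f.contDiff_normed, f.hasCompactSupport_normed, ?_⟩
    rw [f.tsupport_normed_eq, Real.closedBall_eq_Icc]
    refine Icc_subset_Ioo ?_ ?_
    · change a < (a + b) / 2 - (b - a) / 4
      linarith
    · change (a + b) / 2 + (b - a) / 4 < b
      linarith
  exact ⟨_, h, by rw [h.setIntegral, f.integral_normed]⟩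

theorem ae_eq_zero_of_forall_isTestOn {f : ℝ → ℝ} (hf : IntegrableOn f (Ioo a b))
    (h : ∀ χ, IsTestOn a b χ → ∫ x in Ioo a b, f x * χ x = 0) :
    ∀ᵐ x ∂volume.restrict (Ioo a b), f x = 0 := by
  rw [ae_restrict_iff' measurableSet_Ioo]
  refine isOpen_Ioo.ae_eq_zero_of_integral_contDiff_smul_eq_zero hf.locallyIntegrableOn ?_
  intro g hg1 hg2 hg3
  have hg : IsTestOn a b g := ⟨hg1, hg2, hg3⟩
  have := h g hg
  rw [hg.setIntegral_mul] at this
  simpa only [smul_eq_mul, mul_comm] using this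

/-- A function with vanishing weak derivative is constant. -/
theorem ae_eq_const_of_forall_isTestOn {f : ℝ → ℝ} (hab : a < b) (hf : IntegrableOn f (Ioo a b))
    (h : ∀ χ, IsTestOn a b χ → ∫ x in Ioo a b, f x * deriv χ x = 0) :
    ∃ C, ∀ᵐ x ∂volume.restrict (Ioo a b), f x = C := by
  obtain ⟨ψ, hψ, hψ1⟩ := exists_isTestOn_integral_eq_one hab
  have hint : ∀ χ, IsTestOn a b χ → IntegrableOn (fun x => f x * χ x) (Ioo a b) := by
    intro χ hχ
    obtain ⟨M, hM⟩ := hχ.compact.exists_bound_of_continuous hχ.smooth.continuous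
    exact hf.mul_bdd (c := M) hχ.smooth.continuous.aestronglyMeasurable (Eventually.of_forall hM)
  have hintχ : ∀ χ, IsTestOn a b χ → IntegrableOn χ (Ioo a b) := fun χ hχ =>
    (hχ.smooth.continuous.integrable_of_hasCompactSupport hχ.compact).integrableOn
  refine ⟨∫ x in Ioo a b, f x * ψ x, ?_⟩
  set C := ∫ x in Ioo a b, f x * ψ x with hC
  have key := ae_eq_zero_of_forall_isTestOn (a := a) (b := b) (f := fun x => f x - C)
    (hf.sub (integrableOn_const (by simp) (by simp))) ?_
  · filter_upwards [key] with x hx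
    linarith
  · intro χ hχ
    set I := ∫ x in Ioo a b, χ x with hI
    -- Subtracting I ψ makes the mean zero, so the difference is the derivative of a test function.
    have hg : IsTestOn a b (fun x => χ x - I * ψ x) := hχ.sub (hψ.const_mul I)
    obtain ⟨G, hG, hGd⟩ := hg.exists_primitive hab (by
      rw [integral_sub (hintχ χ hχ) ((hintχ ψ hψ).const_mul I), integral_const_mul, hψ1, mul_one,
        sub_self])
    have h1 := h G hG
    rw [hGd] at h1
    simp only [mul_sub, mul_left_comm _ I] at h1
    rw [integral_sub (hint χ hχ) ((hint ψ hψ).const_mul I), integral_const_mul, ← hC] at h1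
    simp only [sub_mul]
    rw [integral_sub (hint χ hχ) ((hintχ χ hχ).const_mul C), integral_const_mul, ← hI]
    linarith

end IntervalTests

/-! ### Radial test functions: injectivity of H and totality -/

section RadialTests

variable {R μ : ℝ} {χ : ℝ → ℝ}

theorem IsTestOn.continuous_inv_mul (hχ : IsTestOn 0 R χ) : Continuous fun r => r⁻¹ * χ r :=
  hχ.continuous_mul (continuousOn_inv₀.mono fun _ hx => ne_of_gt hx.1)

theorem IsTestOn.isNice (hχ : IsTestOn 0 R χ) : IsNice χ := IsNice.of_continuous hχ.smooth.continuous

theorem IsTestOn.isNice_inv_mul (hχ : IsTestOn 0 R χ) : IsNice fun r => r⁻¹ * χ r :=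
  IsNice.of_continuous hχ.continuous_inv_mul

/-- `χ' - μ χ / r`. -/
noncomputable def radD (μ : ℝ) (χ : ℝ → ℝ) (r : ℝ) : ℝ := deriv χ r - μ * (r⁻¹ * χ r)

theorem IsTestOn.isNice_radD (hχ : IsTestOn 0 R χ) : IsNice (radD μ χ) :=
  hχ.deriv.isNice.sub (hχ.isNice_inv_mul.const_mul μ)

/-- A test function vanishes at R, so -H* recovers it from χ' - μχ/r. This converts weak
formulations into statements about H. -/
theorem IsTestOn.toLp_eq_neg_adjoint (hχ : IsTestOn 0 R χ) (hR : 0 < R) (hμ : 0 < μ) :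
    (hχ.isNice.memLp R).toLp χ =
      -adjoint (hOp hμ R) ((hχ.isNice_radD.memLp R).toLp (radD μ χ)) := by
  rw [adjoint_hOp_toLp hμ hR hχ.isNice_radD, ← MemLp.toLp_neg]
  refine toLp_congr_nice _ _ fun r hr => ?_
  have hd : ∀ ρ > 0, HasDerivAt (fun ρ => ρ ^ (-μ) * χ ρ) (ρ ^ (-μ) * radD μ χ ρ) ρ := fun ρ hρ => by
    refine ((Real.hasDerivAt_rpow_const (p := -μ) (Or.inl hρ.ne')).mul
      (hχ.hasDerivAt ρ)).congr_deriv ?_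
    rw [Real.rpow_sub_one hρ.ne', radD]
    field_simp
    ring
  rw [Pi.neg_apply, bwd, intervalIntegral.integral_eq_sub_of_hasDerivAt (fun ρ hρ => hd ρ
    (lt_of_lt_of_le (lt_min hr hR) hρ.1)) (intervalIntegrable_of_pos
      ((continuousOn_rpow_Ioi _).mul hχ.isNice_radD.cont) hr hR),
    hχ.eq_zero (x := R) (by simp), mul_zero, zero_sub, mul_neg, neg_neg, ← mul_assoc,
    ← Real.rpow_add hr]
  simp

theorem integrableOn_id_mul {f : ℝ → ℝ} (hf : Integrable f (radMeas R)) :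
    IntegrableOn (fun r => r * f r) (Ioo 0 R) := by
  rw [radMeas, integrable_withDensity_iff_integrable_smul' (by fun_prop) (by simp)] at hf
  refine hf.congr (ae_restrict_of_forall_mem measurableSet_Ioo fun r hr => ?_)
  simp [ENNReal.toReal_ofReal hr.1.le]

theorem ae_radMeas_of_ae_restrict {P : ℝ → Prop} (h : ∀ᵐ r ∂volume.restrict (Ioo 0 R), P r) :
    ∀ᵐ r ∂radMeas R, P r :=
  (radMeas_absolutelyContinuous R).ae_le h

theorem inner_nice (f : Lp ℝ 2 (radMeas R)) {g : ℝ → ℝ} (hg : IsNice g) :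
    ⟪f, (hg.memLp R).toLp g⟫_ℝ = ∫ r in Ioo 0 R, r * f r * g r := by
  rw [inner_eq_integral (ae_eq_refl f) (MemLp.coeFn_toLp _), integral_radMeas]
  simp only [mul_assoc]

/-- Test functions lie in the range of H*, and the kernel of H is orthogonal to that range. -/
theorem hOp_injective (hR : 0 < R) (hμ : 0 < μ) (f : Lp ℝ 2 (radMeas R)) (hf : hOp hμ R f = 0) :
    f = 0 := by
  have h1 := ae_eq_zero_of_forall_isTestOn
    (integrableOn_id_mul ((Lp.memLp f).integrable (by norm_num))) (fun χ hχ => by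
      rw [← inner_nice f hχ.isNice, hχ.toLp_eq_neg_adjoint hR hμ, inner_neg_right,
        adjoint_inner_right, hf, inner_zero_left, neg_zero])
  rw [Lp.eq_zero_iff_ae_eq_zero]
  filter_upwards [ae_radMeas_of_ae_restrict h1, ae_radMeas (R := R) fun r hr => hr] with r h2 h3
  exact (mul_eq_zero.1 h2).resolve_left h3.1.ne'

/-- The functions `χ' - μ χ / r`, for test functions `χ`, are total in `L²(r dr)`. -/
theorem eq_zero_of_forall_inner_radD (hR : 0 < R) (hμ : 0 < μ) (Y : Lp ℝ 2 (radMeas R))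
    (h : ∀ χ (hχ : IsTestOn 0 R χ), ⟪Y, (hχ.isNice_radD.memLp R).toLp (radD μ χ)⟫_ℝ = 0) :
    Y = 0 := by
  have hYi := integrableOn_id_mul ((Lp.memLp Y).integrable one_le_two)
  have hint : IntegrableOn (fun r => r * Y r * r ^ μ) (Ioo 0 R) := by
    refine Integrable.mul_bdd (c := R ^ μ) hYi
      (Real.continuous_rpow_const hμ.le).aestronglyMeasurable
      (ae_restrict_of_forall_mem measurableSet_Ioo fun r hr => ?_)
    rw [Real.norm_of_nonneg (Real.rpow_nonneg hr.1.le _)]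
    exact Real.rpow_le_rpow hr.1.le hr.2.le hμ.le
  have hconst : ∀ G, IsTestOn 0 R G → ∫ r in Ioo 0 R, r * Y r * r ^ μ * deriv G r = 0 := by
    intro G hG
    -- The integrating factor r^μ turns χ' - μχ/r into r^μ G', so r^(1+μ)Y has vanishing weak
    -- derivative.
    have hχ : IsTestOn 0 R (fun r => r ^ μ * G r) := hG.mul_contDiffOn fun r hr =>
      (Real.contDiffAt_rpow_const_of_ne (n := ∞) (p := μ) hr.1.ne').contDiffWithinAt
    refine Eq.trans ?_ (h _ hχ)
    rw [inner_nice Y (hχ.isNice_radD (μ := μ))]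
    refine setIntegral_congr_fun measurableSet_Ioo fun r hr => ?_
    have hd : deriv (fun r => r ^ μ * G r) r = μ * r ^ (μ - 1) * G r + r ^ μ * deriv G r :=
      ((Real.hasDerivAt_rpow_const (p := μ) (Or.inl hr.1.ne')).mul (hG.hasDerivAt r)).deriv
    simp only [radD]
    rw [hd, Real.rpow_sub_one hr.1.ne']
    have := hr.1.ne'
    field_simp
    ring
  obtain ⟨C, hC⟩ := ae_eq_const_of_forall_isTestOn hR hint hconst
  have hsq := integrableOn_id_mul (Lp.memLp Y).integrable_sq
  -- Otherwise Y = C r^(-1-μ), and rY² would be a multiple of r^(-1-2μ), which is not integrable at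
  -- 0.
  have hC0 : C = 0 := by
    by_contra hC0
    have h1 : IntegrableOn (fun r : ℝ => r ^ (-1 - 2 * μ)) (Ioo 0 R) := by
      refine (hsq.const_mul (C⁻¹ ^ 2)).congr ?_
      filter_upwards [hC, ae_restrict_mem measurableSet_Ioo] with r h1 h2
      have hr := h2.1
      have h3 : Y r = C * (r ^ μ)⁻¹ * r⁻¹ := by
        have := (Real.rpow_pos_of_pos hr μ).ne'
        rw [← h1]
        field_simp
      have h4 : r ^ (-1 - 2 * μ) = r⁻¹ * (r ^ μ)⁻¹ ^ 2 := by
        rw [Real.rpow_sub hr, Real.rpow_neg_one, mul_comm 2 μ, Real.rpow_mul hr.le, div_eq_mul_inv,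
          inv_pow]
        norm_num
      rw [h3, h4]
      field_simp
    rw [intervalIntegral.integrableOn_Ioo_rpow_iff hR] at h1
    linarith
  rw [Lp.eq_zero_iff_ae_eq_zero]
  filter_upwards [ae_radMeas_of_ae_restrict hC, ae_radMeas (R := R) fun r hr => hr] with r h2 h3
  rw [hC0] at h2
  exact (mul_eq_zero.1 ((mul_eq_zero.1 h2).resolve_right
    (Real.rpow_pos_of_pos h3.1 μ).ne')).resolve_left h3.1.ne'

end RadialTests

/-! ### Angular test functions -/

section AngularTests

variable {θ₁ θ₂ : ℝ}

/-- Lebesgue measure on the interval of angles. -/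
noncomputable abbrev angMeas (θ₁ θ₂ : ℝ) : Measure ℝ := volume.restrict (Ioo θ₁ θ₂)

theorem memLp_angMeas {s : ℝ → ℝ} (hs : Continuous s) : MemLp s 2 (angMeas θ₁ θ₂) := by
  obtain ⟨C, hC⟩ := (isCompact_Icc (a := θ₁) (b := θ₂)).exists_bound_of_continuousOn hs.continuousOn
  exact MemLp.of_bound hs.aestronglyMeasurable C
    (ae_restrict_of_forall_mem measurableSet_Ioo fun x hx => hC x (Ioo_subset_Icc_self hx))

theorem inner_toLp_angMeas (P : Lp ℝ 2 (angMeas θ₁ θ₂)) {s : ℝ → ℝ} (hs : Continuous s) :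
    ⟪P, (memLp_angMeas hs).toLp s⟫_ℝ = ∫ x in Ioo θ₁ θ₂, P x * s x :=
  inner_eq_integral (ae_eq_refl P) (MemLp.coeFn_toLp _)

theorem memLp_primitiveKernel (θ₁ θ₂ : ℝ) :
    MemLp (fun p : ℝ × ℝ => if p.2 < p.1 then (1 : ℝ) else 0) 2
      ((angMeas θ₁ θ₂).prod (angMeas θ₁ θ₂)) :=
  MemLp.of_bound (Measurable.ite (measurableSet_lt measurable_snd measurable_fst) measurable_const
    measurable_const).aestronglyMeasurable 1 (Eventually.of_forall fun p => by
      split_ifs <;> simp)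

/-- Writing s as a bounded operator K applied to s' merges a pairing with s and one with s' into a
single pairing with s', through K*. -/
theorem hilbertSchmidt_primitive {s s' : ℝ → ℝ} (hs : ∀ x, HasDerivAt s (s' x) x)
    (hs' : Continuous s') (h1 : s θ₁ = 0) :
    hilbertSchmidt ((memLp_primitiveKernel θ₁ θ₂).toLp _) ((memLp_angMeas hs').toLp s') =
      (memLp_angMeas (continuous_iff_continuousAt.2 fun x => (hs x).continuousAt)).toLp s := by
  refine hilbertSchmidt_eq_toLp (MemLp.coeFn_toLp _) (MemLp.coeFn_toLp _) _
    (ae_restrict_of_forall_mem measurableSet_Ioo fun x hx => ?_)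
  have h2 : ∫ y in Ioo θ₁ θ₂, (if y < x then (1 : ℝ) else 0) * s' y =
      ∫ y in Ioo θ₁ θ₂, (Ioo θ₁ x).indicator s' y := by
    refine setIntegral_congr_fun measurableSet_Ioo fun y hy => ?_
    by_cases h : y < x
    · simp only [if_pos h, indicator_of_mem (show y ∈ Ioo θ₁ x from ⟨hy.1, h⟩), one_mul]
    · simp only [if_neg h, indicator_of_notMem (fun h' : y ∈ Ioo θ₁ x => h h'.2), zero_mul]
  rw [h2, integral_indicator measurableSet_Ioo, Measure.restrict_restrict measurableSet_Ioo,
    inter_eq_left.2 (Ioo_subset_Ioo_right hx.2.le), ← integral_Ioc_eq_integral_Ioo,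
    ← intervalIntegral.integral_of_le hx.1.le, intervalIntegral.integral_eq_sub_of_hasDerivAt
      (fun y _ => hs y) (hs'.intervalIntegrable _ _), h1, sub_zero]

/-- A linear relation `⟪P, η⟫ + ⟪Q, η'⟫ = 0` for test functions `η` extends to all `C¹` functions
vanishing at the end points. -/
theorem inner_add_inner_deriv_eq_zero (hθ : θ₁ < θ₂) (P Q : Lp ℝ 2 (angMeas θ₁ θ₂))
    (h : ∀ η (hη : IsTestOn θ₁ θ₂ η), ⟪P, (memLp_angMeas hη.smooth.continuous).toLp η⟫_ℝ +
      ⟪Q, (memLp_angMeas hη.deriv.smooth.continuous).toLp (deriv η)⟫_ℝ = 0)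
    {s s' : ℝ → ℝ} (hs : ∀ x, HasDerivAt s (s' x) x) (hs' : Continuous s') (h1 : s θ₁ = 0)
    (h2 : s θ₂ = 0) :
    ⟪P, (memLp_angMeas (continuous_iff_continuousAt.2 fun x => (hs x).continuousAt)).toLp s⟫_ℝ +
      ⟪Q, (memLp_angMeas hs').toLp s'⟫_ℝ = 0 := by
  set K := hilbertSchmidt ((memLp_primitiveKernel θ₁ θ₂).toLp _)
  have key : ∀ {s s' : ℝ → ℝ} (hs : ∀ x, HasDerivAt s (s' x) x) (hs' : Continuous s'), s θ₁ = 0 →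
      ⟪P, (memLp_angMeas (continuous_iff_continuousAt.2 fun x => (hs x).continuousAt)).toLp s⟫_ℝ +
      ⟪Q, (memLp_angMeas hs').toLp s'⟫_ℝ =
        ∫ x in Ioo θ₁ θ₂, (adjoint K P + Q : Lp ℝ 2 (angMeas θ₁ θ₂)) x * s' x := by
    intro s s' hs hs' h1
    rw [← hilbertSchmidt_primitive hs hs' h1, ← adjoint_inner_left, ← inner_add_left,
      inner_toLp_angMeas _ hs']
  -- K*P + Q annihilates derivatives of test functions, so it is constant, and constants annihilate
  -- s' when s vanishes at both ends.
  obtain ⟨C, hC⟩ := ae_eq_const_of_forall_isTestOn hθ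
    (f := (adjoint K P + Q : Lp ℝ 2 (angMeas θ₁ θ₂)))
    ((Lp.memLp (adjoint K P + Q : Lp ℝ 2 (angMeas θ₁ θ₂))).integrable (by norm_num))
    fun η hη => by
      rw [← key hη.hasDerivAt hη.deriv.smooth.continuous (hη.eq_zero (by simp))]
      exact h η hη
  rw [key hs hs' h1]
  have h3 : ∫ x in Ioo θ₁ θ₂, (adjoint K P + Q : Lp ℝ 2 (angMeas θ₁ θ₂)) x * s' x =
      ∫ x in Ioo θ₁ θ₂, C * s' x := by
    refine integral_congr_ae ?_
    filter_upwards [hC] with x hx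
    rw [hx]
  rw [h3, integral_const_mul, ← integral_Ioc_eq_integral_Ioo,
    ← intervalIntegral.integral_of_le hθ.le, intervalIntegral.integral_eq_sub_of_hasDerivAt
      (fun y _ => hs y) (hs'.intervalIntegrable _ _), h1, h2, sub_zero, mul_zero]

end AngularTests

/-! ### Orthogonality and totality of the sine modes -/

section Sines

/-- The angular frequency of the `n`-th mode. -/
noncomputable def freq (θ₁ θ₂ : ℝ) (n : ℕ) : ℝ := n * Real.pi / (θ₂ - θ₁)

/-- The companion `cos (n π (θ - θ₁) / (θ₂ - θ₁))` of `angMode`. -/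
noncomputable def angCos (θ₁ θ₂ : ℝ) (n : ℕ) (θ : ℝ) : ℝ :=
  Real.cos (n * Real.pi * (θ - θ₁) / (θ₂ - θ₁))

variable {θ₁ θ₂ : ℝ}

theorem freq_pos (hθ : θ₁ < θ₂) {n : ℕ} (hn : 1 ≤ n) : 0 < freq θ₁ θ₂ n := by
  have h1 : (0 : ℝ) < n := by exact_mod_cast hn
  exact div_pos (mul_pos h1 Real.pi_pos) (sub_pos.2 hθ)

theorem hasDerivAt_angle (θ₁ θ₂ : ℝ) (n : ℕ) (θ : ℝ) :
    HasDerivAt (fun θ => n * Real.pi * (θ - θ₁) / (θ₂ - θ₁)) (freq θ₁ θ₂ n) θ := by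
  simpa [freq] using (((hasDerivAt_id θ).sub_const θ₁).const_mul (n * Real.pi)).div_const (θ₂ - θ₁)

theorem hasDerivAt_angMode (θ₁ θ₂ : ℝ) (n : ℕ) (θ : ℝ) :
    HasDerivAt (angMode θ₁ θ₂ n) (freq θ₁ θ₂ n * angCos θ₁ θ₂ n θ) θ :=
  (hasDerivAt_angle θ₁ θ₂ n θ).sin.congr_deriv (mul_comm _ _)

theorem hasDerivAt_angCos (θ₁ θ₂ : ℝ) (n : ℕ) (θ : ℝ) :
    HasDerivAt (angCos θ₁ θ₂ n) (-freq θ₁ θ₂ n * angMode θ₁ θ₂ n θ) θ :=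
  (hasDerivAt_angle θ₁ θ₂ n θ).cos.congr_deriv (by rw [angMode]; ring)

theorem continuous_angMode (θ₁ θ₂ : ℝ) (n : ℕ) : Continuous (angMode θ₁ θ₂ n) :=
  continuous_iff_continuousAt.2 fun θ => (hasDerivAt_angMode θ₁ θ₂ n θ).continuousAt

theorem continuous_angCos (θ₁ θ₂ : ℝ) (n : ℕ) : Continuous (angCos θ₁ θ₂ n) :=
  continuous_iff_continuousAt.2 fun θ => (hasDerivAt_angCos θ₁ θ₂ n θ).continuousAt

theorem angMode_left (θ₁ θ₂ : ℝ) (n : ℕ) : angMode θ₁ θ₂ n θ₁ = 0 := by simp [angMode]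

theorem angMode_right (hθ : θ₁ < θ₂) (n : ℕ) : angMode θ₁ θ₂ n θ₂ = 0 := by
  rw [angMode, mul_div_assoc, div_self (sub_pos.2 hθ).ne', mul_one, Real.sin_nat_mul_pi]

theorem setIntegral_deriv_eq {F F' : ℝ → ℝ} (hθ : θ₁ < θ₂) (hF : ∀ x, HasDerivAt F (F' x) x)
    (hF' : Continuous F') : ∫ x in Ioo θ₁ θ₂, F' x = F θ₂ - F θ₁ := by
  rw [← integral_Ioc_eq_integral_Ioo, ← intervalIntegral.integral_of_le hθ.le,
    intervalIntegral.integral_eq_sub_of_hasDerivAt (fun y _ => hF y) (hF'.intervalIntegrable _ _)]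

theorem freq_sq_ne (hθ : θ₁ < θ₂) {m n : ℕ} (hmn : m ≠ n) :
    freq θ₁ θ₂ n ^ 2 - freq θ₁ θ₂ m ^ 2 ≠ 0 := by
  intro h
  have hL := (sub_pos.2 hθ).ne'
  have hp := Real.pi_pos.ne'
  have h0 : (Real.pi / (θ₂ - θ₁)) ^ 2 * ((n : ℝ) ^ 2 - (m : ℝ) ^ 2) = 0 := by
    rw [← h, freq, freq]
    ring
  have h1 : (n : ℝ) ^ 2 = (m : ℝ) ^ 2 :=
    sub_eq_zero.1 ((mul_eq_zero.1 h0).resolve_left (pow_ne_zero 2 (div_ne_zero hp hL)))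
  have h2 := (pow_left_inj₀ n.cast_nonneg m.cast_nonneg two_ne_zero).1 h1
  exact hmn (by exact_mod_cast h2.symm)

/-- The Wronskian of the two modes vanishes at both ends, and its derivative is the difference of
the squared frequencies times the product. -/
theorem integral_angMode_mul_of_ne (hθ : θ₁ < θ₂) {m n : ℕ} (hmn : m ≠ n) :
    ∫ x in Ioo θ₁ θ₂, angMode θ₁ θ₂ m x * angMode θ₁ θ₂ n x = 0 := by
  have h := setIntegral_deriv_eq hθ (F := fun x =>
    freq θ₁ θ₂ m * angCos θ₁ θ₂ m x * angMode θ₁ θ₂ n x -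
      angMode θ₁ θ₂ m x * (freq θ₁ θ₂ n * angCos θ₁ θ₂ n x))
    (F' := fun x => (freq θ₁ θ₂ n ^ 2 - freq θ₁ θ₂ m ^ 2) *
      (angMode θ₁ θ₂ m x * angMode θ₁ θ₂ n x)) (fun x => by
      refine ((((hasDerivAt_angCos θ₁ θ₂ m x).const_mul _).mul (hasDerivAt_angMode θ₁ θ₂ n x)).sub
        ((hasDerivAt_angMode θ₁ θ₂ m x).mul
          ((hasDerivAt_angCos θ₁ θ₂ n x).const_mul _))).congr_deriv ?_
      ring) (by
      have := continuous_angMode θ₁ θ₂ m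
      have := continuous_angMode θ₁ θ₂ n
      fun_prop)
  rw [integral_const_mul] at h
  simp only [angMode_left, angMode_right hθ, mul_zero, zero_mul, sub_zero] at h
  exact (mul_eq_zero.1 h).resolve_left (freq_sq_ne hθ hmn)

theorem integral_angCos_mul_of_ne (hθ : θ₁ < θ₂) {m n : ℕ} (hmn : m ≠ n) :
    ∫ x in Ioo θ₁ θ₂, angCos θ₁ θ₂ m x * angCos θ₁ θ₂ n x = 0 := by
  have h := setIntegral_deriv_eq hθ (F := fun x =>
    -freq θ₁ θ₂ m * angMode θ₁ θ₂ m x * angCos θ₁ θ₂ n x -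
      angCos θ₁ θ₂ m x * (-freq θ₁ θ₂ n * angMode θ₁ θ₂ n x))
    (F' := fun x => (freq θ₁ θ₂ n ^ 2 - freq θ₁ θ₂ m ^ 2) *
      (angCos θ₁ θ₂ m x * angCos θ₁ θ₂ n x)) (fun x => by
      refine ((((hasDerivAt_angMode θ₁ θ₂ m x).const_mul _).mul (hasDerivAt_angCos θ₁ θ₂ n x)).sub
        ((hasDerivAt_angCos θ₁ θ₂ m x).mul
          ((hasDerivAt_angMode θ₁ θ₂ n x).const_mul _))).congr_deriv ?_
      ring) (by
      have := continuous_angCos θ₁ θ₂ m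
      have := continuous_angCos θ₁ θ₂ n
      fun_prop)
  rw [integral_const_mul] at h
  simp only [angMode_left, angMode_right hθ, mul_zero, zero_mul, sub_zero] at h
  exact (mul_eq_zero.1 h).resolve_left (freq_sq_ne hθ hmn)

theorem integrableOn_of_continuous {f : ℝ → ℝ} (hf : Continuous f) : IntegrableOn f (Ioo θ₁ θ₂) :=
  hf.integrableOn_Icc.mono_set Ioo_subset_Icc_self

/-- The two integrals agree because cos² - sin² is, up to the frequency, the derivative of sin·cos;
they add up to the length of the interval. -/
theorem integral_sq_angMode (hθ : θ₁ < θ₂) {n : ℕ} (hn : 1 ≤ n) :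
    ∫ x in Ioo θ₁ θ₂, angMode θ₁ θ₂ n x * angMode θ₁ θ₂ n x = (θ₂ - θ₁) / 2 ∧
      ∫ x in Ioo θ₁ θ₂, angCos θ₁ θ₂ n x * angCos θ₁ θ₂ n x = (θ₂ - θ₁) / 2 := by
  have hs := continuous_angMode θ₁ θ₂ n
  have hc := continuous_angCos θ₁ θ₂ n
  have h := setIntegral_deriv_eq hθ (F := fun x => angMode θ₁ θ₂ n x * angCos θ₁ θ₂ n x)
    (F' := fun x => freq θ₁ θ₂ n * (angCos θ₁ θ₂ n x * angCos θ₁ θ₂ n x -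
      angMode θ₁ θ₂ n x * angMode θ₁ θ₂ n x)) (fun x => by
      refine ((hasDerivAt_angMode θ₁ θ₂ n x).mul (hasDerivAt_angCos θ₁ θ₂ n x)).congr_deriv ?_
      ring) (by fun_prop)
  rw [integral_const_mul, integral_sub (integrableOn_of_continuous (by fun_prop))
    (integrableOn_of_continuous (by fun_prop))] at h
  simp only [angMode_left, angMode_right hθ, zero_mul, sub_zero] at h
  have h1 := (mul_eq_zero.1 h).resolve_left (freq_pos hθ hn).ne'
  have h2 : (∫ x in Ioo θ₁ θ₂, angMode θ₁ θ₂ n x * angMode θ₁ θ₂ n x) +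
      ∫ x in Ioo θ₁ θ₂, angCos θ₁ θ₂ n x * angCos θ₁ θ₂ n x = θ₂ - θ₁ := by
    rw [← integral_add (integrableOn_of_continuous (by fun_prop))
      (integrableOn_of_continuous (by fun_prop))]
    have : ∀ x, angMode θ₁ θ₂ n x * angMode θ₁ θ₂ n x + angCos θ₁ θ₂ n x * angCos θ₁ θ₂ n x = 1 :=
      fun x => by
        rw [← sq, ← sq]
        exact Real.sin_sq_add_cos_sq _
    simp [this, hθ.le]
  constructor <;> linarith

/-- The sine mode as an element of `L²`. -/
noncomputable def sinVec (θ₁ θ₂ : ℝ) (n : ℕ) : Lp ℝ 2 (angMeas θ₁ θ₂) :=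
  (memLp_angMeas (continuous_angMode θ₁ θ₂ n)).toLp _

/-- The cosine mode as an element of `L²`. -/
noncomputable def cosVec (θ₁ θ₂ : ℝ) (n : ℕ) : Lp ℝ 2 (angMeas θ₁ θ₂) :=
  (memLp_angMeas (continuous_angCos θ₁ θ₂ n)).toLp _

theorem inner_sinVec (hθ : θ₁ < θ₂) {m n : ℕ} (hn : 1 ≤ n) :
    ⟪sinVec θ₁ θ₂ m, sinVec θ₁ θ₂ n⟫_ℝ = if m = n then (θ₂ - θ₁) / 2 else 0 := by
  rw [sinVec, sinVec, inner_toLp_toLp]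
  split_ifs with h
  · rw [h]
    exact (integral_sq_angMode hθ hn).1
  · exact integral_angMode_mul_of_ne hθ h

theorem inner_cosVec (hθ : θ₁ < θ₂) {m n : ℕ} (hn : 1 ≤ n) :
    ⟪cosVec θ₁ θ₂ m, cosVec θ₁ θ₂ n⟫_ℝ = if m = n then (θ₂ - θ₁) / 2 else 0 := by
  rw [cosVec, cosVec, inner_toLp_toLp]
  split_ifs with h
  · rw [h]
    exact (integral_sq_angMode hθ hn).2
  · exact integral_angCos_mul_of_ne hθ h

theorem angMode_mul_angCos (θ₁ θ₂ : ℝ) (n : ℕ) (x : ℝ) :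
    angMode θ₁ θ₂ (n + 1) x * angCos θ₁ θ₂ 1 x =
      (angMode θ₁ θ₂ (n + 2) x + angMode θ₁ θ₂ n x) / 2 := by
  set y := Real.pi * (x - θ₁) / (θ₂ - θ₁) with hy
  have h : ∀ k : ℕ, (k : ℝ) * Real.pi * (x - θ₁) / (θ₂ - θ₁) = k * y := fun k => by rw [hy]; ring
  simp only [angMode, angCos, h]
  push_cast
  rw [show ((n : ℝ) + 2) * y = (n + 1) * y + 1 * y by ring,
    show (n : ℝ) * y = (n + 1) * y - 1 * y by ring, Real.sin_add, Real.sin_sub]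
  ring

/-- The sine modes are total. -/
theorem eq_zero_of_forall_inner_sinVec (hθ : θ₁ < θ₂) (b : Lp ℝ 2 (angMeas θ₁ θ₂))
    (h : ∀ n : ℕ, 1 ≤ n → ⟪b, sinVec θ₁ θ₂ n⟫_ℝ = 0) : b = 0 := by
  have hL := sub_pos.2 hθ
  have hb : IntegrableOn b (Ioo θ₁ θ₂) := (Lp.memLp b).integrable (by norm_num)
  have hbdd : ∀ {g : ℝ → ℝ}, Continuous g → IntegrableOn (fun x => b x * g x) (Ioo θ₁ θ₂) := by
    intro g hg
    obtain ⟨C, hC⟩ := (isCompact_Icc (a := θ₁) (b := θ₂)).exists_bound_of_continuousOn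
      hg.continuousOn
    exact Integrable.mul_bdd (c := C) hb hg.aestronglyMeasurable
      (ae_restrict_of_forall_mem measurableSet_Ioo fun x hx => hC x (Ioo_subset_Icc_self hx))
  have hcs := continuous_angCos θ₁ θ₂ 1
  -- The product formula trades one power of the cosine for neighbouring modes. The index n = 0 is
  -- included since that mode is zero.
  have hpow : ∀ (k n : ℕ), ∫ x in Ioo θ₁ θ₂, b x * (angMode θ₁ θ₂ n x * angCos θ₁ θ₂ 1 x ^ k) = 0 := by
    intro k
    induction k with
    | zero =>
      intro n
      rcases Nat.eq_zero_or_pos n with rfl | hn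
      · simp [angMode]
      · have := h n hn
        rw [sinVec, inner_toLp_angMeas b (continuous_angMode θ₁ θ₂ n)] at this
        simpa using this
    | succ k ih =>
      intro n
      cases n with
      | zero => simp [angMode]
      | succ n =>
        have h1 : ∀ x, b x * (angMode θ₁ θ₂ (n + 1) x * angCos θ₁ θ₂ 1 x ^ (k + 1)) =
            1 / 2 * (b x * (angMode θ₁ θ₂ (n + 2) x * angCos θ₁ θ₂ 1 x ^ k)) +
              1 / 2 * (b x * (angMode θ₁ θ₂ n x * angCos θ₁ θ₂ 1 x ^ k)) := fun x => by
          rw [pow_succ', ← mul_assoc (angMode θ₁ θ₂ (n + 1) x), angMode_mul_angCos]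
          ring
        simp only [h1]
        rw [integral_add, integral_const_mul, integral_const_mul, ih, ih]
        · simp
        · exact (hbdd ((continuous_angMode _ _ _).mul (hcs.pow k))).const_mul _
        · exact (hbdd ((continuous_angMode _ _ _).mul (hcs.pow k))).const_mul _
  have hpoly : ∀ p : Polynomial ℝ,
      ∫ x in Ioo θ₁ θ₂, b x * (angMode θ₁ θ₂ 1 x * p.eval (angCos θ₁ θ₂ 1 x)) = 0 := by
    intro p
    have hs := continuous_angMode θ₁ θ₂ 1
    induction p using Polynomial.induction_on' with
    | add p q hp hq =>
      simp only [Polynomial.eval_add, mul_add]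
      rw [integral_add, hp, hq, add_zero]
      · exact hbdd (hs.mul (p.continuous.comp hcs))
      · exact hbdd (hs.mul (q.continuous.comp hcs))
    | monomial k a =>
      have h1 : ∀ x, b x * (angMode θ₁ θ₂ 1 x * (Polynomial.monomial k a).eval (angCos θ₁ θ₂ 1 x)) =
          a * (b x * (angMode θ₁ θ₂ 1 x * angCos θ₁ θ₂ 1 x ^ k)) := fun x => by
        rw [Polynomial.eval_monomial]
        ring
      simp only [h1]
      rw [integral_const_mul, hpow, mul_zero]
  have hg : IntegrableOn (fun x => b x * angMode θ₁ θ₂ 1 x) (Ioo θ₁ θ₂) :=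
    hbdd (continuous_angMode θ₁ θ₂ 1)
  have key := ae_eq_zero_of_forall_isTestOn hg (fun η hη => by
    have hη' := hη.smooth.continuous
    -- The first cosine is a coordinate on the interval: η is a continuous function of it, so
    -- Weierstrass approximation on [-1, 1] reduces η to the polynomials already treated.
    set q : ℝ → ℝ := fun y => η (θ₁ + (θ₂ - θ₁) / Real.pi * Real.arccos y) with hq
    have hqc : Continuous q := hη'.comp (by fun_prop)
    have hqe : ∀ x ∈ Ioo θ₁ θ₂, q (angCos θ₁ θ₂ 1 x) = η x := by
      intro x hx
      have h0 : (0 : ℝ) ≤ (1 : ℕ) * Real.pi * (x - θ₁) / (θ₂ - θ₁) := by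
        have := Real.pi_pos
        have := sub_pos.2 hx.1
        positivity
      have h1 : (1 : ℕ) * Real.pi * (x - θ₁) / (θ₂ - θ₁) ≤ Real.pi := by
        rw [div_le_iff₀ hL, Nat.cast_one, one_mul]
        have := Real.pi_pos
        gcongr
        exact hx.2.le
      simp only [hq, angCos]
      rw [Real.arccos_cos h0 h1]
      congr 1
      have := Real.pi_pos.ne'
      field_simp
      push_cast
      ring
    set I := ∫ x in Ioo θ₁ θ₂, |b x * angMode θ₁ θ₂ 1 x| with hI
    have hI0 : 0 ≤ I := integral_nonneg fun _ => abs_nonneg _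
    refine abs_nonpos_iff.1 (le_of_forall_pos_le_add fun δ hδ => ?_)
    obtain ⟨p, hp⟩ := exists_polynomial_near_of_continuousOn (-1) 1 q hqc.continuousOn
      (δ / (I + 1)) (by positivity)
    have h1 : ∫ x in Ioo θ₁ θ₂, b x * angMode θ₁ θ₂ 1 x * η x =
        ∫ x in Ioo θ₁ θ₂, b x * angMode θ₁ θ₂ 1 x * (η x - p.eval (angCos θ₁ θ₂ 1 x)) := by
      have h2 := hpoly p
      simp only [← mul_assoc] at h2
      simp only [mul_sub]
      rw [integral_sub, h2, sub_zero]
      · simp only [mul_assoc]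
        exact hbdd ((continuous_angMode θ₁ θ₂ 1).mul hη')
      · simp only [mul_assoc]
        exact hbdd ((continuous_angMode θ₁ θ₂ 1).mul (p.continuous.comp hcs))
    rw [h1, zero_add]
    calc |∫ x in Ioo θ₁ θ₂, b x * angMode θ₁ θ₂ 1 x * (η x - p.eval (angCos θ₁ θ₂ 1 x))|
        ≤ ∫ x in Ioo θ₁ θ₂, |b x * angMode θ₁ θ₂ 1 x| * (δ / (I + 1)) := by
          rw [← Real.norm_eq_abs (∫ x in Ioo θ₁ θ₂, _)]
          refine norm_integral_le_of_norm_le (Integrable.mul_const hg.abs _)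
            (ae_restrict_of_forall_mem measurableSet_Ioo fun x hx => ?_)
          rw [norm_mul]
          refine mul_le_mul_of_nonneg_left ?_ (norm_nonneg _)
          have := hp (angCos θ₁ θ₂ 1 x) ⟨Real.neg_one_le_cos _, Real.cos_le_one _⟩
          rw [hqe x hx, abs_sub_comm] at this
          exact this.le
      _ = I * (δ / (I + 1)) := integral_mul_const _ _
      _ ≤ δ := by
          rw [mul_div_assoc', div_le_iff₀ (by positivity)]
          nlinarith)
  rw [Lp.eq_zero_iff_ae_eq_zero]
  filter_upwards [key, ae_restrict_mem measurableSet_Ioo] with x hx hx'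
  refine (mul_eq_zero.1 hx).resolve_right (Real.sin_pos_of_pos_of_lt_pi ?_ ?_).ne'
  · have := Real.pi_pos
    have := sub_pos.2 hx'.1
    positivity
  · rw [div_lt_iff₀ hL, Nat.cast_one, one_mul]
    have := Real.pi_pos
    have := hx'.2
    gcongr

end Sines

/-! ### Angular mode decomposition of L²(Ω) -/

section Modes

/-- Tensors of indicators show that U integrates to zero over rectangles; a π-λ argument extends
this to all measurable sets. -/
theorem eq_zero_of_forall_inner_tensor {A B : Type*} [MeasurableSpace A] [MeasurableSpace B]
    {μ : Measure A} {ν : Measure B} [IsFiniteMeasure μ] [IsFiniteMeasure ν]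
    (U : Lp ℝ 2 (μ.prod ν)) (h : ∀ f g, ⟪U, tensor μ ν f g⟫_ℝ = 0) : U = 0 := by
  have hU : Integrable U (μ.prod ν) := (Lp.memLp U).integrable (by norm_num)
  have hrect : ∀ (s : Set A) (t : Set B), MeasurableSet s → MeasurableSet t →
      ∫ p in s ×ˢ t, U p ∂μ.prod ν = 0 := by
    intro s t hs ht
    have h1 := h (indicatorConstLp 2 hs (measure_ne_top μ s) 1)
      (indicatorConstLp 2 ht (measure_ne_top ν t) 1)
    rw [inner_eq_integral (ae_eq_refl U) (tensor_coeFn indicatorConstLp_coeFn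
      indicatorConstLp_coeFn)] at h1
    rw [← h1, ← integral_indicator (hs.prod ht)]
    congr 1
    ext p
    by_cases h2 : p.1 ∈ s <;> by_cases h3 : p.2 ∈ t <;> simp [indicator, h2, h3]
  rw [Lp.eq_zero_iff_ae_eq_zero]
  refine Integrable.ae_eq_zero_of_forall_setIntegral_eq_zero hU fun s hs _ => ?_
  refine MeasurableSpace.induction_on_inter (C := fun s _ => ∫ p in s, U p ∂μ.prod ν = 0)
    generateFrom_prod.symm isPiSystem_prod ?_ ?_ ?_ ?_ s hs
  · simp
  · rintro _ ⟨s, hs, t, ht, rfl⟩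
    exact hrect s t hs ht
  · intro t ht h1
    have h2 := integral_add_compl ht hU
    have h3 := hrect univ univ MeasurableSet.univ MeasurableSet.univ
    rw [univ_prod_univ, setIntegral_univ] at h3
    linarith
  · intro f hd hm hf
    have h1 := hasSum_integral_iUnion hm hd hU.integrableOn
    simp only [hf] at h1
    exact h1.unique hasSum_zero

variable {R θ₁ θ₂ : ℝ}

theorem area_eq (R θ₁ θ₂ : ℝ) : area R θ₁ θ₂ = (radMeas R).prod (angMeas θ₁ θ₂) := by
  rw [area, domain, radMeas, Measure.volume_eq_prod, ← Measure.prod_restrict,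
    prod_withDensity_left (by fun_prop)]

instance (R θ₁ θ₂ : ℝ) : IsFiniteMeasure (area R θ₁ θ₂) := by
  rw [area_eq]
  infer_instance

/-- The area measure and the product measure are equal but not definitionally so; their L² spaces
are distinct types that need an explicit identification. -/
theorem exists_linearIsometryEquiv_Lp {A : Type*} [MeasurableSpace A] {μ ν : Measure A}
    (h : μ = ν) : ∃ J : Lp ℝ 2 μ ≃ₗᵢ[ℝ] Lp ℝ 2 ν, ∀ (f : A → ℝ) (hf : MemLp f 2 μ)
      (hf' : MemLp f 2 ν), J (hf.toLp f) = hf'.toLp f := by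
  subst h
  exact ⟨LinearIsometryEquiv.refl ℝ _, fun _ _ _ => rfl⟩

/-- `L²(Ω)` as the `L²` space of a product measure. -/
noncomputable def areaIso (R θ₁ θ₂ : ℝ) :
    L2 R θ₁ θ₂ ≃ₗᵢ[ℝ] Lp ℝ 2 ((radMeas R).prod (angMeas θ₁ θ₂)) :=
  (exists_linearIsometryEquiv_Lp (area_eq R θ₁ θ₂)).choose

theorem areaIso_toLp {R θ₁ θ₂ : ℝ} {f : ℝ × ℝ → ℝ} (hf : MemLp f 2 (area R θ₁ θ₂))
    (hf' : MemLp f 2 ((radMeas R).prod (angMeas θ₁ θ₂))) :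
    areaIso R θ₁ θ₂ (hf.toLp f) = hf'.toLp f :=
  (exists_linearIsometryEquiv_Lp (area_eq R θ₁ θ₂)).choose_spec f hf hf'

/-- The tensor product `f(r) b(θ)` as an element of `L²(Ω)`. -/
noncomputable def tens (f : Lp ℝ 2 (radMeas R)) (b : Lp ℝ 2 (angMeas θ₁ θ₂)) : L2 R θ₁ θ₂ :=
  (areaIso R θ₁ θ₂).symm (tensor (radMeas R) (angMeas θ₁ θ₂) f b)

/-- The partial pairing `r ↦ ∫ U(r, θ) b(θ) dθ`. -/
noncomputable def modeOp (R : ℝ) (b : Lp ℝ 2 (angMeas θ₁ θ₂)) :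
    L2 R θ₁ θ₂ →L[ℝ] Lp ℝ 2 (radMeas R) :=
  partialInner (radMeas R) b ∘L ((areaIso R θ₁ θ₂).toContinuousLinearEquiv :
    L2 R θ₁ θ₂ →L[ℝ] Lp ℝ 2 ((radMeas R).prod (angMeas θ₁ θ₂)))

theorem inner_tens (U : L2 R θ₁ θ₂) (f : Lp ℝ 2 (radMeas R)) (b : Lp ℝ 2 (angMeas θ₁ θ₂)) :
    ⟪U, tens f b⟫_ℝ = ⟪areaIso R θ₁ θ₂ U, tensor _ _ f b⟫_ℝ := by
  have h := (areaIso R θ₁ θ₂).inner_map_map U (tens f b)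
  have h2 : areaIso R θ₁ θ₂ (tens f b) = tensor _ _ f b :=
    LinearIsometryEquiv.apply_symm_apply _ _
  rw [← h, h2]

theorem inner_modeOp (b : Lp ℝ 2 (angMeas θ₁ θ₂)) (U : L2 R θ₁ θ₂) (f : Lp ℝ 2 (radMeas R)) :
    ⟪modeOp R b U, f⟫_ℝ = ⟪U, tens f b⟫_ℝ := by
  rw [inner_tens]
  exact inner_partialInner b _ f

theorem memLp_area {f : ℝ × ℝ → ℝ} :
    MemLp f 2 (area R θ₁ θ₂) ↔ MemLp f 2 ((radMeas R).prod (angMeas θ₁ θ₂)) := by rw [area_eq]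

theorem tens_toLp {f b : ℝ → ℝ} (hf : MemLp f 2 (radMeas R)) (hb : MemLp b 2 (angMeas θ₁ θ₂)) :
    tens (hf.toLp f) (hb.toLp b) = (memLp_area.2 (memLp_tensor hf hb)).toLp _ := by
  rw [tens, tensor_toLp, LinearIsometryEquiv.symm_apply_eq]
  exact (areaIso_toLp _ _).symm

theorem inner_tens_tens (f f' : Lp ℝ 2 (radMeas R)) (b b' : Lp ℝ 2 (angMeas θ₁ θ₂)) :
    ⟪tens f b, tens f' b'⟫_ℝ = ⟪f, f'⟫_ℝ * ⟪b, b'⟫_ℝ := by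
  rw [inner_tens, tens, LinearIsometryEquiv.apply_symm_apply, inner_tensor_tensor]

theorem modeOp_tens (f : Lp ℝ 2 (radMeas R)) (b b' : Lp ℝ 2 (angMeas θ₁ θ₂)) :
    modeOp R b (tens f b') = ⟪b', b⟫_ℝ • f := by
  refine ext_inner_right ℝ fun v => ?_
  rw [inner_modeOp, inner_tens_tens, inner_smul_left, mul_comm]
  rfl

/-- The isometric embedding of the `n`-th angular mode. -/
noncomputable def modeIso (hθ : θ₁ < θ₂) (R : ℝ) {n : ℕ} (hn : 1 ≤ n) :
    Lp ℝ 2 (radMeas R) →ₗᵢ[ℝ] L2 R θ₁ θ₂ :=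
  LinearMap.isometryOfInner
    { toFun := fun f => Real.sqrt (2 / (θ₂ - θ₁)) • tens f (sinVec θ₁ θ₂ n)
      map_add' := fun f g => by simp [tens]
      map_smul' := fun a f => by simp [tens, smul_comm a] }
    fun f g => by
      have hL := sub_pos.2 hθ
      have h1 : Real.sqrt (2 / (θ₂ - θ₁)) * Real.sqrt (2 / (θ₂ - θ₁)) = 2 / (θ₂ - θ₁) :=
        Real.mul_self_sqrt (by positivity)
      simp only [LinearMap.coe_mk, AddHom.coe_mk, inner_smul_left, inner_smul_right,
        inner_tens_tens, inner_sinVec hθ hn, if_true, conj_trivial]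
      rw [← mul_assoc, h1]
      field_simp

theorem modeIso_apply (hθ : θ₁ < θ₂) {n : ℕ} (hn : 1 ≤ n) (f : Lp ℝ 2 (radMeas R)) :
    modeIso hθ R hn f = Real.sqrt (2 / (θ₂ - θ₁)) • tens f (sinVec θ₁ θ₂ n) := rfl

/-- The decomposition of `L²(Ω)` into angular modes. -/
theorem isHilbertSum_modeIso (hθ : θ₁ < θ₂) (R : ℝ) :
    IsHilbertSum ℝ (fun _ : ℕ => Lp ℝ 2 (radMeas R))
      fun n : ℕ => modeIso hθ R (Nat.le_add_left 1 n) := by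
  have hL := sub_pos.2 hθ
  refine IsHilbertSum.mk ?_ ?_
  · intro m n hmn f g
    rw [modeIso_apply, modeIso_apply, inner_smul_left, inner_smul_right, inner_tens_tens,
      inner_sinVec hθ (Nat.le_add_left 1 n), if_neg (by omega)]
    simp
  · rw [top_le_iff, Submodule.topologicalClosure_eq_top_iff, Submodule.eq_bot_iff]
    intro U hU
    have h1 : ∀ (n : ℕ), 1 ≤ n → ∀ f : Lp ℝ 2 (radMeas R), ⟪U, tens f (sinVec θ₁ θ₂ n)⟫_ℝ = 0 := by
      intro n hn f
      obtain ⟨n, rfl⟩ := Nat.exists_eq_add_of_le' hn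
      have h2 := (Submodule.mem_orthogonal' _ _).1 hU (modeIso hθ R (Nat.le_add_left 1 n) f)
        (Submodule.mem_iSup_of_mem n ⟨f, rfl⟩)
      rw [modeIso_apply, inner_smul_right] at h2
      exact (mul_eq_zero.1 h2).resolve_left (Real.sqrt_pos.2 (by positivity)).ne'
    rw [← LinearIsometryEquiv.map_eq_zero_iff (areaIso R θ₁ θ₂)]
    refine eq_zero_of_forall_inner_tensor _ fun f b => ?_
    rw [← adjoint_inner_left, eq_zero_of_forall_inner_sinVec hθ
      (adjoint (tensor (radMeas R) (angMeas θ₁ θ₂) f) (areaIso R θ₁ θ₂ U)) fun n hn => ?_,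
      inner_zero_left]
    rw [adjoint_inner_left, ← inner_tens]
    exact h1 n hn f

/-- Parseval's identity for the angular modes. -/
theorem hasSum_norm_sq_modeOp (hθ : θ₁ < θ₂) (U : L2 R θ₁ θ₂) :
    HasSum (fun n : ℕ => ‖modeOp R (sinVec θ₁ θ₂ (n + 1)) U‖ ^ 2) ((θ₂ - θ₁) / 2 * ‖U‖ ^ 2) := by
  have hL := sub_pos.2 hθ
  have hV := isHilbertSum_modeIso hθ R
  set w := hV.linearIsometryEquiv U with hw
  have h1 := hV.hasSum_linearIsometryEquiv_symm w
  rw [hw, LinearIsometryEquiv.symm_apply_apply, ← hw] at h1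
  have h2 : ∀ n : ℕ, modeOp R (sinVec θ₁ θ₂ (n + 1)) U =
      (Real.sqrt (2 / (θ₂ - θ₁)) * ((θ₂ - θ₁) / 2)) • w n := by
    intro n
    have h3 := h1.mapL (modeOp R (sinVec θ₁ θ₂ (n + 1)))
    refine h3.unique ?_
    have h4 := hasSum_ite_eq n ((Real.sqrt (2 / (θ₂ - θ₁)) * ((θ₂ - θ₁) / 2)) • w n)
    refine h4.congr_fun fun m => ?_
    rw [modeIso_apply, map_smul, modeOp_tens, inner_sinVec hθ (Nat.le_add_left 1 n), smul_smul]
    by_cases h : m = n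
    · subst h
      simp
    · rw [if_neg (by omega), if_neg h]
      simp
  have h5 := lp.hasSum_norm (p := 2) (by norm_num) w
  rw [hw, LinearIsometryEquiv.norm_map, ← hw] at h5
  have h6 := h5.mul_left ((θ₂ - θ₁) / 2)
  simp only [ENNReal.toReal_ofNat, Real.rpow_ofNat] at h6
  refine h6.congr_fun fun n => ?_
  have h7 : Real.sqrt (2 / (θ₂ - θ₁)) ^ 2 = 2 / (θ₂ - θ₁) := Real.sq_sqrt (by positivity)
  rw [h2, norm_smul, mul_pow, Real.norm_eq_abs, sq_abs, mul_pow, h7]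
  field_simp

end Modes

/-! ### Test functions on the sector and mode relations in H¹₀ -/

section PlaneTests

variable {R θ₁ θ₂ : ℝ} {φ ψ : ℝ × ℝ → ℝ}

/-- Continuous functions with compact support inside the sector. -/
structure IsCc (R θ₁ θ₂ : ℝ) (ψ : ℝ × ℝ → ℝ) : Prop where
  cont : Continuous ψ
  compact : HasCompactSupport ψ
  inside : tsupport ψ ⊆ domain R θ₁ θ₂

theorem isOpen_domain (R θ₁ θ₂ : ℝ) : IsOpen (domain R θ₁ θ₂) := isOpen_Ioo.prod isOpen_Ioo

theorem measurableSet_domain (R θ₁ θ₂ : ℝ) : MeasurableSet (domain R θ₁ θ₂) :=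
  (isOpen_domain R θ₁ θ₂).measurableSet

theorem restrict_domain (R θ₁ θ₂ : ℝ) : (volume : Measure (ℝ × ℝ)).restrict (domain R θ₁ θ₂) =
    (volume.restrict (Ioo 0 R)).prod (volume.restrict (Ioo θ₁ θ₂)) := by
  rw [domain, Measure.volume_eq_prod, Measure.prod_restrict]

theorem integral_area (f : ℝ × ℝ → ℝ) :
    ∫ p, f p ∂area R θ₁ θ₂ = ∫ p in domain R θ₁ θ₂, p.1 * f p := by
  rw [area, integral_withDensity_eq_integral_toReal_smul (by fun_prop) (by simp)]
  refine setIntegral_congr_fun (measurableSet_domain R θ₁ θ₂) fun p hp => ?_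
  simp only [ENNReal.toReal_ofReal hp.1.1.le, smul_eq_mul]

theorem integrable_area_iff {f : ℝ × ℝ → ℝ} :
    Integrable f (area R θ₁ θ₂) ↔ IntegrableOn (fun p => p.1 * f p) (domain R θ₁ θ₂) := by
  rw [area, integrable_withDensity_iff_integrable_smul' (by fun_prop) (by simp)]
  refine integrable_congr (ae_restrict_of_forall_mem (measurableSet_domain R θ₁ θ₂) fun p hp => ?_)
  simp [ENNReal.toReal_ofReal hp.1.1.le]

theorem area_absolutelyContinuous (R θ₁ θ₂ : ℝ) :
    area R θ₁ θ₂ ≪ volume.restrict (domain R θ₁ θ₂) :=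
  withDensity_absolutelyContinuous _ _

theorem IsTest.isCc (hφ : IsTest R θ₁ θ₂ φ) : IsCc R θ₁ θ₂ φ :=
  ⟨hφ.smooth.continuous, hφ.compact, hφ.inside⟩

theorem IsCc.mul_continuousOn (hψ : IsCc R θ₁ θ₂ ψ) {F : ℝ × ℝ → ℝ}
    (hF : ContinuousOn F (domain R θ₁ θ₂)) : IsCc R θ₁ θ₂ (fun p => F p * ψ p) := by
  have h := (tsupport_mul_subset_right (f := F) (g := ψ)).trans hψ.inside
  refine ⟨continuous_of_tsupport fun p hp => ?_, hψ.compact.mul_left, h⟩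
  exact (hF.continuousAt ((isOpen_domain R θ₁ θ₂).mem_nhds (h hp))).mul hψ.cont.continuousAt

theorem IsCc.mul_prod (hψ : IsCc R θ₁ θ₂ ψ) {a b : ℝ → ℝ} (ha : ContinuousOn a (Ioo 0 R))
    (hb : Continuous b) : IsCc R θ₁ θ₂ (fun p => a p.1 * b p.2 * ψ p) :=
  hψ.mul_continuousOn (F := fun p => a p.1 * b p.2)
    ((ha.comp continuous_fst.continuousOn fun _ hp => hp.1).mul
      (hb.comp continuous_snd).continuousOn)

theorem IsCc.div_fst (hψ : IsCc R θ₁ θ₂ ψ) : IsCc R θ₁ θ₂ (fun p => ψ p / p.1) := by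
  have h := hψ.mul_continuousOn (F := fun p => p.1⁻¹)
    (continuous_fst.continuousOn.inv₀ fun p hp => hp.1.1.ne')
  simpa only [div_eq_inv_mul] using h

theorem IsCc.integrable (hψ : IsCc R θ₁ θ₂ ψ) : IntegrableOn ψ (domain R θ₁ θ₂) :=
  (hψ.cont.integrable_of_hasCompactSupport hψ.compact).integrableOn

theorem IsCc.exists_bound (hψ : IsCc R θ₁ θ₂ ψ) : ∃ C, ∀ p, ‖ψ p‖ ≤ C :=
  hψ.compact.exists_bound_of_continuous hψ.cont

theorem IsCc.memLp (hψ : IsCc R θ₁ θ₂ ψ) : MemLp ψ 2 (area R θ₁ θ₂) := by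
  obtain ⟨C, hC⟩ := hψ.exists_bound
  exact MemLp.of_bound hψ.cont.aestronglyMeasurable C (Eventually.of_forall hC)

theorem IsCc.integrable_mul (hψ : IsCc R θ₁ θ₂ ψ) {f : ℝ × ℝ → ℝ} (hf : MemLp f 2 (area R θ₁ θ₂)) :
    IntegrableOn (fun p => f p * ψ p) (domain R θ₁ θ₂) := by
  have h := integrable_area_iff.1 (MemLp.integrable_mul hf hψ.div_fst.memLp)
  refine h.congr (ae_restrict_of_forall_mem (measurableSet_domain R θ₁ θ₂) fun p hp => ?_)
  have := hp.1.1.ne'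
  simp only [Pi.mul_apply]
  field_simp

theorem IsTest.slice_rad (hφ : IsTest R θ₁ θ₂ φ) (θ : ℝ) : IsTestOn 0 R fun r => φ (r, θ) := by
  have hcont : Continuous fun r : ℝ => (r, θ) := by fun_prop
  have hsub : tsupport (fun r => φ (r, θ)) ⊆ (fun r : ℝ => (r, θ)) ⁻¹' tsupport φ :=
    closure_minimal (fun r hr => subset_tsupport φ hr) ((isClosed_tsupport φ).preimage hcont)
  refine ⟨hφ.smooth.comp (by fun_prop), ?_, fun r hr => (hφ.inside (hsub hr)).1⟩
  refine HasCompactSupport.of_support_subset_isCompact (hφ.compact.image continuous_fst) ?_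
  exact fun r hr => ⟨(r, θ), subset_tsupport φ hr, rfl⟩

theorem IsTest.slice_ang (hφ : IsTest R θ₁ θ₂ φ) (r : ℝ) : IsTestOn θ₁ θ₂ fun θ => φ (r, θ) := by
  have hcont : Continuous fun θ : ℝ => (r, θ) := by fun_prop
  have hsub : tsupport (fun θ => φ (r, θ)) ⊆ (fun θ : ℝ => (r, θ)) ⁻¹' tsupport φ :=
    closure_minimal (fun θ hθ => subset_tsupport φ hθ) ((isClosed_tsupport φ).preimage hcont)
  refine ⟨hφ.smooth.comp (by fun_prop), ?_, fun θ hθ => (hφ.inside (hsub hθ)).2⟩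
  refine HasCompactSupport.of_support_subset_isCompact (hφ.compact.image continuous_snd) ?_
  exact fun θ hθ => ⟨(r, θ), subset_tsupport φ hθ, rfl⟩

theorem isCc_fderiv_apply (hφ : IsTest R θ₁ θ₂ φ) (v : ℝ × ℝ) :
    IsCc R θ₁ θ₂ fun p => fderiv ℝ φ p v := by
  have hsub : Function.support (fun p => fderiv ℝ φ p v) ⊆ tsupport φ := fun p hp => by
    refine support_fderiv_subset ℝ (f := φ) fun h => hp ?_
    simp only [h]
    rfl
  refine ⟨?_, HasCompactSupport.of_support_subset_isCompact hφ.compact hsub,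
    (closure_minimal hsub (isClosed_tsupport φ)).trans hφ.inside⟩
  exact (hφ.smooth.continuous_fderiv (by simp)).clm_apply continuous_const

theorem IsTest.isCc_dRad (hφ : IsTest R θ₁ θ₂ φ) : IsCc R θ₁ θ₂ (dRad φ) := by
  have h : dRad φ = fun p => fderiv ℝ φ p (1, 0) := by
    ext p
    exact ((hφ.smooth.differentiable (by simp) p).hasFDerivAt.comp_hasDerivAt p.1
      ((hasDerivAt_id p.1).prodMk (hasDerivAt_const p.1 p.2))).deriv
  rw [h]
  exact isCc_fderiv_apply hφ _

theorem IsTest.isCc_dAng (hφ : IsTest R θ₁ θ₂ φ) : IsCc R θ₁ θ₂ (dAng φ) := by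
  have h : dAng φ = fun p => fderiv ℝ φ p (0, 1) := by
    ext p
    exact ((hφ.smooth.differentiable (by simp) p).hasFDerivAt.comp_hasDerivAt p.2
      ((hasDerivAt_const p.2 p.1).prodMk (hasDerivAt_id p.2))).deriv
  rw [h]
  exact isCc_fderiv_apply hφ _

theorem integral_mul_dRad (hφ : IsTest R θ₁ θ₂ φ) {a a' b : ℝ → ℝ}
    (ha : ∀ r ∈ Ioo 0 R, HasDerivAt a (a' r) r) (ha' : ContinuousOn a' (Ioo 0 R))
    (hb : Continuous b) :
    ∫ p in domain R θ₁ θ₂, a p.1 * b p.2 * dRad φ p =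
      -∫ p in domain R θ₁ θ₂, a' p.1 * b p.2 * φ p := by
  have hac : ContinuousOn a (Ioo 0 R) := fun x hx => (ha x hx).continuousAt.continuousWithinAt
  have h1 := (hφ.isCc_dRad.mul_prod hac hb).integrable
  have h2 := (hφ.isCc.mul_prod ha' hb).integrable
  rw [IntegrableOn, restrict_domain] at h1 h2
  rw [restrict_domain, integral_prod_symm _ h1, integral_prod_symm _ h2, ← integral_neg]
  congr 1
  ext θ
  have h3 := (hφ.slice_rad θ).integral_mul_deriv ha ha'
  simp only [mul_right_comm _ (b θ)]
  rw [integral_mul_const, integral_mul_const, ← neg_mul, ← h3]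
  rfl

theorem integral_mul_dAng (hφ : IsTest R θ₁ θ₂ φ) {a b b' : ℝ → ℝ} (ha : ContinuousOn a (Ioo 0 R))
    (hb : ∀ θ, HasDerivAt b (b' θ) θ) (hb' : Continuous b') :
    ∫ p in domain R θ₁ θ₂, a p.1 * b p.2 * dAng φ p =
      -∫ p in domain R θ₁ θ₂, a p.1 * b' p.2 * φ p := by
  have hbc : Continuous b := continuous_iff_continuousAt.2 fun x => (hb x).continuousAt
  have h1 := (hφ.isCc_dAng.mul_prod ha hbc).integrable
  have h2 := (hφ.isCc.mul_prod ha hb').integrable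
  rw [IntegrableOn, restrict_domain] at h1 h2
  rw [restrict_domain, integral_prod _ h1, integral_prod _ h2, ← integral_neg]
  congr 1
  ext r
  have h3 := (hφ.slice_ang r).integral_mul_deriv (fun x _ => hb x) hb'.continuousOn
  simp only [mul_assoc (a r)]
  rw [integral_const_mul, integral_const_mul, ← mul_neg, ← h3]
  rfl

theorem inner_modeOp_toLp {U : ℝ × ℝ → ℝ} (hU : MemLp U 2 (area R θ₁ θ₂)) {f b : ℝ → ℝ}
    (hf : MemLp f 2 (radMeas R)) (hb : MemLp b 2 (angMeas θ₁ θ₂)) :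
    ⟪modeOp R (hb.toLp b) (hU.toLp U), hf.toLp f⟫_ℝ =
      ∫ p in domain R θ₁ θ₂, p.1 * (f p.1 * b p.2) * U p := by
  rw [inner_modeOp, tens_toLp, inner_toLp_toLp, integral_area]
  congr 1
  ext p
  ring

/-- The relations between the `n`-th modes of `v` and of its gradient `(g, h)`
that hold for `v ∈ H¹₀`. -/
structure DirichletTriple (n : ℕ) (hμ : 0 < freq θ₁ θ₂ n) (v g h : L2 R θ₁ θ₂) : Prop where
  eq_adjoint : modeOp R (sinVec θ₁ θ₂ n) v = adjoint (hOp hμ R)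
    (modeOp R (cosVec θ₁ θ₂ n) h - modeOp R (sinVec θ₁ θ₂ n) g)
  compat : ∀ χ (hχ : IsTestOn 0 R χ),
    ⟪modeOp R (cosVec θ₁ θ₂ n) h, (hχ.deriv.isNice.memLp R).toLp (deriv χ)⟫_ℝ +
      freq θ₁ θ₂ n * ⟪modeOp R (sinVec θ₁ θ₂ n) g,
        (hχ.isNice_inv_mul.memLp R).toLp (fun r => r⁻¹ * χ r)⟫_ℝ = 0

/-- If w is the n-th sine mode of φ, the cosine mode of (1/r)∂_θφ is μw/r and the sine mode of ∂_rφ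
is w'. Their difference is -(w' - μw/r), which H* inverts; the second relation is the weak form of
(μw)' = μw'. -/
theorem IsTest.dirichletTriple (hφ : IsTest R θ₁ θ₂ φ) (n : ℕ) (hμ : 0 < freq θ₁ θ₂ n) :
    DirichletTriple n hμ (hφ.isCc.memLp.toLp φ) (hφ.isCc_dRad.memLp.toLp (dRad φ))
      (hφ.isCc_dAng.div_fst.memLp.toLp (fun p => dAng φ p / p.1)) := by
  have hs := continuous_angMode θ₁ θ₂ n
  have hc := continuous_angCos θ₁ θ₂ n
  have hang : ∀ {f : ℝ → ℝ}, ContinuousOn f (Ioo 0 R) →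
      ∫ p in domain R θ₁ θ₂, p.1 * (f p.1 * angCos θ₁ θ₂ n p.2) * (dAng φ p / p.1) =
        freq θ₁ θ₂ n * ∫ p in domain R θ₁ θ₂, f p.1 * angMode θ₁ θ₂ n p.2 * φ p := by
    intro f hf
    have h1 := integral_mul_dAng hφ hf (hasDerivAt_angCos θ₁ θ₂ n) (by fun_prop)
    rw [← integral_neg] at h1
    rw [← integral_const_mul]
    refine Eq.trans (setIntegral_congr_fun (measurableSet_domain R θ₁ θ₂) fun p hp => ?_)
      (h1.trans (integral_congr_ae (Eventually.of_forall fun p => ?_)))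
    · have := hp.1.1.ne'
      field_simp
    · simp only
      ring
  refine ⟨?_, fun χ hχ => ?_⟩
  · refine ext_inner_right ℝ fun f => ?_
    -- Against a nice f, moving H* to the other side puts the differentiable function `fwd` of f
    -- next to the gradient, and integration by parts applies.
    refine nice_induction (P := fun f => ⟪modeOp R (sinVec θ₁ θ₂ n) (hφ.isCc.memLp.toLp φ), f⟫_ℝ =
      ⟪adjoint (hOp hμ R) (modeOp R (cosVec θ₁ θ₂ n)
        (hφ.isCc_dAng.div_fst.memLp.toLp (fun p => dAng φ p / p.1)) -
          modeOp R (sinVec θ₁ θ₂ n) (hφ.isCc_dRad.memLp.toLp (dRad φ))), f⟫_ℝ)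
      (isClosed_eq (by fun_prop) (by fun_prop)) (fun f hf => ?_) f
    have hp := hf.fwd hμ
    have hpc : ContinuousOn (fwd (freq θ₁ θ₂ n) f) (Ioo 0 R) := hp.cont.mono Ioo_subset_Ioi_self
    have hfc : ContinuousOn f (Ioo 0 R) := hf.cont.mono Ioo_subset_Ioi_self
    rw [adjoint_inner_left, hOp_toLp hμ hf, inner_sub_left, sinVec, cosVec, inner_modeOp_toLp,
      inner_modeOp_toLp, inner_modeOp_toLp, hang hpc]
    have hd : ∀ r ∈ Ioo 0 R, HasDerivAt (fun r => r * fwd (freq θ₁ θ₂ n) f r)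
        (r * f r - freq θ₁ θ₂ n * fwd (freq θ₁ θ₂ n) f r) r := fun r hr => by
      refine ((hasDerivAt_id r).mul (hasDerivAt_fwd hf hμ hr.1)).congr_deriv ?_
      have := hr.1.ne'
      simp only [id]
      field_simp
      ring
    have hrf : ContinuousOn (fun r => r * f r) (Ioo 0 R) := continuousOn_id.mul hfc
    have h2 := integral_mul_dRad hφ hd (hrf.sub (continuousOn_const.mul hpc)) hs
    have h3 : ∫ p in domain R θ₁ θ₂, p.1 * (fwd (freq θ₁ θ₂ n) f p.1 * angMode θ₁ θ₂ n p.2) *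
        dRad φ p = ∫ p in domain R θ₁ θ₂, p.1 * fwd (freq θ₁ θ₂ n) f p.1 * angMode θ₁ θ₂ n p.2 *
        dRad φ p := by
      simp only [mul_assoc]
    rw [h3, h2, sub_neg_eq_add, ← integral_const_mul, ← integral_add]
    · congr 1
      ext p
      ring
    · exact (hφ.isCc.mul_prod hpc hs).integrable.const_mul _
    · exact (hφ.isCc.mul_prod (hrf.sub (continuousOn_const.mul hpc)) hs).integrable
  · rw [sinVec, cosVec, inner_modeOp_toLp, inner_modeOp_toLp,
      hang hχ.deriv.smooth.continuous.continuousOn]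
    have h1 := integral_mul_dRad hφ (fun r _ => hχ.hasDerivAt r)
      hχ.deriv.smooth.continuous.continuousOn hs
    have h2 : ∫ p in domain R θ₁ θ₂, p.1 * (p.1⁻¹ * χ p.1 * angMode θ₁ θ₂ n p.2) * dRad φ p =
        ∫ p in domain R θ₁ θ₂, χ p.1 * angMode θ₁ θ₂ n p.2 * dRad φ p := by
      refine setIntegral_congr_fun (measurableSet_domain R θ₁ θ₂) fun p hp => ?_
      have := hp.1.1.ne'
      field_simp
    rw [h2, h1]
    ring

/-- Both relations are closed conditions on (v, g, h), so they survive the H¹ limits that define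
H¹₀. -/
theorem dirichletTriple_of_forall_near {n : ℕ} {hμ : 0 < freq θ₁ θ₂ n} {v g h : L2 R θ₁ θ₂}
    (H : ∀ δ > 0, ∃ v' g' h', DirichletTriple n hμ v' g' h' ∧ dist v' v < δ ∧ dist g' g < δ ∧
      dist h' h < δ) : DirichletTriple n hμ v g h := by
  have key : ∀ P : L2 R θ₁ θ₂ × L2 R θ₁ θ₂ × L2 R θ₁ θ₂ → Prop, IsClosed {x | P x} →
      (∀ v' g' h', DirichletTriple n hμ v' g' h' → P (v', g', h')) → P (v, g, h) := by
    intro P hP hT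
    refine hP.closure_subset_iff.2 (Subset.refl _) (Metric.mem_closure_iff.2 fun δ hδ => ?_)
    obtain ⟨v', g', h', h1, h2, h3, h4⟩ := H δ hδ
    refine ⟨(v', g', h'), hT _ _ _ h1, ?_⟩
    rw [dist_comm]
    simp only [Prod.dist_eq, max_lt_iff]
    exact ⟨h2, h3, h4⟩
  constructor
  · exact key (fun x => modeOp R (sinVec θ₁ θ₂ n) x.1 = adjoint (hOp hμ R)
      (modeOp R (cosVec θ₁ θ₂ n) x.2.2 - modeOp R (sinVec θ₁ θ₂ n) x.2.1))
      (isClosed_eq (by fun_prop) (by fun_prop)) fun _ _ _ h => h.eq_adjoint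
  · intro χ hχ
    exact key (fun x => ⟪modeOp R (cosVec θ₁ θ₂ n) x.2.2,
      (hχ.deriv.isNice.memLp R).toLp (deriv χ)⟫_ℝ +
      freq θ₁ θ₂ n * ⟪modeOp R (sinVec θ₁ θ₂ n) x.2.1,
        (hχ.isNice_inv_mul.memLp R).toLp (fun r => r⁻¹ * χ r)⟫_ℝ = 0)
      (isClosed_eq (by fun_prop) (by fun_prop)) fun _ _ _ h => h.compat χ hχ

theorem dist_toLp_lt {f g : ℝ × ℝ → ℝ} (hf : MemLp f 2 (area R θ₁ θ₂))
    (hg : MemLp g 2 (area R θ₁ θ₂)) {δ : ℝ}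
    (h : eLpNorm (fun p => g p - f p) 2 (area R θ₁ θ₂) < ENNReal.ofReal δ) :
    dist (hf.toLp f) (hg.toLp g) < δ := by
  rw [dist_comm, Lp.dist_edist, Lp.edist_toLp_toLp]
  exact (ENNReal.lt_ofReal_iff_toReal_lt (ne_top_of_lt h)).1 h

/-- The gradient of an `H¹₀` function satisfies the mode relations for every `n`. -/
theorem MemH10.exists_dirichletTriple {v : ℝ × ℝ → ℝ} (hv : MemH10 R θ₁ θ₂ v) :
    ∃ (hv' : MemLp v 2 (area R θ₁ θ₂)) (g h : ℝ × ℝ → ℝ) (hg : MemLp g 2 (area R θ₁ θ₂))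
      (hh : MemLp h 2 (area R θ₁ θ₂)), HasWeakGradient R θ₁ θ₂ v g h ∧
      ∀ (n : ℕ) (hμ : 0 < freq θ₁ θ₂ n),
        DirichletTriple n hμ (hv'.toLp v) (hg.toLp g) (hh.toLp h) := by
  obtain ⟨hv', g, h, hg, hh, hw, happ⟩ := hv
  refine ⟨hv', g, h, hg, hh, hw, fun n hμ => ?_⟩
  refine dirichletTriple_of_forall_near fun δ hδ => ?_
  obtain ⟨φ, hφ, h1, h2, h3⟩ := happ (ENNReal.ofReal δ) (by simpa using hδ)
  exact ⟨_, _, _, hφ.dirichletTriple n hμ, dist_toLp_lt _ _ h1, dist_toLp_lt _ _ h2,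
    dist_toLp_lt _ _ h3⟩

end PlaneTests

/-! ### Uniqueness of the weak gradient and the boundary extension -/

section WeakGradient

variable {R θ₁ θ₂ : ℝ}

theorem IsTest.fst_mul {φ : ℝ × ℝ → ℝ} (hφ : IsTest R θ₁ θ₂ φ) :
    IsTest R θ₁ θ₂ fun p => p.1 * φ p :=
  ⟨contDiff_fst.mul hφ.smooth, hφ.compact.mul_left,
    (tsupport_mul_subset_right (f := Prod.fst)).trans hφ.inside⟩

theorem ae_area_eq_of_forall_isTest {f g : ℝ × ℝ → ℝ} (hf : MemLp f 2 (area R θ₁ θ₂))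
    (hg : MemLp g 2 (area R θ₁ θ₂)) (h : ∀ φ, IsTest R θ₁ θ₂ φ →
      ∫ p in domain R θ₁ θ₂, p.1 * f p * φ p = ∫ p in domain R θ₁ θ₂, p.1 * g p * φ p) :
    f =ᵐ[area R θ₁ θ₂] g := by
  have hf1 := integrable_area_iff.1 (hf.integrable one_le_two)
  have hg1 := integrable_area_iff.1 (hg.integrable one_le_two)
  have hbdd : ∀ {F φ : ℝ × ℝ → ℝ}, IsTest R θ₁ θ₂ φ → IntegrableOn F (domain R θ₁ θ₂) →
      IntegrableOn (fun p => F p * φ p) (domain R θ₁ θ₂) := by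
    intro F φ hφ hF
    obtain ⟨C, hC⟩ := hφ.isCc.exists_bound
    exact Integrable.mul_bdd (c := C) hF hφ.isCc.cont.aestronglyMeasurable
      (Eventually.of_forall hC)
  have key := (isOpen_domain R θ₁ θ₂).ae_eq_zero_of_integral_contDiff_smul_eq_zero (μ := volume)
    (f := fun p => p.1 * f p - p.1 * g p) (hf1.sub hg1).locallyIntegrableOn (fun φ h1 h2 h3 => by
      have hφ : IsTest R θ₁ θ₂ φ := ⟨h1, h2, h3⟩
      rw [← setIntegral_eq_integral_of_forall_compl_eq_zero (s := domain R θ₁ θ₂) fun p hp => by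
        rw [image_eq_zero_of_notMem_tsupport fun h => hp (h3 h), zero_smul]]
      have h4 : ∀ p, φ p • (p.1 * f p - p.1 * g p) = p.1 * f p * φ p - p.1 * g p * φ p := fun p => by
        rw [smul_eq_mul]
        ring
      simp only [h4]
      rw [integral_sub (hbdd hφ hf1) (hbdd hφ hg1), h φ hφ, sub_self])
  refine (area_absolutelyContinuous R θ₁ θ₂).ae_le ?_
  refine (ae_restrict_iff' (measurableSet_domain R θ₁ θ₂)).2 ?_
  filter_upwards [key] with p hp hpd
  have h5 := hp hpd
  rw [← mul_sub] at h5
  exact sub_eq_zero.1 ((mul_eq_zero.1 h5).resolve_left hpd.1.1.ne')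

theorem memLp_prod {f b : ℝ → ℝ} (hf : Continuous f) (hb : Continuous b) :
    MemLp (fun p : ℝ × ℝ => f p.1 * b p.2) 2 (area R θ₁ θ₂) :=
  memLp_area.2 (memLp_tensor ((IsNice.of_continuous hf).memLp R) (memLp_angMeas hb))

/-- The weak gradient of `u` is that of `u - (r / R) b(θ)` plus the classical gradient of
`(r / R) b(θ)`. -/
theorem weakGradient_eq {u ur ua g h : ℝ × ℝ → ℝ} {b b' : ℝ → ℝ}
    (hu : MemLp u 2 (area R θ₁ θ₂)) (hur : MemLp ur 2 (area R θ₁ θ₂))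
    (hua : MemLp ua 2 (area R θ₁ θ₂)) (hg : MemLp g 2 (area R θ₁ θ₂))
    (hh : MemLp h 2 (area R θ₁ θ₂)) (hw : HasWeakGradient R θ₁ θ₂ u ur ua)
    (hw' : HasWeakGradient R θ₁ θ₂ (fun p => u p - p.1 / R * b p.2) g h)
    (hb : ∀ θ, HasDerivAt b (b' θ) θ) (hb' : Continuous b') :
    (ur =ᵐ[area R θ₁ θ₂] fun p => g p + 1 / R * b p.2) ∧
      ua =ᵐ[area R θ₁ θ₂] fun p => h p + 1 / R * b' p.2 := by
  have hbc : Continuous b := continuous_iff_continuousAt.2 fun x => (hb x).continuousAt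
  have hrc : ContinuousOn (fun r : ℝ => r / R) (Ioo 0 R) := (continuous_id.div_const R).continuousOn
  constructor
  · have hm : MemLp (fun p => g p + 1 / R * b p.2) 2 (area R θ₁ θ₂) :=
      hg.add (memLp_prod (f := fun _ => 1 / R) continuous_const hbc)
    refine ae_area_eq_of_forall_isTest hur hm fun φ hφ => ?_
    -- The radial weak derivative is defined without the weight r; testing with rφ supplies it.
    have hψ := hφ.fst_mul
    have h1 := hw.radial _ hψ
    have h2 := hw'.radial _ hψ
    have h3 := integral_mul_dRad hψ (a := fun r => r / R) (a' := fun _ => 1 / R)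
      (fun r _ => (hasDerivAt_id r).div_const R) continuousOn_const hbc
    simp only [sub_mul] at h2
    rw [integral_sub (hψ.isCc_dRad.integrable_mul hu) (hψ.isCc_dRad.mul_prod hrc hbc).integrable,
      h1, h3] at h2
    have h4 : ∀ F : ℝ × ℝ → ℝ, ∫ p in domain R θ₁ θ₂, p.1 * F p * φ p =
      ∫ p in domain R θ₁ θ₂, F p * (p.1 * φ p) := fun F => by
      congr 1
      ext p
      ring
    rw [h4, h4]
    simp only [add_mul]
    rw [integral_add (hψ.isCc.integrable_mul hg)
      (hψ.isCc.mul_prod (a := fun _ => 1 / R) continuousOn_const hbc).integrable]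
    linarith
  · have hm : MemLp (fun p => h p + 1 / R * b' p.2) 2 (area R θ₁ θ₂) :=
      hh.add (memLp_prod (f := fun _ => 1 / R) continuous_const hb')
    refine ae_area_eq_of_forall_isTest hua hm fun φ hφ => ?_
    have h1 := hw.angular _ hφ
    have h2 := hw'.angular _ hφ
    have h3 := integral_mul_dAng hφ hrc hb hb'
    simp only [sub_mul] at h2
    rw [integral_sub (hφ.isCc_dAng.integrable_mul hu) (hφ.isCc_dAng.mul_prod hrc hbc).integrable,
      h1, h3] at h2
    have h4 : ∫ p in domain R θ₁ θ₂, p.1 * (h p + 1 / R * b' p.2) * φ p =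
        (∫ p in domain R θ₁ θ₂, p.1 * h p * φ p) + ∫ p in domain R θ₁ θ₂, p.1 / R * b' p.2 * φ p := by
      rw [← integral_add _ (hφ.isCc.mul_prod hrc hb').integrable]
      · congr 1
        ext p
        ring
      · have := hφ.fst_mul.isCc.integrable_mul hh
        refine this.congr (Eventually.of_forall fun p => ?_)
        simp only
        ring
    rw [h4]
    linarith

end WeakGradient

/-! ### The feedback law and inhomogeneous boundary values -/

section Feedback

variable {R θ₁ θ₂ : ℝ}

theorem summable_besselI1 (x : ℝ) : Summable fun m : ℕ =>
    (x / 2) ^ (2 * m + 1) / ((m.factorial : ℝ) * ((m + 1).factorial : ℝ)) := by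
  refine Summable.of_norm_bounded ((Real.summable_pow_div_factorial ((x / 2) ^ 2)).mul_left |x / 2|)
    fun m => ?_
  have h1 : (1 : ℝ) ≤ (m + 1).factorial := by exact_mod_cast Nat.succ_le_of_lt (Nat.factorial_pos _)
  have h2 : (0 : ℝ) < m.factorial := by exact_mod_cast Nat.factorial_pos m
  rw [norm_div, norm_pow, pow_succ, pow_mul, Real.norm_eq_abs, sq_abs, mul_comm, mul_div_assoc,
    Real.norm_of_nonneg (by positivity)]
  gcongr
  exact le_mul_of_one_le_right h2.le h1

theorem measurable_besselI1 : Measurable besselI1 := by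
  refine measurable_of_tendsto_metrizable (f := fun (k : ℕ) x => ∑ m ∈ Finset.range k,
    (x / 2) ^ (2 * m + 1) / ((m.factorial : ℝ) * ((m + 1).factorial : ℝ))) (fun k => ?_) ?_
  · fun_prop
  · exact tendsto_pi_nhds.2 fun x => (summable_besselI1 x).hasSum.tendsto_sum_nat

/-- The kernel already contains the Jacobian ρ, which is divided out for a pairing in L²(ρ dρ). What
remains is bounded, by a termwise comparison with an exponential series. -/
theorem memLp_besselKernel_div {κ μ : ℝ} (hκ : 0 ≤ κ) (hμ : 0 < μ) :
    MemLp (fun ρ => besselKernel κ R μ ρ / ρ) 2 (radMeas R) := by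
  have hm : Measurable fun ρ => besselKernel κ R μ ρ / ρ := by
    have := measurable_besselI1
    unfold besselKernel
    fun_prop
  set a := ∑' m : ℕ, (κ * R ^ 2 / 4) ^ m / (m.factorial : ℝ) with ha
  refine MemLp.of_bound hm.aestronglyMeasurable (κ * a) (ae_radMeas fun ρ hρ => ?_)
  rcases eq_or_lt_of_le hκ with rfl | hκ'
  · simp [besselKernel]
  have hR : 0 < R := hρ.1.trans hρ.2
  have h0 : 0 < R ^ 2 - ρ ^ 2 := sub_pos.2 (pow_lt_pow_left₀ hρ.2 hρ.1.le two_ne_zero)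
  have h1 : 0 < κ * (R ^ 2 - ρ ^ 2) := mul_pos hκ' h0
  have h2 : besselKernel κ R μ ρ / ρ = -(κ * ((ρ / R) ^ μ * (besselI1 (Real.sqrt
      (κ * (R ^ 2 - ρ ^ 2))) / Real.sqrt (κ * (R ^ 2 - ρ ^ 2))))) := by
    have := hρ.1.ne'
    rw [besselKernel]
    field_simp
  rw [h2, norm_neg, norm_mul, norm_mul, Real.norm_of_nonneg hκ,
    besselI1_div_self (Real.sqrt_pos.2 h1).ne', Real.sq_sqrt h1.le]
  have hρ0 : 0 ≤ ρ / R := (div_pos hρ.1 hR).le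
  have h3 : ‖(ρ / R) ^ μ‖ ≤ 1 := by
    rw [Real.norm_of_nonneg (Real.rpow_nonneg hρ0 _)]
    exact Real.rpow_le_one hρ0 ((div_le_one hR).2 hρ.2.le) hμ.le
  have h4 : ‖∑' m : ℕ, (κ * (R ^ 2 - ρ ^ 2) / 4) ^ m /
      (2 * ((m.factorial : ℝ) * (m + 1).factorial))‖ ≤ a := by
    refine tsum_of_norm_bounded (Real.summable_pow_div_factorial (κ * R ^ 2 / 4)).hasSum fun m => ?_
    have h5 : (1 : ℝ) ≤ (m + 1).factorial := by
      exact_mod_cast Nat.succ_le_of_lt (Nat.factorial_pos _)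
    have h6 : (0 : ℝ) < m.factorial := by exact_mod_cast Nat.factorial_pos m
    rw [Real.norm_of_nonneg (by positivity)]
    have h7 : R ^ 2 - ρ ^ 2 ≤ R ^ 2 := by nlinarith [sq_nonneg ρ]
    gcongr
    nlinarith
  calc κ * (‖(ρ / R) ^ μ‖ * _) ≤ κ * (1 * a) := by gcongr
    _ = κ * a := by rw [one_mul]

/-- The `n`-th sine coefficient of the feedback law is the pairing of the `n`-th mode with this
element of `L²(r dr)`. -/
noncomputable def gainVec {κ μ : ℝ} (hκ : 0 ≤ κ) (hμ : 0 < μ) (R : ℝ) : Lp ℝ 2 (radMeas R) :=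
  (memLp_besselKernel_div (R := R) hκ hμ).toLp _

theorem inner_gainVec {κ μ : ℝ} (hκ : 0 ≤ κ) (hμ : 0 < μ) (f : Lp ℝ 2 (radMeas R)) :
    ⟪gainVec hκ hμ R, f⟫_ℝ = ∫ ρ in Ioo 0 R, besselKernel κ R μ ρ * f ρ := by
  rw [gainVec, inner_eq_integral (MemLp.coeFn_toLp _) (ae_eq_refl f), integral_radMeas]
  refine setIntegral_congr_fun measurableSet_Ioo fun ρ hρ => ?_
  have := hρ.1.ne'
  field_simp

variable {ε lam c : ℝ} {N : ℕ}

theorem integral_kernel_mul (hκ : 0 ≤ (lam + c) / ε) {n : ℕ} (hμ : 0 < freq θ₁ θ₂ n)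
    (u : L2 R θ₁ θ₂) :
    IntegrableOn (fun p => kernel ε lam c θ₁ θ₂ n R p.1 * angMode θ₁ θ₂ n p.2 * u p)
      (domain R θ₁ θ₂) ∧
    ∫ p in domain R θ₁ θ₂, kernel ε lam c θ₁ θ₂ n R p.1 * angMode θ₁ θ₂ n p.2 * u p =
      ⟪gainVec hκ hμ R, modeOp R (sinVec θ₁ θ₂ n) u⟫_ℝ := by
  have hk := memLp_besselKernel_div (R := R) hκ hμ
  have hs := memLp_angMeas (θ₁ := θ₁) (θ₂ := θ₂) (continuous_angMode θ₁ θ₂ n)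
  have heq : ∀ p ∈ domain R θ₁ θ₂, p.1 * (u p * (besselKernel ((lam + c) / ε) R (freq θ₁ θ₂ n) p.1 /
      p.1 * angMode θ₁ θ₂ n p.2)) = kernel ε lam c θ₁ θ₂ n R p.1 * angMode θ₁ θ₂ n p.2 * u p := by
    intro p hp
    have := hp.1.1.ne'
    have h1 : kernel ε lam c θ₁ θ₂ n R p.1 =
      besselKernel ((lam + c) / ε) R (freq θ₁ θ₂ n) p.1 := rfl
    rw [h1]
    field_simp
  constructor
  · have h1 := integrable_area_iff.1 (MemLp.integrable_mul (Lp.memLp u)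
      (memLp_area.2 (memLp_tensor hk hs)))
    exact h1.congr (ae_restrict_of_forall_mem (measurableSet_domain R θ₁ θ₂) heq)
  · rw [real_inner_comm, inner_modeOp, gainVec, sinVec, tens_toLp,
      inner_eq_integral (ae_eq_refl u) (MemLp.coeFn_toLp _), integral_area]
    exact (setIntegral_congr_fun (measurableSet_domain R θ₁ θ₂) heq).symm

/-- The sine coefficients of the feedback law. -/
noncomputable def feedbackCoeff (hκ : 0 ≤ (lam + c) / ε) (hθ : θ₁ < θ₂) (N : ℕ) (u : L2 R θ₁ θ₂)
    (n : ℕ) : ℝ :=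
  if hn : 1 ≤ n ∧ n ≤ N then
    ⟪gainVec hκ (freq_pos hθ hn.1) R, modeOp R (sinVec θ₁ θ₂ n) u⟫_ℝ else 0

/-- A finite sine sum is differentiable with an explicit cosine derivative, so the gradient of the
extension (r/R)b(θ) can be computed. -/
theorem feedback_eq_sum (hκ : 0 ≤ (lam + c) / ε) (hθ : θ₁ < θ₂) (u : L2 R θ₁ θ₂) (θ : ℝ) :
    feedback ε lam c R θ₁ θ₂ N u θ = ∑ n ∈ Finset.Icc 1 N,
      2 / (θ₂ - θ₁) * feedbackCoeff hκ hθ N u n * angMode θ₁ θ₂ n θ := by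
  rw [feedback]
  have h1 : ∀ p : ℝ × ℝ, fullKernel ε lam c θ₁ θ₂ N R p.1 θ p.2 * u p =
      ∑ n ∈ Finset.Icc 1 N, -(2 / (θ₂ - θ₁) * angMode θ₁ θ₂ n θ) *
        (kernel ε lam c θ₁ θ₂ n R p.1 * angMode θ₁ θ₂ n p.2 * u p) := fun p => by
    rw [fullKernel, mul_assoc, Finset.sum_mul, Finset.mul_sum]
    refine Finset.sum_congr rfl fun n _ => ?_
    ring
  simp only [h1]
  rw [integral_finsetSum, ← Finset.sum_neg_distrib]
  · refine Finset.sum_congr rfl fun n hn => ?_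
    have hn' := Finset.mem_Icc.1 hn
    rw [integral_const_mul, (integral_kernel_mul hκ (freq_pos hθ hn'.1) u).2, feedbackCoeff,
      dif_pos hn']
    ring
  · intro n hn
    exact (integral_kernel_mul hκ (freq_pos hθ (Finset.mem_Icc.1 hn).1) u).1.const_mul _

theorem integral_sum_mul_mode {f : ℕ → ℝ → ℝ} (hf : ∀ n, Continuous (f n))
    (horth : ∀ m n, 1 ≤ n →
      ∫ x in Ioo θ₁ θ₂, f m x * f n x = if m = n then (θ₂ - θ₁) / 2 else 0) (B : ℕ → ℝ) {n : ℕ}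
    (hn : 1 ≤ n) :
    ∫ x in Ioo θ₁ θ₂, (∑ m ∈ Finset.Icc 1 N, B m * f m x) * f n x =
      if n ≤ N then B n * ((θ₂ - θ₁) / 2) else 0 := by
  simp only [Finset.sum_mul, mul_assoc]
  have hi : ∀ m ∈ Finset.Icc 1 N, IntegrableOn (fun x => B m * (f m x * f n x)) (Ioo θ₁ θ₂) :=
    fun m _ => (integrableOn_of_continuous ((hf m).mul (hf n))).const_mul (B m)
  rw [integral_finsetSum _ hi]
  simp only [integral_const_mul, horth _ _ hn, mul_ite, mul_zero]
  rw [Finset.sum_ite_eq']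
  simp [hn]

/-- `r / R = (μ - 1) T(1 / R) + (r / R)^μ` with `T` the adjoint of `hOp`. -/
theorem ratio_eq (hR : 0 < R) {μ : ℝ} (hμ : 0 < μ) :
    ((IsNice.of_continuous (continuous_id.div_const R)).memLp R).toLp (fun r => r / R) =
      (μ - 1) • adjoint (hOp hμ R) (((IsNice.of_continuous (f := fun _ => 1 / R)
        continuous_const).memLp R).toLp (fun _ => 1 / R)) + eVec hμ R := by
  rw [adjoint_hOp_toLp hμ hR (IsNice.of_continuous (f := fun _ => 1 / R) continuous_const), eVec,
    ← MemLp.toLp_const_smul, ← MemLp.toLp_add]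
  refine toLp_congr_nice _ _ fun r hr => ?_
  simp only [Pi.add_apply, Pi.smul_apply, smul_eq_mul, bwd]
  have h1 : (μ - 1) * ∫ ρ in r..R, ρ ^ (-μ) * (1 / R) = -(1 / R) * (R ^ (1 - μ) - r ^ (1 - μ)) := by
    rw [← intervalIntegral.integral_const_mul, mul_sub, intervalIntegral.integral_eq_sub_of_hasDerivAt
      (f := fun ρ => -(1 / R) * ρ ^ (1 - μ))]
    · intro ρ hρ
      have hρ0 : 0 < ρ := lt_of_lt_of_le (lt_min hr hR) hρ.1
      refine ((Real.hasDerivAt_rpow_const (p := 1 - μ) (Or.inl hρ0.ne')).const_mul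
        (-(1 / R))).congr_deriv ?_
      rw [show 1 - μ - 1 = -μ by ring]
      ring
    · exact intervalIntegrable_of_pos (continuousOn_const.mul
        ((continuousOn_rpow_Ioi _).mul continuousOn_const)) hr hR
  have h2 : r ^ μ * r ^ (1 - μ) = r := by rw [← Real.rpow_add hr]; simp
  have h3 : R ^ (1 - μ) = R / R ^ μ := by rw [Real.rpow_sub hR, Real.rpow_one]
  have h4 : R ^ μ ≠ 0 := (Real.rpow_pos_of_pos hR _).ne'
  rw [mul_left_comm, h1, h3, Real.div_rpow hr.le hR.le]
  field_simp
  linear_combination (-R ^ μ) * h2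

/-- The relations between the modes of a function with boundary values given by the feedback law
and the modes of its weak gradient. -/
theorem modes_of_hasBoundaryValues (hR : 0 < R) (hθ : θ₁ < θ₂) (hκ : 0 ≤ (lam + c) / ε)
    {u ur ua : L2 R θ₁ θ₂} (hw : HasWeakGradient R θ₁ θ₂ u ur ua)
    (hbv : HasBoundaryValues R θ₁ θ₂ (feedback ε lam c R θ₁ θ₂ N u) u) {n : ℕ} (hn : 1 ≤ n) :
    (modeOp R (sinVec θ₁ θ₂ n) u = adjoint (hOp (freq_pos hθ hn) R)
      (modeOp R (cosVec θ₁ θ₂ n) ua - modeOp R (sinVec θ₁ θ₂ n) ur) +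
        feedbackCoeff hκ hθ N u n • eVec (freq_pos hθ hn) R) ∧
    ∀ χ (hχ : IsTestOn 0 R χ),
      ⟪modeOp R (cosVec θ₁ θ₂ n) ua, (hχ.deriv.isNice.memLp R).toLp (deriv χ)⟫_ℝ +
        freq θ₁ θ₂ n * ⟪modeOp R (sinVec θ₁ θ₂ n) ur,
          (hχ.isNice_inv_mul.memLp R).toLp (fun r => r⁻¹ * χ r)⟫_ℝ = 0 := by
  have hL := sub_pos.2 hθ
  set b : ℝ → ℝ := fun θ => ∑ m ∈ Finset.Icc 1 N,
    2 / (θ₂ - θ₁) * feedbackCoeff hκ hθ N u m * angMode θ₁ θ₂ m θ with hb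
  set b' : ℝ → ℝ := fun θ => ∑ m ∈ Finset.Icc 1 N,
    (2 / (θ₂ - θ₁) * feedbackCoeff hκ hθ N u m * freq θ₁ θ₂ m) * angCos θ₁ θ₂ m θ with hb'
  have hfb : feedback ε lam c R θ₁ θ₂ N u = b := funext fun θ => feedback_eq_sum hκ hθ u θ
  have hbd : ∀ θ, HasDerivAt b (b' θ) θ := fun θ => by
    refine (HasDerivAt.fun_sum fun m _ => (hasDerivAt_angMode θ₁ θ₂ m θ).const_mul
      (2 / (θ₂ - θ₁) * feedbackCoeff hκ hθ N u m)).congr_deriv ?_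
    exact Finset.sum_congr rfl fun m _ => by ring
  have hbc : Continuous b := continuous_iff_continuousAt.2 fun x => (hbd x).continuousAt
  have hbc' : Continuous b' := continuous_finsetSum _ fun m _ =>
    continuous_const.mul (continuous_angCos θ₁ θ₂ m)
  rw [HasBoundaryValues, hfb] at hbv
  obtain ⟨hv, g, h, hg, hh, hw', htriple⟩ := hbv.exists_dirichletTriple
  obtain ⟨hur, hua⟩ := weakGradient_eq (Lp.memLp u) (Lp.memLp ur) (Lp.memLp ua) hg hh hw hw' hbd hbc'
  have hμ := freq_pos hθ hn
  obtain ⟨ht1, ht2⟩ := htriple n hμ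
  set rV := ((IsNice.of_continuous (continuous_id.div_const R)).memLp R).toLp (fun r => r / R)
    with hrV
  set iV := ((IsNice.of_continuous (f := fun _ => 1 / R) continuous_const).memLp R).toLp
    (fun _ => 1 / R) with hiV
  set bV := (memLp_angMeas (θ₁ := θ₁) (θ₂ := θ₂) hbc).toLp b with hbV
  set bV' := (memLp_angMeas (θ₁ := θ₁) (θ₂ := θ₂) hbc').toLp b' with hbV'
  have e1 : u = hv.toLp _ + tens rV bV := by
    rw [tens_toLp, ← MemLp.toLp_add]
    refine Lp.ext ?_
    filter_upwards [MemLp.coeFn_toLp (hv.add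
      (memLp_prod (f := fun r => r / R) (continuous_id.div_const R) hbc))]
      with p hp
    rw [hp]
    simp
  have e2 : ur = hg.toLp g + tens iV bV := by
    rw [tens_toLp, ← MemLp.toLp_add]
    refine Lp.ext (hur.trans ?_)
    exact (MemLp.coeFn_toLp (hg.add (memLp_prod (f := fun _ => 1 / R) continuous_const hbc))).symm
  have e3 : ua = hh.toLp h + tens iV bV' := by
    rw [tens_toLp, ← MemLp.toLp_add]
    refine Lp.ext (hua.trans ?_)
    exact (MemLp.coeFn_toLp (hh.add (memLp_prod (f := fun _ => 1 / R) continuous_const hbc'))).symm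
  set β := feedbackCoeff hκ hθ N u n with hβ
  have hβ0 : ¬ n ≤ N → β = 0 := fun hnN => dif_neg fun h => hnN h.2
  have i1 : ⟪bV, sinVec θ₁ θ₂ n⟫_ℝ = β := by
    rw [hbV, sinVec, inner_toLp_toLp, integral_sum_mul_mode (continuous_angMode θ₁ θ₂)
      (fun m n hn => by
        have := inner_sinVec hθ (m := m) hn
        rwa [sinVec, sinVec, inner_toLp_toLp] at this) _ hn]
    split_ifs with hnN
    · field_simp
      rfl
    · exact (hβ0 hnN).symm
  have i2 : ⟪bV', cosVec θ₁ θ₂ n⟫_ℝ = freq θ₁ θ₂ n * β := by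
    rw [hbV', cosVec, inner_toLp_toLp, integral_sum_mul_mode (continuous_angCos θ₁ θ₂)
      (fun m n hn => by
        have := inner_cosVec hθ (m := m) hn
        rwa [cosVec, cosVec, inner_toLp_toLp] at this) _ hn]
    split_ifs with hnN
    · field_simp
      rfl
    · rw [hβ0 hnN, mul_zero]
  have m1 : modeOp R (sinVec θ₁ θ₂ n) u = modeOp R (sinVec θ₁ θ₂ n) (hv.toLp _) + β • rV := by
    nth_rewrite 1 [e1]
    rw [map_add, modeOp_tens, i1]
  have m2 : modeOp R (sinVec θ₁ θ₂ n) ur = modeOp R (sinVec θ₁ θ₂ n) (hg.toLp g) + β • iV := by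
    rw [e2, map_add, modeOp_tens, i1]
  have m3 : modeOp R (cosVec θ₁ θ₂ n) ua =
      modeOp R (cosVec θ₁ θ₂ n) (hh.toLp h) + (freq θ₁ θ₂ n * β) • iV := by
    rw [e3, map_add, modeOp_tens, i2]
  constructor
  -- The extension contributes βr/R to the mode of u, and μβ/R - β/R to the difference of the
  -- gradient modes. By `ratio_eq` these match under H* up to βe, independently of the chosen
  -- extension.
  · rw [m1, m2, m3, ht1, hrV, ratio_eq hR hμ, ← hiV]
    simp only [map_sub, map_add, map_smul]
    module
  · intro χ hχ
    -- For the extension the compatibility relation is the integral of (rχ)' being zero.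
    have h1 : ⟪iV, (hχ.deriv.isNice.memLp R).toLp (deriv χ)⟫_ℝ +
        ⟪iV, (hχ.isNice_inv_mul.memLp R).toLp (fun r => r⁻¹ * χ r)⟫_ℝ = 0 := by
      rw [hiV, inner_toLp_toLp, inner_toLp_toLp, integral_radMeas, integral_radMeas]
      have h2 := hχ.integral_mul_deriv (F := fun r => r) (F' := fun _ => 1)
        (fun r _ => hasDerivAt_id r) continuousOn_const
      have h3 : ∫ r in Ioo 0 R, r * (1 / R * deriv χ r) = 1 / R * ∫ r in Ioo 0 R, r * deriv χ r := by
        rw [← integral_const_mul]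
        congr 1
        ext r
        ring
      have h4 : ∫ r in Ioo 0 R, r * (1 / R * (r⁻¹ * χ r)) = 1 / R * ∫ r in Ioo 0 R, 1 * χ r := by
        rw [← integral_const_mul]
        refine setIntegral_congr_fun measurableSet_Ioo fun r hr => ?_
        have := hr.1.ne'
        field_simp
      rw [h3, h4, h2]
      ring
    have h2 := ht2 χ hχ
    rw [m2, m3, inner_add_left, inner_add_left, inner_smul_left, inner_smul_left]
    simp only [conj_trivial]
    linear_combination h2 + freq θ₁ θ₂ n * β * h1

end Feedback

/-! ### From the weak equation to the inverted mode equation -/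

section WeakEquation

variable {R θ₁ θ₂ : ℝ}

theorem IsTestOn.isTest_mul {χ η : ℝ → ℝ} (hχ : IsTestOn 0 R χ) (hη : IsTestOn θ₁ θ₂ η) :
    IsTest R θ₁ θ₂ fun p => χ p.1 * η p.2 := by
  have hsub : Function.support (fun p : ℝ × ℝ => χ p.1 * η p.2) ⊆ tsupport χ ×ˢ tsupport η :=
    fun p hp => ⟨subset_tsupport χ (left_ne_zero_of_mul hp), subset_tsupport η
      (right_ne_zero_of_mul hp)⟩
  refine ⟨(hχ.smooth.comp contDiff_fst).mul (hη.smooth.comp contDiff_snd),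
    HasCompactSupport.of_support_subset_isCompact (hχ.compact.isCompact.prod hη.compact.isCompact)
      hsub, (closure_minimal hsub ((isClosed_tsupport χ).prod (isClosed_tsupport η))).trans
        (prod_mono hχ.inside hη.inside)⟩

theorem dRad_mul {χ : ℝ → ℝ} (hχ : IsTestOn 0 R χ) (η : ℝ → ℝ) :
    dRad (fun p => χ p.1 * η p.2) = fun p => deriv χ p.1 * η p.2 :=
  funext fun p => ((hχ.hasDerivAt p.1).mul_const (η p.2)).deriv

theorem dAng_mul {η : ℝ → ℝ} (hη : IsTestOn θ₁ θ₂ η) (χ : ℝ → ℝ) :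
    dAng (fun p => χ p.1 * η p.2) = fun p => χ p.1 * deriv η p.2 :=
  funext fun p => ((hη.hasDerivAt p.2).const_mul (χ p.1)).deriv

/-- The weak formulation satisfied by `U = u(t) - u(s)` and the time integrals `V`, `G`, `A` of `u`
and of the components of its gradient. -/
def WeakRelation (ε lam : ℝ) (U V G A : L2 R θ₁ θ₂) : Prop :=
  ∀ φ (hφ : IsTest R θ₁ θ₂ φ), ⟪U, hφ.isCc.memLp.toLp φ⟫_ℝ =
    -ε * (⟪G, hφ.isCc_dRad.memLp.toLp (dRad φ)⟫_ℝ +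
      ⟪A, hφ.isCc_dAng.div_fst.memLp.toLp (fun p => dAng φ p / p.1)⟫_ℝ) +
    lam * ⟪V, hφ.isCc.memLp.toLp φ⟫_ℝ

theorem exists_angular_pairing (f : Lp ℝ 2 (radMeas R)) :
    ∃ B : L2 R θ₁ θ₂ →L[ℝ] Lp ℝ 2 (angMeas θ₁ θ₂), ∀ U b, ⟪B U, b⟫_ℝ = ⟪U, tens f b⟫_ℝ := by
  refine ⟨adjoint (tensor (radMeas R) (angMeas θ₁ θ₂) f) ∘L
    ((areaIso R θ₁ θ₂).toContinuousLinearEquiv :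
      L2 R θ₁ θ₂ →L[ℝ] Lp ℝ 2 ((radMeas R).prod (angMeas θ₁ θ₂))), fun U b => ?_⟩
  rw [inner_tens, ContinuousLinearMap.comp_apply, adjoint_inner_left]
  rfl

variable {ε lam : ℝ} {U V G A : L2 R θ₁ θ₂}

/-- The sine is not compactly supported in the open angle. For fixed χ the weak equation is a linear
relation in η and η', and `inner_add_inner_deriv_eq_zero` extends it to η = sine. -/
theorem WeakRelation.mode (hθ : θ₁ < θ₂) (h : WeakRelation ε lam U V G A) (n : ℕ) {χ : ℝ → ℝ}
    (hχ : IsTestOn 0 R χ) :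
    ⟪modeOp R (sinVec θ₁ θ₂ n) U, (hχ.isNice.memLp R).toLp χ⟫_ℝ =
      -ε * (⟪modeOp R (sinVec θ₁ θ₂ n) G, (hχ.deriv.isNice.memLp R).toLp (deriv χ)⟫_ℝ +
        freq θ₁ θ₂ n * ⟪modeOp R (cosVec θ₁ θ₂ n) A,
          (hχ.isNice_inv_mul.memLp R).toLp (fun r => r⁻¹ * χ r)⟫_ℝ) +
      lam * ⟪modeOp R (sinVec θ₁ θ₂ n) V, (hχ.isNice.memLp R).toLp χ⟫_ℝ := by
  obtain ⟨B, hB⟩ := exists_angular_pairing (θ₁ := θ₁) (θ₂ := θ₂) ((hχ.isNice.memLp R).toLp χ)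
  obtain ⟨B', hB'⟩ := exists_angular_pairing (θ₁ := θ₁) (θ₂ := θ₂)
    ((hχ.deriv.isNice.memLp R).toLp (deriv χ))
  obtain ⟨D, hD⟩ := exists_angular_pairing (θ₁ := θ₁) (θ₂ := θ₂)
    ((hχ.isNice_inv_mul.memLp R).toLp (fun r => r⁻¹ * χ r))
  have key := inner_add_inner_deriv_eq_zero hθ (B U - lam • B V + ε • B' G) (ε • D A)
    (fun η hη => by
      have hη' := memLp_angMeas (θ₁ := θ₁) (θ₂ := θ₂) hη.smooth.continuous
      have h1 := h _ (hχ.isTest_mul hη)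
      have e1 : tens ((hχ.isNice.memLp R).toLp χ) (hη'.toLp η) =
        (hχ.isTest_mul hη).isCc.memLp.toLp _ := tens_toLp _ _
      have e2 : tens ((hχ.deriv.isNice.memLp R).toLp (deriv χ)) (hη'.toLp η) =
          (hχ.isTest_mul hη).isCc_dRad.memLp.toLp _ := by
        rw [tens_toLp]
        exact MemLp.toLp_congr _ _ (by rw [dRad_mul hχ])
      have e3 : tens ((hχ.isNice_inv_mul.memLp R).toLp (fun r => r⁻¹ * χ r))
          ((memLp_angMeas (θ₁ := θ₁) (θ₂ := θ₂) hη.deriv.smooth.continuous).toLp (deriv η)) =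
          (hχ.isTest_mul hη).isCc_dAng.div_fst.memLp.toLp _ := by
        rw [tens_toLp]
        refine MemLp.toLp_congr _ _ (Eventually.of_forall fun p => ?_)
        simp only [dAng_mul hη, div_eq_mul_inv]
        ring
      rw [inner_add_left, inner_sub_left, inner_smul_left, inner_smul_left, inner_smul_left, hB, hB,
        hB', hD, e1, e2, e3]
      simp only [conj_trivial]
      linear_combination h1) (hasDerivAt_angMode θ₁ θ₂ n)
    (continuous_const.mul (continuous_angCos θ₁ θ₂ n)) (angMode_left θ₁ θ₂ n) (angMode_right hθ n)
  have hc : (memLp_angMeas (θ₁ := θ₁) (θ₂ := θ₂)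
      (continuous_const.mul (continuous_angCos θ₁ θ₂ n))).toLp
        (fun θ => freq θ₁ θ₂ n * angCos θ₁ θ₂ n θ) = freq θ₁ θ₂ n • cosVec θ₁ θ₂ n := by
    rw [cosVec, ← MemLp.toLp_const_smul]
    rfl
  rw [hc, ← sinVec, inner_add_left, inner_sub_left, inner_smul_left, inner_smul_left,
    inner_smul_left, inner_smul_right, hB, hB, hB', hD] at key
  simp only [conj_trivial] at key
  rw [inner_modeOp, inner_modeOp, inner_modeOp, inner_modeOp]
  linear_combination key

/-- The relations between the `n`-th modes of `v` and its gradient `(g, h)` for boundary values `β`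
on the arc. -/
structure ModeRelation (n : ℕ) (hμ : 0 < freq θ₁ θ₂ n) (β : ℝ) (v g h : L2 R θ₁ θ₂) : Prop where
  eq_adjoint : modeOp R (sinVec θ₁ θ₂ n) v = adjoint (hOp hμ R)
    (modeOp R (cosVec θ₁ θ₂ n) h - modeOp R (sinVec θ₁ θ₂ n) g) + β • eVec hμ R
  compat : ∀ χ (hχ : IsTestOn 0 R χ),
    ⟪modeOp R (cosVec θ₁ θ₂ n) h, (hχ.deriv.isNice.memLp R).toLp (deriv χ)⟫_ℝ +
      freq θ₁ θ₂ n * ⟪modeOp R (sinVec θ₁ θ₂ n) g,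
        (hχ.isNice_inv_mul.memLp R).toLp (fun r => r⁻¹ * χ r)⟫_ℝ = 0

/-- The equation of the `n`-th mode, with the Laplacian inverted. -/
theorem WeakRelation.mode_equation (hR : 0 < R) (hθ : θ₁ < θ₂) {n : ℕ} (hμ : 0 < freq θ₁ θ₂ n)
    (h : WeakRelation ε lam U V G A) {β : ℝ} (hm : ModeRelation n hμ β V G A) :
    adjoint (hOp hμ R) (hOp hμ R (modeOp R (sinVec θ₁ θ₂ n) U)) =
      -(ε • modeOp R (sinVec θ₁ θ₂ n) V) + (ε * β) • eVec hμ R +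
        lam • adjoint (hOp hμ R) (hOp hμ R (modeOp R (sinVec θ₁ θ₂ n) V)) := by
  set q := modeOp R (cosVec θ₁ θ₂ n) A - modeOp R (sinVec θ₁ θ₂ n) G with hq
  -- This is the mode equation after inverting one factor. Replacing χ by -H*(χ' - μχ/r) and using
  -- the compatibility relation shows that the left side is orthogonal to the total family of all χ'
  -- - μχ/r.
  have hY : hOp hμ R (modeOp R (sinVec θ₁ θ₂ n) U) + ε • q -
      lam • hOp hμ R (modeOp R (sinVec θ₁ θ₂ n) V) = 0 := by
    refine eq_zero_of_forall_inner_radD hR hμ _ fun χ hχ => ?_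
    have h1 := h.mode hθ n hχ
    have h2 := hm.compat χ hχ
    have h3 : ∀ x : Lp ℝ 2 (radMeas R), ⟪x, (hχ.isNice.memLp R).toLp χ⟫_ℝ =
        -⟪hOp hμ R x, ((hχ.isNice_radD (μ := freq θ₁ θ₂ n)).memLp R).toLp
          (radD (freq θ₁ θ₂ n) χ)⟫_ℝ := fun x => by
      rw [hχ.toLp_eq_neg_adjoint hR hμ, inner_neg_right, adjoint_inner_right]
    have h4 : ((hχ.isNice_radD (μ := freq θ₁ θ₂ n)).memLp R).toLp (radD (freq θ₁ θ₂ n) χ) =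
        (hχ.deriv.isNice.memLp R).toLp (deriv χ) - freq θ₁ θ₂ n •
          (hχ.isNice_inv_mul.memLp R).toLp (fun r => r⁻¹ * χ r) := by
      rw [← MemLp.toLp_const_smul, ← MemLp.toLp_sub]
      rfl
    have h5 : ⟪q, ((hχ.isNice_radD (μ := freq θ₁ θ₂ n)).memLp R).toLp
          (radD (freq θ₁ θ₂ n) χ)⟫_ℝ =
        -(⟪modeOp R (sinVec θ₁ θ₂ n) G, (hχ.deriv.isNice.memLp R).toLp (deriv χ)⟫_ℝ +
        freq θ₁ θ₂ n * ⟪modeOp R (cosVec θ₁ θ₂ n) A,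
          (hχ.isNice_inv_mul.memLp R).toLp (fun r => r⁻¹ * χ r)⟫_ℝ) := by
      rw [h4, hq]
      simp only [inner_sub_left, inner_sub_right, inner_smul_right]
      linear_combination h2
    rw [h3, h3] at h1
    rw [inner_sub_left, inner_add_left, inner_smul_left, inner_smul_left, h5]
    simp only [conj_trivial]
    linear_combination -h1
  have h6 := congrArg (adjoint (hOp hμ R)) hY
  have h7 := hm.eq_adjoint
  rw [← hq] at h7
  simp only [map_add, map_sub, map_smul, map_zero] at h6
  -- Applying H* inverts the second factor, and here the boundary value enters.
  have h8 : adjoint (hOp hμ R) q = modeOp R (sinVec θ₁ θ₂ n) V - β • eVec hμ R := by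
    rw [h7]
    abel
  rw [h8, sub_eq_zero, ← eq_sub_iff_add_eq] at h6
  rw [h6]
  module

end WeakEquation

/-! ### Time integrals of the closed-loop solution -/

section TimeIntegrals

variable {R θ₁ θ₂ ε lam c : ℝ} {N : ℕ}

theorem intervalIntegrable_of_continuousOn_Ici {E : Type*} [NormedAddCommGroup E] {u : ℝ → E}
    (hu : ContinuousOn u (Ici 0)) {s t : ℝ} (hs : 0 < s) (hst : s ≤ t) :
    IntervalIntegrable u volume s t := by
  refine (hu.mono fun x hx => ?_).intervalIntegrable
  rw [uIcc_of_le hst] at hx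
  exact hs.le.trans hx.1

theorem intervalIntegrable_of_memLp {E : Type*} [NormedAddCommGroup E] {u : ℝ → E} {s t : ℝ}
    (hst : s ≤ t) (hu : MemLp u 2 (volume.restrict (Icc s t))) : IntervalIntegrable u volume s t :=
  (intervalIntegrable_iff_integrableOn_Icc_of_le hst).2 (hu.integrable one_le_two)

theorem integral_linear_relation {E F : Type*} [NormedAddCommGroup E] [NormedSpace ℝ E]
    [CompleteSpace E] [NormedAddCommGroup F] [NormedSpace ℝ F] [CompleteSpace F]
    (L₁ L₂ L₃ : E →L[ℝ] F) {v g h : ℝ → E} {s t : ℝ} (hs : 0 < s) (hst : s ≤ t)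
    (hv : IntervalIntegrable v volume s t) (hg : IntervalIntegrable g volume s t)
    (hh : IntervalIntegrable h volume s t)
    (heq : ∀ᵐ τ ∂volume.restrict (Ioi (0 : ℝ)), L₁ (v τ) + L₂ (g τ) + L₃ (h τ) = 0) :
    L₁ (∫ τ in s..t, v τ) + L₂ (∫ τ in s..t, g τ) + L₃ (∫ τ in s..t, h τ) = 0 := by
  have i1 : IntervalIntegrable (fun τ => L₁ (v τ)) volume s t := ⟨L₁.integrable_comp hv.1,
    L₁.integrable_comp hv.2⟩
  have i2 : IntervalIntegrable (fun τ => L₂ (g τ)) volume s t := ⟨L₂.integrable_comp hg.1,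
    L₂.integrable_comp hg.2⟩
  have i3 : IntervalIntegrable (fun τ => L₃ (h τ)) volume s t := ⟨L₃.integrable_comp hh.1,
    L₃.integrable_comp hh.2⟩
  rw [← L₁.intervalIntegral_comp_comm hv, ← L₂.intervalIntegral_comp_comm hg,
    ← L₃.intervalIntegral_comp_comm hh, ← intervalIntegral.integral_add i1 i2,
    ← intervalIntegral.integral_add (i1.add i2) i3]
  refine intervalIntegral.integral_zero_ae ?_
  filter_upwards [(ae_restrict_iff' measurableSet_Ioi).1 heq] with τ hτ hτ'
  rw [uIoc_of_le hst] at hτ'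
  exact hτ (hs.trans hτ'.1)

/-- All relations are bounded linear in (u, ∇u), including the feedback coefficient, so they pass
from almost every time to integrals over [s,t]. Positivity of s is needed because ∇u is square
integrable only away from time 0. -/
theorem IsClosedLoopSolution.exists_relations (hR : 0 < R) (hθ : θ₁ < θ₂)
    (hκ : 0 ≤ (lam + c) / ε) {u : ℝ → L2 R θ₁ θ₂} (hu : IsClosedLoopSolution ε lam c R θ₁ θ₂ N u)
    {s t : ℝ} (hs : 0 < s) (hst : s ≤ t) :
    ∃ G A : L2 R θ₁ θ₂, WeakRelation ε lam (u t - u s) (∫ τ in s..t, u τ) G A ∧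
      ∀ (n : ℕ) (hn : 1 ≤ n), ModeRelation n (freq_pos hθ hn)
        (feedbackCoeff hκ hθ N (∫ τ in s..t, u τ) n) (∫ τ in s..t, u τ) G A := by
  obtain ⟨hc, ur, ua, hint, hae, hweak⟩ := hu
  have iu := intervalIntegrable_of_continuousOn_Ici hc hs hst
  have ir := intervalIntegrable_of_memLp hst (hint s t hs).1
  have ia := intervalIntegrable_of_memLp hst (hint s t hs).2
  refine ⟨∫ τ in s..t, ur τ, ∫ τ in s..t, ua τ, fun φ hφ => ?_, fun n hn => ?_⟩
  · have h1 := hweak φ hφ s t hs hst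
    have e1 : ∀ v : L2 R θ₁ θ₂, ∫ p, v p * φ p ∂area R θ₁ θ₂ =
      ⟪v, hφ.isCc.memLp.toLp φ⟫_ℝ := fun v =>
        (inner_eq_integral (ae_eq_refl v) (MemLp.coeFn_toLp _)).symm
    have e2 : ∀ g h : L2 R θ₁ θ₂, ∫ p, (g p * dRad φ p + h p * (dAng φ p / p.1)) ∂area R θ₁ θ₂ =
        ⟪g, hφ.isCc_dRad.memLp.toLp (dRad φ)⟫_ℝ +
          ⟪h, hφ.isCc_dAng.div_fst.memLp.toLp (fun p => dAng φ p / p.1)⟫_ℝ := fun g h => by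
      rw [inner_eq_integral (ae_eq_refl g) (MemLp.coeFn_toLp _),
        inner_eq_integral (ae_eq_refl h) (MemLp.coeFn_toLp _)]
      exact integral_add (MemLp.integrable_mul (Lp.memLp g) hφ.isCc_dRad.memLp)
        (MemLp.integrable_mul (Lp.memLp h) hφ.isCc_dAng.div_fst.memLp)
    simp only [e1, e2] at h1
    have e3 : ∀ {v : ℝ → L2 R θ₁ θ₂} (w : L2 R θ₁ θ₂), IntervalIntegrable v volume s t →
        IntervalIntegrable (fun τ => ⟪v τ, w⟫_ℝ) volume s t ∧
          ∫ τ in s..t, ⟪v τ, w⟫_ℝ = ⟪∫ τ in s..t, v τ, w⟫_ℝ := by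
      intro v w hv
      simp only [real_inner_comm w]
      exact ⟨⟨(innerSL ℝ w).integrable_comp hv.1, (innerSL ℝ w).integrable_comp hv.2⟩,
        (innerSL ℝ w).intervalIntegral_comp_comm hv⟩
    have j1 := e3 (hφ.isCc_dRad.memLp.toLp (dRad φ)) ir
    have j2 := e3 (hφ.isCc_dAng.div_fst.memLp.toLp (fun p => dAng φ p / p.1)) ia
    have j3 := e3 (hφ.isCc.memLp.toLp φ) iu
    rw [inner_sub_left, h1, intervalIntegral.integral_add ((j1.1.add j2.1).const_mul _)
      (j3.1.const_mul _), intervalIntegral.integral_const_mul, intervalIntegral.integral_const_mul,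
      intervalIntegral.integral_add j1.1 j2.1, j1.2, j2.2, j3.2]
  · have hrel : ∀ᵐ τ ∂volume.restrict (Ioi (0 : ℝ)), ModeRelation n (freq_pos hθ hn)
        (feedbackCoeff hκ hθ N (u τ) n) (u τ) (ur τ) (ua τ) := by
      filter_upwards [hae] with τ hτ
      have h1 := modes_of_hasBoundaryValues hR hθ hκ hτ.1 hτ.2 hn
      exact ⟨h1.1, h1.2⟩
    set S := modeOp R (sinVec θ₁ θ₂ n)
    set C := modeOp R (cosVec θ₁ θ₂ n)
    set H := adjoint (hOp (freq_pos hθ hn) R)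
    obtain ⟨k, hk⟩ : ∃ k : L2 R θ₁ θ₂ →L[ℝ] ℝ, ∀ v, feedbackCoeff hκ hθ N v n = k v := by
      by_cases h : 1 ≤ n ∧ n ≤ N
      · exact ⟨innerSL ℝ (gainVec hκ (freq_pos hθ hn) R) ∘L S, fun v => by
          rw [feedbackCoeff, dif_pos h]
          rfl⟩
      · exact ⟨0, fun v => by
          rw [feedbackCoeff, dif_neg h]
          rfl⟩
    constructor
    · have h1 := integral_linear_relation (S - k.smulRight (eVec (freq_pos hθ hn) R)) (H ∘L S)
        (-(H ∘L C)) hs hst iu ir ia (by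
          filter_upwards [hrel] with τ hτ
          have h2 := hτ.eq_adjoint
          rw [hk] at h2
          simp only [sub_apply, neg_apply, ContinuousLinearMap.comp_apply, smulRight_apply]
          change S (u τ) = H (C (ua τ) - S (ur τ)) + _ at h2
          rw [h2, map_sub]
          abel)
      simp only [sub_apply, neg_apply, ContinuousLinearMap.comp_apply, smulRight_apply] at h1
      rw [hk]
      change S _ = H (C _ - S _) + _
      rw [map_sub, ← sub_eq_zero, ← h1]
      abel
    · intro χ hχ
      have h1 := integral_linear_relation 0
        (freq θ₁ θ₂ n • innerSL ℝ ((hχ.isNice_inv_mul.memLp R).toLp (fun r => r⁻¹ * χ r)) ∘L S)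
        (innerSL ℝ ((hχ.deriv.isNice.memLp R).toLp (deriv χ)) ∘L C) hs hst iu ir ia (by
          filter_upwards [hrel] with τ hτ
          have h2 := hτ.compat χ hχ
          simp only [zero_apply, smul_apply, ContinuousLinearMap.comp_apply, innerSL_apply_apply,
            smul_eq_mul, zero_add]
          rw [real_inner_comm, real_inner_comm (C _), add_comm]
          exact h2)
      simp only [zero_apply, smul_apply, ContinuousLinearMap.comp_apply, innerSL_apply_apply,
            smul_eq_mul, zero_add] at h1
      rw [real_inner_comm, real_inner_comm (C _), add_comm] at h1
      exact h1

end TimeIntegrals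

/-! ### Decay of the modes and of the solution -/

section Decay

variable {R θ₁ θ₂ ε lam c : ℝ} {N : ℕ}

/-- Decay of the modes that are not controlled. -/
theorem norm_mode_le_of_lt (hε : 0 < ε) (hlc : 0 ≤ c + lam) (hR : 0 < R) (hθ : θ₁ < θ₂)
    (hN : Real.sqrt ((c + lam) / ε) * ((θ₂ - θ₁) * R) / Real.pi < (N : ℝ))
    {u : ℝ → L2 R θ₁ θ₂} (hu : IsClosedLoopSolution ε lam c R θ₁ θ₂ N u) {n : ℕ} (hn : N < n)
    {t : ℝ} (ht : 0 ≤ t) :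
    ‖modeOp R (sinVec θ₁ θ₂ n) (u t)‖ ≤
      Real.exp (-c * t) * ‖modeOp R (sinVec θ₁ θ₂ n) (u 0)‖ := by
  have hn1 : 1 ≤ n := by omega
  have hκ : 0 ≤ (lam + c) / ε := div_nonneg (by linarith) hε.le
  have hμ := freq_pos hθ hn1
  have hL := sub_pos.2 hθ
  refine norm_le_exp_mul_of_adjoint_comp_self_eq (hOp hμ R) (hOp_injective hR hμ) (ε := ε)
    (a := lam) (by linarith) ?_ ((modeOp R _).continuous.comp_continuousOn hu.1) ?_ ht
  · have h1 := norm_hOp_le hR hμ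
    -- This is where the lower bound on N is used: n > N makes ((c+λ)/ε)(R/μ)² ≤ 1.
    have h2 : Real.sqrt ((c + lam) / ε) * (R / freq θ₁ θ₂ n) ≤ 1 := by
      have h3 : Real.sqrt ((c + lam) / ε) * ((θ₂ - θ₁) * R) / Real.pi < n :=
        hN.trans (by exact_mod_cast hn)
      have hn0 : (0 : ℝ) < n := by exact_mod_cast hn1
      rw [div_lt_iff₀ Real.pi_pos] at h3
      have h4 : Real.sqrt ((c + lam) / ε) * (R / freq θ₁ θ₂ n) =
          Real.sqrt ((c + lam) / ε) * ((θ₂ - θ₁) * R) / (n * Real.pi) := by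
        rw [freq]
        field_simp
      rw [h4, div_le_one (by positivity)]
      exact h3.le
    have h5 : (c + lam) / ε * ‖hOp hμ R‖ ^ 2 ≤ 1 := by
      rw [← Real.sq_sqrt (show 0 ≤ (c + lam) / ε by positivity), ← mul_pow]
      refine pow_le_one₀ (by positivity) (le_trans ?_ h2)
      gcongr
    rw [div_mul_eq_mul_div, div_le_one hε] at h5
    rwa [add_comm lam]
  · intro s t hs hst
    obtain ⟨G, A, hw, hm⟩ := hu.exists_relations hR hθ hκ hs hst
    have h1 := hw.mode_equation hR hθ hμ (hm n hn1)
    have h2 : feedbackCoeff hκ hθ N (∫ τ in s..t, u τ) n = 0 := dif_neg fun h => hn.not_ge h.2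
    rw [h2, mul_zero, zero_smul, add_zero, map_sub] at h1
    rw [← (modeOp R (sinVec θ₁ θ₂ n)).intervalIntegral_comp_comm
      (intervalIntegrable_of_continuousOn_Ici hu.1 hs hst)] at h1
    exact h1

/-- Decay of the controlled modes. -/
theorem exists_norm_mode_le (hε : 0 < ε) (hlc : 0 ≤ c + lam) (hR : 0 < R) (hθ : θ₁ < θ₂) {n : ℕ}
    (hn : 1 ≤ n) (hnN : n ≤ N) :
    ∃ C : ℝ, 0 ≤ C ∧ ∀ u : ℝ → L2 R θ₁ θ₂, IsClosedLoopSolution ε lam c R θ₁ θ₂ N u →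
      ∀ t, 0 ≤ t → ‖modeOp R (sinVec θ₁ θ₂ n) (u t)‖ ≤
        C * (Real.exp (-c * t) * ‖modeOp R (sinVec θ₁ θ₂ n) (u 0)‖) := by
  have hκ : 0 ≤ (lam + c) / ε := div_nonneg (by linarith) hε.le
  have hμ := freq_pos hθ hn
  set E := NormedSpace.exp (((lam + c) / ε / 4) • volterra hμ R) with hE
  let _ : NormedAlgebra ℚ (Lp ℝ 2 (radMeas R) →L[ℝ] Lp ℝ 2 (radMeas R)) :=
    NormedAlgebra.restrictScalars ℚ ℝ _
  -- A left inverse suffices to return from the transformed mode; it exists since an exponential is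
  -- always a unit.
  obtain ⟨B, hB⟩ := (NormedSpace.isUnit_exp (((lam + c) / ε / 4) • volterra hμ R)).exists_left_inv
  rw [← hE] at hB
  refine ⟨‖B‖ * ‖E‖, by positivity, fun u hu t ht => ?_⟩
  set S := modeOp R (sinVec θ₁ θ₂ n) with hS
  have key : ‖E (S (u t))‖ ≤ Real.exp (-c * t) * ‖E (S (u 0))‖ := by
    -- With a = -c the norm condition reads 0 ≤ ε, so no bound on H is needed for controlled modes.
    refine norm_le_exp_mul_of_adjoint_comp_self_eq (hOp hμ R) (hOp_injective hR hμ) (ε := ε)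
      (a := -c) (w := fun τ => E (S (u τ))) (by simp) (by simpa using hε.le)
      ((E ∘L S).continuous.comp_continuousOn hu.1) ?_ ht
    intro s t hs hst
    obtain ⟨G, A, hw, hm⟩ := hu.exists_relations hR hθ hκ hs hst
    have h1 := hw.mode_equation hR hθ hμ (hm n hn)
    have h2 : ∫ τ in s..t, E (S (u τ)) = E (S (∫ τ in s..t, u τ)) :=
      (E ∘L S).intervalIntegral_comp_comm (intervalIntegrable_of_continuousOn_Ici hu.1 hs hst)
    rw [h2]
    set V := ∫ τ in s..t, u τ
    have h3 : feedbackCoeff hκ hθ N V n = ⟪gainVec hκ hμ R, S V⟫_ℝ := dif_pos ⟨hn, hnN⟩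
    rw [h3, ← hS] at h1
    -- The vector under T plays the role of L(SV), read off from the integrated equation.
    have h4 : S V = -(adjoint (hOp hμ R) ∘L hOp hμ R) (ε⁻¹ • (S (u t - u s) - lam • S V)) +
        ⟪gainVec hκ hμ R, S V⟫_ℝ • eVec hμ R := by
      simp only [ContinuousLinearMap.comp_apply, map_smul, map_sub] at h1 ⊢
      rw [h1]
      match_scalars <;> field_simp <;> ring
    have h5 := hasSum_inner_volterra_pow hR hμ hκ (S V)
    rw [← inner_gainVec hκ hμ] at h5
    have h6 := exp_smul_apply_of_commutator _ (volterra hμ R) (eVec hμ R)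
      (volterra_apply_of_eq hR hμ) ((lam + c) / ε / 4) h4 h5
    -- The feedback coefficient cancels the boundary value created by the exponential, so the
    -- transformed mode is homogeneous at R.
    rw [add_neg_cancel, zero_smul, add_zero, ← hE] at h6
    -- With s = (λ+c)/(4ε), the shift ε·4s = λ+c replaces the reaction coefficient λ by -c.
    have h7 : E (S (u t)) - E (S (u s)) = ε • E (ε⁻¹ • (S (u t - u s) - lam • S V) +
        (4 * ((lam + c) / ε / 4)) • S V) - c • E (S V) := by
      simp only [map_add, map_sub, map_smul]
      match_scalars <;> field_simp
      ring
    rw [ContinuousLinearMap.comp_apply] at h6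
    rw [h7, map_sub, map_sub, map_smul, map_smul, map_smul, map_smul]
    generalize E (ε⁻¹ • _ + _) = y at h6
    rw [← neg_eq_iff_eq_neg] at h6
    rw [← h6]
    module
  have h8 : B (E (S (u t))) = S (u t) := by
    rw [← mul_apply_eq_comp, hB, one_apply_eq_self]
  calc ‖S (u t)‖ = ‖B (E (S (u t)))‖ := by rw [h8]
    _ ≤ ‖B‖ * ‖E (S (u t))‖ := B.le_opNorm _
    _ ≤ ‖B‖ * (Real.exp (-c * t) * (‖E‖ * ‖S (u 0)‖)) := by
      gcongr
      exact key.trans (by gcongr; exact E.le_opNorm _)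
    _ = _ := by ring

/-- Uniform decay of the modes gives decay in `L²(Ω)`. -/
theorem norm_le_of_norm_mode_le (hθ : θ₁ < θ₂) {K : ℝ} (hK : 0 ≤ K) {U V : L2 R θ₁ θ₂}
    (h : ∀ n, 1 ≤ n → ‖modeOp R (sinVec θ₁ θ₂ n) U‖ ≤ K * ‖modeOp R (sinVec θ₁ θ₂ n) V‖) :
    ‖U‖ ≤ K * ‖V‖ := by
  have hL := sub_pos.2 hθ
  have h1 := hasSum_le (fun n => by
    rw [← mul_pow]
    exact pow_le_pow_left₀ (norm_nonneg _) (h (n + 1) (Nat.le_add_left 1 n)) 2)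
    (hasSum_norm_sq_modeOp hθ U) ((hasSum_norm_sq_modeOp hθ V).mul_left (K ^ 2))
  rw [mul_left_comm, ← mul_pow] at h1
  exact (pow_le_pow_iff_left₀ (norm_nonneg _) (by positivity) two_ne_zero).1
    (le_of_mul_le_mul_left h1 (by positivity))

end Decay

end Sector

theorem mainTheorem3 (ε lam c R θ₁ θ₂ : ℝ) (N : ℕ)
    (hε : 0 < ε) (hc : 0 < c) (hlc : 0 ≤ c + lam) (hR : 0 < R) (hθ : θ₁ < θ₂)
    (hN : Real.sqrt ((c + lam) / ε) * ((θ₂ - θ₁) * R) / Real.pi < (N : ℝ)) :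
    ∃ M : ℝ, 0 < M ∧
      ∀ u : ℝ → Sector.L2 R θ₁ θ₂,
        Sector.IsClosedLoopSolution ε lam c R θ₁ θ₂ N u →
        ∀ t : ℝ, 0 ≤ t → ‖u t‖ ≤ M * Real.exp (-c * t) * ‖u 0‖ := by
  have h1 : ∀ n, ∃ C : ℝ, 0 ≤ C ∧ (1 ≤ n → n ≤ N → ∀ u : ℝ → Sector.L2 R θ₁ θ₂,
      Sector.IsClosedLoopSolution ε lam c R θ₁ θ₂ N u → ∀ t, 0 ≤ t →
        ‖Sector.modeOp R (Sector.sinVec θ₁ θ₂ n) (u t)‖ ≤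
          C * (Real.exp (-c * t) * ‖Sector.modeOp R (Sector.sinVec θ₁ θ₂ n) (u 0)‖)) := by
    intro n
    by_cases h : 1 ≤ n ∧ n ≤ N
    · obtain ⟨C, hC, h2⟩ := Sector.exists_norm_mode_le hε hlc hR hθ h.1 h.2
      exact ⟨C, hC, fun _ _ => h2⟩
    · exact ⟨0, le_rfl, fun h3 h4 => absurd ⟨h3, h4⟩ h⟩
  choose C hC0 hC using h1
  have hsum : 0 ≤ ∑ n ∈ Finset.Icc 1 N, C n := Finset.sum_nonneg fun n _ => hC0 n
  -- One constant for all modes: the sum dominates each of the N controlled constants, and the 1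
  -- serves the uncontrolled modes.
  refine ⟨1 + ∑ n ∈ Finset.Icc 1 N, C n, by positivity, fun u hu t ht => ?_⟩
  refine Sector.norm_le_of_norm_mode_le hθ (by positivity) fun n hn => ?_
  rw [mul_assoc]
  rcases le_or_gt n N with hnN | hnN
  · refine (hC n hn hnN u hu t ht).trans ?_
    gcongr
    have := Finset.single_le_sum (fun n _ => hC0 n) (Finset.mem_Icc.2 ⟨hn, hnN⟩)
    linarith
  · refine (Sector.norm_mode_le_of_lt hε hlc hR hθ hN hu hnN ht).trans ?_
    exact le_mul_of_one_le_left (by positivity) (by linarith)
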